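/- Composites are written in diagrammatic order: $f;g$ means first $f$, then $g$. An \emph{oplax functor} of bicategories has nullary constraints $F(1_X)\to 1_{FX}$ and binary constraints $F(f;g)\to Ff;Fg$ (natural, associative and unital); it is \emph{normal} if the nullary constraints are invertible, a \emph{pseudofunctor} if all constraints are invertible, and \emph{gregarious} if it is normal and the constraint $F(f;g)\to Ff;Fg$ is invertible whenever $g$ has a right adjoint. An \emph{icon} $\alpha\colon F\Rightarrow G$ between oplax functors that agree on objects is a family of 2-cells $\alpha_f\colon Ff\to Gf$, natural in the 1-cell $f$ and compatible with the binary and nullary constraints; there are no icons between functors that differ on objects. $\mathbf{Icon}(\mathscr A,\mathscr C)$ is the category of pseudofunctors $\mathscr A\to\mathscr C$ and icons. Let $\mathcal E$ be a category with chosen pullbacks, chosen such that identities pull back to identities, and let $\mathscr C$ be a bicategory. Let $\mathbf{Span}_{\mathrm{iso}}(\mathcal E)$ be the bicategory with the objects of $\mathcal E$, with 1-cells $X\to Y$ the spans $(s,t)=(X\xleftarrow{s}T\xrightarrow{t}Y)$ composed by the chosen pullbacks, and with 2-cells the isomorphisms of spans. There are pseudofunctors $(-)_\otimes\colon\mathcal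 E\to\mathbf{Span}_{\mathrm{iso}}(\mathcal E)$, $f\mapsto(1,f)$, and $(-)_\Delta\colon\mathcal E^{\mathrm{op}}\to\mathbf{Span}_{\mathrm{iso}}(\mathcal E)$, $f\mapsto(f,1)$, both the identity on objects. Let $\mathbf{Greg}_{\otimes,\Delta}(\mathbf{Span}_{\mathrm{iso}}(\mathcal E),\mathscr C)$ be the category whose objects are the gregarious functors $F\colon\mathbf{Span}_{\mathrm{iso}}(\mathcal E)\to\mathscr C$ whose composites $F_\otimes$ and $F_\Delta$ with $(-)_\otimes$ and $(-)_\Delta$ are pseudofunctors and whose constraints $F(s,t)\to F(s,1);F(1,t)$ are invertible for all spans $(s,t)$, and whose morphisms are icons. A \emph{lax Beck pair} is a pair of pseudofunctors $F_\otimes\colon\mathcal E\to\mathscr C$ and $F_\Delta\colon\mathcal E^{\mathrm{op}}\to\mathscr C$ that agree on objects, together with, for every pullback square $g';f=f';g$ in $\mathcal E$ (where $f'$ is parallel to $f$ and $g'$ is parallel to $g$), a 2-cell $$\mathfrak b^{f',g'}_{f,g}\colon F_\Delta g';F_\otimes f'\longrightarrow F_\otimes f;F_\Delta g$$ subject to the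 Beck--Chevalley coherence conditions (associativity and unit isomorphisms of $\mathscr C$ are suppressed, and $\cong$ denotes constraints of $F_\otimes$ and $F_\Delta$): 1. (horizontal) if $g'';f_2=f_2';g'$ and $g';f_1=f_1';g$ are pullback squares, then $\mathfrak b^{f_2';f_1',\,g''}_{f_2;f_1,\,g}$ is the composite $$F_\Delta g'';F_\otimes(f_2';f_1')\cong F_\Delta g'';F_\otimes f_2';F_\otimes f_1'\to F_\otimes f_2;F_\Delta g';F_\otimes f_1'\to F_\otimes f_2;F_\otimes f_1;F_\Delta g\cong F_\otimes(f_2;f_1);F_\Delta g$$ whose two middle 2-cells are $\mathfrak b^{f_2',g''}_{f_2,g'};F_\otimes f_1'$ and $F_\otimes f_2;\mathfrak b^{f_1',g'}_{f_1,g}$; 2. (vertical) if $g_2';f'=f'';g_2$ and $g_1';f=f';g_1$ are pullback squares, then $\mathfrak b^{f'',\,g_2';g_1'}_{f,\,g_2;g_1}$ is the composite $$F_\Delta(g_2';g_1');F_\otimes f''\cong F_\Delta g_1';F_\Delta g_2';F_\otimes f''\to F_\Delta g_1';F_\otimes f';F_\Delta g_2\to F_\otimes f;F_\Delta g_1;F_\Delta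 g_2\cong F_\otimes f;F_\Delta(g_2;g_1)$$ whose two middle 2-cells are $F_\Delta g_1';\mathfrak b^{f'',g_2'}_{f',g_2}$ and $\mathfrak b^{f',g_1'}_{f,g_1};F_\Delta g_2$; 3. (horizontal nullary) for every $f$, the composite $F_\otimes f\cong F_\Delta 1;F_\otimes f\to F_\otimes f;F_\Delta 1\cong F_\otimes f$, with middle 2-cell $\mathfrak b^{f,1}_{f,1}$, is the identity; 4. (vertical nullary) for every $g$, the composite $F_\Delta g\cong F_\Delta g;F_\otimes 1\to F_\otimes 1;F_\Delta g\cong F_\Delta g$, with middle 2-cell $\mathfrak b^{1,g}_{1,g}$, is the identity. A morphism $(F_\otimes,F_\Delta,{}^F\mathfrak b)\to(G_\otimes,G_\Delta,{}^G\mathfrak b)$ of lax Beck pairs is a pair of icons $\alpha\colon F_\otimes\Rightarrow G_\otimes$, $\beta\colon F_\Delta\Rightarrow G_\Delta$ such that $(\beta_{g'}*\alpha_{f'})$ followed by ${}^G\mathfrak b^{f',g'}_{f,g}$ equals ${}^F\mathfrak b^{f',g'}_{f,g}$ followed by $(\alpha_f*\beta_g)$, for every pullback square, where $*$ is horizontal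 composition. Let $\mathbf{LaxBeckPair}(\mathcal E,\mathscr C)$ be the resulting category and $\mathbf{BeckPair}(\mathcal E,\mathscr C)$ its full subcategory on the \emph{Beck pairs}: the lax Beck pairs all of whose 2-cells $\mathfrak b^{f',g'}_{f,g}$ are invertible. **Theorem.** For $F$ in $\mathbf{Greg}_{\otimes,\Delta}(\mathbf{Span}_{\mathrm{iso}}(\mathcal E),\mathscr C)$, the pseudofunctors $F_\otimes$, $F_\Delta$ together with the 2-cells $$\mathfrak b^{f',g'}_{f,g}\colon F(g',1);F(1,f')\to F(g',f')\to F\big((1,f);(g,1)\big)\to F(1,f);F(g,1),$$ composed of the inverse of a constraint, the image under $F$ of the isomorphism of spans from $(g',f')$ to the span of projections of the chosen pullback of $f$ and $g$, and a constraint, form a lax Beck pair; and restriction of icons along $(-)_\otimes$ and $(-)_\Delta$ makes this a functor which is an equivalence of categories $$(-)_{\otimes\Delta}\colon\mathbf{Greg}_{\otimes,\Delta}(\mathbf{Span}_{\mathrm{iso}}(\mathcal E),\mathscr C)\simeq\mathbf{LaxBeckPair}(\mathcal E,\mathscr C).$$ It restricts to an equivalence of categories $$\mathbf{Icon}(\mathbf{Span}_{\mathrm{iso}}(\mathcal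 E),\mathscr C)\simeq\mathbf{BeckPair}(\mathcal E,\mathscr C).$$ -/

import Mathlib

open CategoryTheory Bicategory Opposite

attribute [-instance] CategoryTheory.catToReflQuiver

universe w w₁ w₂ v v₁ v₂ u u₁ u₂

namespace SpanBeck

/-! ### Chosen pullbacks -/

/-- A category with chosen pullbacks: for each cospan, a chosen pullback square. -/
class PullbackChoice (E : Type u) [Category.{v} E] where
  /-- the apex of the chosen pullback -/
  pt {X Y Z : E} (f : X ⟶ Z) (g : Y ⟶ Z) : E
  /-- the first projection -/
  fst {X Y Z : E} (f : X ⟶ Z) (g : Y ⟶ Z) : pt f g ⟶ X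
  /-- the second projection -/
  snd {X Y Z : E} (f : X ⟶ Z) (g : Y ⟶ Z) : pt f g ⟶ Y
  isPullback {X Y Z : E} (f : X ⟶ Z) (g : Y ⟶ Z) : IsPullback (fst f g) (snd f g) f g

/-- The chosen pullbacks are such that identities pull back to identities
(the other projection is then forced by commutativity of the square). -/
class PullbackChoice.IsNormal (E : Type u) [Category.{v} E] [PullbackChoice E] : Prop where
  fst_id {X Z : E} (f : X ⟶ Z) : ∃ h : pt f (𝟙 Z) = X, fst f (𝟙 Z) = eqToHom h
  snd_id {Y Z : E} (g : Y ⟶ Z) : ∃ h : pt (𝟙 Z) g = Y, snd (𝟙 Z) g = eqToHom h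

/-! ### The bicategory of spans -/

/-- The objects of the bicategory of spans in `E` are those of `E`. -/
structure SpanBicat (E : Type u) where
  /-- the underlying object -/
  as : E

section Span

variable {E : Type u} [Category.{v} E]

/-- Spans `X ⟵ T ⟶ Y` in `E`, with Mathlib's morphisms of spans. -/
abbrev Sp (X Y : E) := Span (⊤ : MorphismProperty E) (⊤ : MorphismProperty E) X Y

/-- The span `(s, t)`. -/
abbrev Sp.mk {T X Y : E} (s : T ⟶ X) (t : T ⟶ Y) : Sp X Y := ⟨T, s, t, trivial, trivial⟩

variable [PullbackChoice E]

open PullbackChoice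

/-- The morphism into a chosen pullback induced by a commutative square. -/
noncomputable def pbLift {W X Y Z : E} {f : X ⟶ Z} {g : Y ⟶ Z} (a : W ⟶ X) (b : W ⟶ Y)
    (h : a ≫ f = b ≫ g) : W ⟶ pt f g :=
  (isPullback f g).lift a b h

@[simp]
theorem pbLift_fst {W X Y Z : E} {f : X ⟶ Z} {g : Y ⟶ Z} (a : W ⟶ X) (b : W ⟶ Y)
    (h : a ≫ f = b ≫ g) : pbLift a b h ≫ fst f g = a :=
  (isPullback f g).lift_fst a b h

@[simp]
theorem pbLift_snd {W X Y Z : E} {f : X ⟶ Z} {g : Y ⟶ Z} (a : W ⟶ X) (b : W ⟶ Y)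
    (h : a ≫ f = b ≫ g) : pbLift a b h ≫ snd f g = b :=
  (isPullback f g).lift_snd a b h

@[simp]
theorem pbLift_fst_assoc {W X Y Z V : E} {f : X ⟶ Z} {g : Y ⟶ Z} (a : W ⟶ X) (b : W ⟶ Y)
    (h : a ≫ f = b ≫ g) (k : X ⟶ V) : pbLift a b h ≫ fst f g ≫ k = a ≫ k := by
  rw [← Category.assoc, pbLift_fst]

@[simp]
theorem pbLift_snd_assoc {W X Y Z V : E} {f : X ⟶ Z} {g : Y ⟶ Z} (a : W ⟶ X) (b : W ⟶ Y)
    (h : a ≫ f = b ≫ g) (k : Y ⟶ V) : pbLift a b h ≫ snd f g ≫ k = b ≫ k := by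
  rw [← Category.assoc, pbLift_snd]

theorem pb_w {X Y Z : E} (f : X ⟶ Z) (g : Y ⟶ Z) : fst f g ≫ f = snd f g ≫ g :=
  (isPullback f g).w

theorem pb_w_assoc {X Y Z V : E} (f : X ⟶ Z) (g : Y ⟶ Z) (k : Z ⟶ V) :
    fst f g ≫ f ≫ k = snd f g ≫ g ≫ k := by
  rw [← Category.assoc, pb_w, Category.assoc]

theorem pb_ext {W X Y Z : E} {f : X ⟶ Z} {g : Y ⟶ Z} {a b : W ⟶ pt f g}
    (h₁ : a ≫ fst f g = b ≫ fst f g) (h₂ : a ≫ snd f g = b ≫ snd f g) : a = b :=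
  (isPullback f g).hom_ext h₁ h₂

/-- Composition of spans, by the chosen pullback. -/
abbrev Sp.comp {X Y Z : E} (S : Sp X Y) (T : Sp Y Z) : Sp X Z :=
  Sp.mk (fst S.r T.l ≫ S.l) (snd S.r T.l ≫ T.r)

/-- Horizontal composition of a span with a morphism of spans. -/
@[simps]
noncomputable def Sp.whiskerLeft {X Y Z : E} (S : Sp X Y) {T T' : Sp Y Z} (η : T ⟶ T') :
    S.comp T ⟶ S.comp T' where
  hom := pbLift (fst S.r T.l) (snd S.r T.l ≫ η.hom) (by simp [pb_w])
  hom_l := by simp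
  hom_r := by simp

/-- Horizontal composition of a morphism of spans with a span. -/
@[simps]
noncomputable def Sp.whiskerRight {X Y Z : E} {S S' : Sp X Y} (η : S ⟶ S') (T : Sp Y Z) :
    S.comp T ⟶ S'.comp T where
  hom := pbLift (fst S.r T.l ≫ η.hom) (snd S.r T.l) (by simp [pb_w])
  hom_l := by simp
  hom_r := by simp

/-- The associativity isomorphism of spans. -/
@[simps]
noncomputable def Sp.assoc {W X Y Z : E} (S : Sp W X) (T : Sp X Y) (U : Sp Y Z) :
    (S.comp T).comp U ≅ S.comp (T.comp U) where
  hom :=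
    { hom := pbLift (fst (S.comp T).r U.l ≫ fst S.r T.l)
        (pbLift (fst (S.comp T).r U.l ≫ snd S.r T.l) (snd (S.comp T).r U.l)
          (by simpa using pb_w (S.comp T).r U.l))
        (by simp [pb_w])
      hom_l := by simp
      hom_r := by simp }
  inv :=
    { hom := pbLift (pbLift (fst S.r (T.comp U).l) (snd S.r (T.comp U).l ≫ fst T.r U.l)
          (by simpa using pb_w S.r (T.comp U).l))
        (snd S.r (T.comp U).l ≫ snd T.r U.l) (by simp [pb_w])
      hom_l := by simp
      hom_r := by simp }
  hom_inv_id := by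
    ext
    refine pb_ext (pb_ext ?_ ?_) ?_ <;> simp
  inv_hom_id := by
    ext
    refine pb_ext ?_ (pb_ext ?_ ?_) <;> simp

/-- The left unit isomorphism of spans. -/
@[simps]
noncomputable def Sp.leftUnitor {X Y : E} (S : Sp X Y) : (Sp.mk (𝟙 X) (𝟙 X)).comp S ≅ S where
  hom :=
    { hom := snd (𝟙 X) S.l
      hom_l := by simpa using (pb_w (𝟙 X) S.l).symm
      hom_r := by simp }
  inv :=
    { hom := pbLift S.l (𝟙 _) (by simp)
      hom_l := by simp
      hom_r := by simp }
  hom_inv_id := by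
    ext
    refine pb_ext ?_ ?_
    · simpa using (pb_w (𝟙 X) S.l).symm
    · simp
  inv_hom_id := by ext; simp

/-- The right unit isomorphism of spans. -/
@[simps]
noncomputable def Sp.rightUnitor {X Y : E} (S : Sp X Y) : S.comp (Sp.mk (𝟙 Y) (𝟙 Y)) ≅ S where
  hom :=
    { hom := fst S.r (𝟙 Y)
      hom_l := by simp
      hom_r := by simpa using pb_w S.r (𝟙 Y) }
  inv :=
    { hom := pbLift (𝟙 _) S.r (by simp)
      hom_l := by simp
      hom_r := by simp }
  hom_inv_id := by
    ext
    refine pb_ext ?_ ?_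
    · simp
    · simpa using pb_w S.r (𝟙 Y)
  inv_hom_id := by ext; simp

/-- The bicategory of spans in a category with chosen pullbacks. -/
noncomputable instance : Bicategory (SpanBicat E) where
  Hom X Y := Sp X.as Y.as
  id X := Sp.mk (𝟙 X.as) (𝟙 X.as)
  comp S T := Sp.comp S T
  homCategory X Y := inferInstanceAs (Category (Sp X.as Y.as))
  whiskerLeft S _ _ η := Sp.whiskerLeft S η
  whiskerRight η T := Sp.whiskerRight η T
  associator S T U := Sp.assoc S T U
  leftUnitor S := Sp.leftUnitor S
  rightUnitor S := Sp.rightUnitor S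
  whiskerLeft_id S T := by
    apply Span.hom_ext; refine pb_ext ?_ ?_ <;> simp
  whiskerLeft_comp S _ _ _ η θ := by
    apply Span.hom_ext; refine pb_ext ?_ ?_ <;> simp
  id_whiskerLeft {X Y S S'} η := by
    apply Span.hom_ext
    refine pb_ext ?_ ?_
    · simpa using pb_w (𝟙 X.as) S.l
    · simp
  comp_whiskerLeft S T _ _ η := by
    apply Span.hom_ext; refine pb_ext (pb_ext ?_ ?_) ?_ <;> simp
  id_whiskerRight S T := by
    apply Span.hom_ext; refine pb_ext ?_ ?_ <;> simp
  comp_whiskerRight η θ T := by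
    apply Span.hom_ext; refine pb_ext ?_ ?_ <;> simp
  whiskerRight_id {X Y S S'} η := by
    apply Span.hom_ext
    refine pb_ext ?_ ?_
    · simp
    · simpa using (pb_w S.r (𝟙 Y.as)).symm
  whiskerRight_comp η T U := by
    apply Span.hom_ext; refine pb_ext ?_ (pb_ext ?_ ?_) <;> simp
  whisker_assoc S _ _ η U := by
    apply Span.hom_ext; refine pb_ext (pb_ext ?_ ?_) ?_ <;> simp
  whisker_exchange η θ := by
    apply Span.hom_ext; refine pb_ext ?_ ?_ <;> simp
  pentagon S T U V := by
    apply Span.hom_ext; refine pb_ext ?_ (pb_ext ?_ (pb_ext ?_ ?_)) <;> simp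
  triangle S T := by
    apply Span.hom_ext; refine pb_ext ?_ ?_ <;> simp


variable (E) in
/-- `Span_iso(E)`: the bicategory of spans in `E` with only the invertible 2-cells. -/
abbrev SpanIso := Pith (SpanBicat E)

/-- An object of `E`, as an object of `Span_iso(E)`. -/
abbrev SpanIso.of (X : E) : SpanIso E := ⟨⟨X⟩⟩

/-- The span `(s, t)`, as a 1-cell of `Span_iso(E)`. -/
abbrev SpanIso.mk {T X Y : E} (s : T ⟶ X) (t : T ⟶ Y) : SpanIso.of X ⟶ SpanIso.of Y :=
  ⟨Sp.mk s t⟩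

/-- An isomorphism of spans, as an invertible 2-cell of `Span_iso(E)`. -/
noncomputable def SpanIso.iso {X Y : SpanIso E} {S T : X ⟶ Y} (e : S.of.apex ≅ T.of.apex)
    (hl : e.hom ≫ T.of.l = S.of.l) (hr : e.hom ≫ T.of.r = S.of.r) : S ≅ T :=
  Core.isoMk (Span.mkIso e hl hr)

/-- The canonical isomorphism of spans `(g', f') ≅ (1, f) ; (g, 1)` attached to a pullback square
`g' ≫ f = f' ≫ g`: it is induced by the universal property of the chosen pullback. -/
noncomputable def SpanIso.ofIsPullback {P X Y Z : E} {g' : P ⟶ X} {f' : P ⟶ Y} {f : X ⟶ Z}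
    {g : Y ⟶ Z} (h : IsPullback g' f' f g) :
    SpanIso.mk g' f' ≅ SpanIso.mk (𝟙 X) f ≫ SpanIso.mk g (𝟙 Y) :=
  SpanIso.iso
    (show P ≅ pt f g from
      { hom := pbLift g' f' h.w
        inv := h.lift (fst f g) (snd f g) (pb_w f g)
        hom_inv_id := h.hom_ext (by simp) (by simp)
        inv_hom_id := pb_ext (by simp) (by simp) })
    (show pbLift g' f' h.w ≫ fst f g ≫ 𝟙 X = g' by simp)
    (show pbLift g' f' h.w ≫ snd f g ≫ 𝟙 Y = f' by simp)

/-- The canonical isomorphism of spans `(s, t) ≅ (s, 1) ; (1, t)`. When identities pull back to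
identities this is an identity. -/
noncomputable def SpanIso.factor {T X Y : E} (s : T ⟶ X) (t : T ⟶ Y) :
    SpanIso.mk s t ≅ SpanIso.mk s (𝟙 T) ≫ SpanIso.mk (𝟙 T) t :=
  SpanIso.iso
    (show T ≅ pt (𝟙 T) (𝟙 T) from
      { hom := pbLift (𝟙 T) (𝟙 T) rfl
        inv := fst (𝟙 T) (𝟙 T)
        hom_inv_id := by simp
        inv_hom_id := pb_ext (by simp) (by simpa using pb_w (𝟙 T) (𝟙 T)) })
    (show pbLift (𝟙 T) (𝟙 T) rfl ≫ fst (𝟙 T) (𝟙 T) ≫ s = s by simp)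
    (show pbLift (𝟙 T) (𝟙 T) rfl ≫ snd (𝟙 T) (𝟙 T) ≫ t = t by simp)

/-- The canonical isomorphism of spans `(1, f ≫ g) ≅ (1, f) ; (1, g)`. -/
noncomputable def SpanIso.tensorComp {X Y Z : E} (f : X ⟶ Y) (g : Y ⟶ Z) :
    SpanIso.mk (𝟙 X) (f ≫ g) ≅ SpanIso.mk (𝟙 X) f ≫ SpanIso.mk (𝟙 Y) g :=
  SpanIso.iso
    (show X ≅ pt f (𝟙 Y) from
      { hom := pbLift (𝟙 X) f (by simp)
        inv := fst f (𝟙 Y)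
        hom_inv_id := by simp
        inv_hom_id := pb_ext (by simp) (by simpa using pb_w f (𝟙 Y)) })
    (show pbLift (𝟙 X) f _ ≫ fst f (𝟙 Y) ≫ 𝟙 X = 𝟙 X by simp)
    (show pbLift (𝟙 X) f _ ≫ snd f (𝟙 Y) ≫ g = f ≫ g by simp)

/-- The canonical isomorphism of spans `(g ≫ f, 1) ≅ (f, 1) ; (g, 1)`. -/
noncomputable def SpanIso.deltaComp {X Y Z : E} (f : Y ⟶ X) (g : Z ⟶ Y) :
    SpanIso.mk (g ≫ f) (𝟙 Z) ≅ SpanIso.mk f (𝟙 Y) ≫ SpanIso.mk g (𝟙 Z) :=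
  SpanIso.iso
    (show Z ≅ pt (𝟙 Y) g from
      { hom := pbLift g (𝟙 Z) (by simp)
        inv := snd (𝟙 Y) g
        hom_inv_id := by simp
        inv_hom_id := pb_ext (by simpa using (pb_w (𝟙 Y) g).symm) (by simp) })
    (show pbLift g (𝟙 Z) _ ≫ fst (𝟙 Y) g ≫ f = g ≫ f by simp)
    (show pbLift g (𝟙 Z) _ ≫ snd (𝟙 Y) g ≫ 𝟙 Z = 𝟙 Z by simp)

theorem tensor_assoc_aux {X Y Z : E} (f : X ⟶ Y) (g : Y ⟶ Z) (h₁ h₂ h₃ h₄ h₅ h₆) :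
    pbLift (f := f ≫ g) (g := 𝟙 Z) (𝟙 X) (f ≫ g) h₁ ≫
      pbLift (f := snd f (𝟙 Y) ≫ g) (g := 𝟙 Z)
        (fst (f ≫ g) (𝟙 Z) ≫ pbLift (𝟙 X) f h₂) (snd (f ≫ g) (𝟙 Z)) h₃ ≫
      pbLift (f := f) (g := fst g (𝟙 Z) ≫ 𝟙 Y) (fst (snd f (𝟙 Y) ≫ g) (𝟙 Z) ≫ fst f (𝟙 Y))
        (pbLift (fst (snd f (𝟙 Y) ≫ g) (𝟙 Z) ≫ snd f (𝟙 Y)) (snd (snd f (𝟙 Y) ≫ g) (𝟙 Z)) h₄)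
        h₅ ≫
      pbLift (f := f) (g := 𝟙 Y) (fst f (fst g (𝟙 Z) ≫ 𝟙 Y))
        (snd f (fst g (𝟙 Z) ≫ 𝟙 Y) ≫ fst g (𝟙 Z)) h₆ ≫ fst f (𝟙 Y) = 𝟙 X := by
  simp

theorem delta_assoc_aux {X Y Z : E} (f : X ⟶ Y) (g : Y ⟶ Z) (h₁ h₂ h₃ h₄ h₅ h₆) :
    pbLift (f := 𝟙 Y) (g := f) f (𝟙 X) h₁ ≫
      pbLift (f := snd (𝟙 Z) g ≫ 𝟙 Y) (g := f)
        (fst (𝟙 Y) f ≫ pbLift g (𝟙 Y) h₂) (snd (𝟙 Y) f) h₃ ≫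
      pbLift (f := 𝟙 Z) (g := fst (𝟙 Y) f ≫ g)
        (fst (snd (𝟙 Z) g ≫ 𝟙 Y) f ≫ fst (𝟙 Z) g)
        (pbLift (fst (snd (𝟙 Z) g ≫ 𝟙 Y) f ≫ snd (𝟙 Z) g) (snd (snd (𝟙 Z) g ≫ 𝟙 Y) f) h₄)
        h₅ ≫
      pbLift (f := 𝟙 Z) (g := f ≫ g) (fst (𝟙 Z) (fst (𝟙 Y) f ≫ g))
        (snd (𝟙 Z) (fst (𝟙 Y) f ≫ g) ≫ snd (𝟙 Y) f) h₆ ≫ snd (𝟙 Z) (f ≫ g) = 𝟙 X := by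
  simp

theorem SpanIso.eqToHom_tensor {X Y : E} {f g : X ⟶ Y} (h : f = g)
    (h' : SpanIso.mk (𝟙 X) f = SpanIso.mk (𝟙 X) g) : (eqToHom h').iso.hom.hom = 𝟙 X := by
  subst h; rfl

theorem SpanIso.eqToHom_delta {X Y : E} {f g : X ⟶ Y} (h : f = g)
    (h' : SpanIso.mk f (𝟙 X) = SpanIso.mk g (𝟙 X)) : (eqToHom h').iso.hom.hom = 𝟙 X := by
  subst h; rfl

variable (E) in
/-- The embedding `(-)_⊗ : E ⥤ Span_iso(E)`, sending `f : X ⟶ Y` to the span `(1, f)`. -/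
noncomputable def tensorEmb : LocallyDiscrete E ⥤ᵖ SpanIso E :=
  LocallyDiscrete.mkPseudofunctor (fun X => SpanIso.of X) (fun {X _} f => SpanIso.mk (𝟙 X) f)
    (fun _ => Iso.refl _) (fun f g => SpanIso.tensorComp f g)
    (fun {X Y Z W} f g h => by
      apply Pith.hom₂_ext
      apply Span.hom_ext
      rw [SpanIso.eqToHom_tensor (by simp)]
      exact tensor_assoc_aux f g _ _ _ _ _ _)
    (fun {X Y} f => by
      apply Pith.hom₂_ext
      apply Span.hom_ext
      rw [SpanIso.eqToHom_tensor (by simp)]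
      show pbLift _ _ _ ≫ pbLift _ _ _ ≫ snd _ _ = 𝟙 _
      simp)
    (fun {X Y} f => by
      apply Pith.hom₂_ext
      apply Span.hom_ext
      rw [SpanIso.eqToHom_tensor (by simp)]
      show pbLift _ _ _ ≫ pbLift _ _ _ ≫ fst _ _ = 𝟙 _
      simp)

variable (E) in
/-- The embedding `(-)_Δ : Eᵒᵖ ⥤ Span_iso(E)`, sending `f : X ⟶ Y` in `E` to the span `(f, 1)`
from `Y` to `X`. -/
noncomputable def deltaEmb : LocallyDiscrete Eᵒᵖ ⥤ᵖ SpanIso E :=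
  LocallyDiscrete.mkPseudofunctor (fun X => SpanIso.of X.unop)
    (fun {_ Y} f => SpanIso.mk f.unop (𝟙 Y.unop))
    (fun _ => Iso.refl _) (fun f g => SpanIso.deltaComp f.unop g.unop)
    (fun {X Y Z W} f g h => by
      apply Pith.hom₂_ext
      apply Span.hom_ext
      rw [SpanIso.eqToHom_delta (by simp)]
      exact delta_assoc_aux h.unop g.unop _ _ _ _ _ _)
    (fun {X Y} f => by
      apply Pith.hom₂_ext
      apply Span.hom_ext
      rw [SpanIso.eqToHom_delta (by simp)]
      show pbLift _ _ _ ≫ pbLift _ _ _ ≫ snd _ _ = 𝟙 _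
      simp)
    (fun {X Y} f => by
      apply Pith.hom₂_ext
      apply Span.hom_ext
      rw [SpanIso.eqToHom_delta (by simp)]
      show pbLift _ _ _ ≫ pbLift _ _ _ ≫ fst _ _ = 𝟙 _
      simp)

end Span

/-! ### Oplax functors and icons -/

section Icon

variable {B : Type u₁} [Bicategory.{w₁, v₁} B] {C : Type u₂} [Bicategory.{w₂, v₂} C]

/-- An oplax functor `B ⥤ᵒᵖᴸ C` with prescribed action `ob` on objects. Mathlib's oplax functors
are the pairs of a function `ob` and such a structure, see `OplaxOn.equiv`. Icons only exist between
oplax functors which agree on objects, so it is convenient to fix this action. -/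
structure OplaxOn (ob : B → C) where
  /-- action on 1-cells -/
  map {a b : B} (f : a ⟶ b) : ob a ⟶ ob b
  /-- action on 2-cells -/
  map₂ {a b : B} {f g : a ⟶ b} (η : f ⟶ g) : map f ⟶ map g
  map₂_id {a b : B} (f : a ⟶ b) : map₂ (𝟙 f) = 𝟙 (map f)
  map₂_comp {a b : B} {f g h : a ⟶ b} (η : f ⟶ g) (θ : g ⟶ h) :
    map₂ (η ≫ θ) = map₂ η ≫ map₂ θ
  /-- nullary constraint -/
  mapId (a : B) : map (𝟙 a) ⟶ 𝟙 (ob a)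
  /-- binary constraint -/
  mapComp {a b c : B} (f : a ⟶ b) (g : b ⟶ c) : map (f ≫ g) ⟶ map f ≫ map g
  mapComp_naturality_left {a b c : B} {f f' : a ⟶ b} (η : f ⟶ f') (g : b ⟶ c) :
    map₂ (η ▷ g) ≫ mapComp f' g = mapComp f g ≫ map₂ η ▷ map g
  mapComp_naturality_right {a b c : B} (f : a ⟶ b) {g g' : b ⟶ c} (η : g ⟶ g') :
    map₂ (f ◁ η) ≫ mapComp f g' = mapComp f g ≫ map f ◁ map₂ η
  map₂_associator {a b c d : B} (f : a ⟶ b) (g : b ⟶ c) (h : c ⟶ d) :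
    map₂ (α_ f g h).hom ≫ mapComp f (g ≫ h) ≫ map f ◁ mapComp g h =
      mapComp (f ≫ g) h ≫ mapComp f g ▷ map h ≫ (α_ (map f) (map g) (map h)).hom
  map₂_leftUnitor {a b : B} (f : a ⟶ b) :
    map₂ (λ_ f).hom = mapComp (𝟙 a) f ≫ mapId a ▷ map f ≫ (λ_ (map f)).hom
  map₂_rightUnitor {a b : B} (f : a ⟶ b) :
    map₂ (ρ_ f).hom = mapComp f (𝟙 b) ≫ map f ◁ mapId b ≫ (ρ_ (map f)).hom

namespace OplaxOn

/-- The underlying oplax functor. -/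
abbrev toOplax {ob : B → C} (F : OplaxOn ob) : B ⥤ᵒᵖᴸ C where
  obj := ob
  map := F.map
  map₂ := F.map₂
  map₂_id := F.map₂_id
  map₂_comp := F.map₂_comp
  mapId := F.mapId
  mapComp := F.mapComp
  mapComp_naturality_left := F.mapComp_naturality_left
  mapComp_naturality_right := F.mapComp_naturality_right
  map₂_associator := F.map₂_associator
  map₂_leftUnitor := F.map₂_leftUnitor
  map₂_rightUnitor := F.map₂_rightUnitor

/-- An oplax functor, as an oplax functor with its action on objects. -/
abbrev ofOplax (F : B ⥤ᵒᵖᴸ C) : OplaxOn F.obj where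
  map := F.map
  map₂ := F.map₂
  map₂_id := F.map₂_id
  map₂_comp := F.map₂_comp
  mapId := F.mapId
  mapComp := F.mapComp
  mapComp_naturality_left := F.mapComp_naturality_left
  mapComp_naturality_right := F.mapComp_naturality_right
  map₂_associator := F.map₂_associator
  map₂_leftUnitor := F.map₂_leftUnitor
  map₂_rightUnitor := F.map₂_rightUnitor

/-- An oplax functor is the same thing as an action on objects `ob` and an element of
`OplaxOn ob`. -/
def equiv : (Σ ob : B → C, OplaxOn ob) ≃ (B ⥤ᵒᵖᴸ C) where
  toFun F := F.2.toOplax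
  invFun F := ⟨F.obj, ofOplax F⟩
  left_inv _ := rfl
  right_inv _ := rfl

/-- Icons between oplax functors which agree on objects. -/
@[ext]
structure Icon {ob : B → C} (F G : OplaxOn ob) where
  /-- the components -/
  app {a b : B} (f : a ⟶ b) : F.map f ⟶ G.map f
  naturality {a b : B} {f g : a ⟶ b} (η : f ⟶ g) : F.map₂ η ≫ app g = app f ≫ G.map₂ η
  app_comp {a b c : B} (f : a ⟶ b) (g : b ⟶ c) :
    F.mapComp f g ≫ app f ▷ F.map g ≫ G.map f ◁ app g = app (f ≫ g) ≫ G.mapComp f g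
  app_id (a : B) : app (𝟙 a) ≫ G.mapId a = F.mapId a

/-- The category of oplax functors with a given action on objects, and icons. -/
@[simps id_app comp_app]
instance {ob : B → C} : Category (OplaxOn ob) where
  Hom F G := Icon F G
  id F :=
    { app := fun f => 𝟙 (F.map f)
      naturality := by simp
      app_comp := by simp
      app_id := by simp }
  comp {F G H} α β :=
    { app := fun f => α.app f ≫ β.app f
      naturality := fun η => by
        rw [← Category.assoc, α.naturality, Category.assoc, β.naturality, Category.assoc]
      app_comp := fun f g => by
        rw [Category.assoc, ← β.app_comp, ← Category.assoc (α.app (f ≫ g)), ← α.app_comp]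
        simp only [comp_whiskerRight, whiskerLeft_comp, Category.assoc]
        rw [← whisker_exchange_assoc]
      app_id := fun a => by rw [Category.assoc, β.app_id, α.app_id] }

@[ext]
theorem hom_ext {ob : B → C} {F G : OplaxOn ob} {α β : F ⟶ G}
    (h : ∀ {a b : B} (f : a ⟶ b), α.app f = β.app f) : α = β := by
  apply Icon.ext
  funext a b f
  exact h f

end OplaxOn

/-- An oplax functor is a pseudofunctor if its constraints are invertible. -/
structure IsPseudo (F : B ⥤ᵒᵖᴸ C) : Prop where
  isIso_mapId (a : B) : IsIso (F.mapId a)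
  isIso_mapComp {a b c : B} (f : a ⟶ b) (g : b ⟶ c) : IsIso (F.mapComp f g)

/-- A gregarious functor: a normal oplax functor whose constraint cell at `f : a ⟶ b`, `g : b ⟶ c`
is invertible whenever `g` has a right adjoint. -/
structure IsGregarious (F : B ⥤ᵒᵖᴸ C) : Prop where
  isIso_mapId (a : B) : IsIso (F.mapId a)
  isIso_mapComp {a b c : B} (f : a ⟶ b) (g : b ⟶ c) (hg : Bicategory.IsLeftAdjoint g) :
    IsIso (F.mapComp f g)

/-- Pseudofunctors with a given action on objects. The morphisms are icons. -/
abbrev PseudoOn (ob : B → C) :=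
  ObjectProperty.FullSubcategory (fun F : OplaxOn ob => IsPseudo F.toOplax)

variable (B C) in
/-- `Icon(B, C)`: the category of pseudofunctors from `B` to `C` and icons. It is the disjoint union,
over all functions `ob : B → C`, of the categories of pseudofunctors acting as `ob` on objects. -/
abbrev PseudoIcon := Σ ob : B → C, PseudoOn ob

variable {A : Type u} [Bicategory.{w, v} A]

/-- The restriction of an oplax functor along a pseudofunctor `P`, that is, the composite
`P.toOplax.comp F.toOplax`. -/
abbrev OplaxOn.restrict (P : A ⥤ᵖ B) {ob : B → C} (F : OplaxOn ob) :
    OplaxOn (fun a => ob (P.obj a)) where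
  map f := F.map (P.map f)
  map₂ η := F.map₂ (P.map₂ η)
  mapId a := F.map₂ (P.mapId a).hom ≫ F.mapId (P.obj a)
  mapComp f g := F.map₂ (P.mapComp f g).hom ≫ F.mapComp (P.map f) (P.map g)
  map₂_id := (P.toOplax.comp F.toOplax).map₂_id
  map₂_comp := (P.toOplax.comp F.toOplax).map₂_comp
  mapComp_naturality_left := (P.toOplax.comp F.toOplax).mapComp_naturality_left
  mapComp_naturality_right := (P.toOplax.comp F.toOplax).mapComp_naturality_right
  map₂_associator := (P.toOplax.comp F.toOplax).map₂_associator
  map₂_leftUnitor := (P.toOplax.comp F.toOplax).map₂_leftUnitor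
  map₂_rightUnitor := (P.toOplax.comp F.toOplax).map₂_rightUnitor

/-- The restriction of an icon along a pseudofunctor. -/
@[simps]
def OplaxOn.restrictIcon (P : A ⥤ᵖ B) {ob : B → C} {F G : OplaxOn ob} (α : F ⟶ G) :
    F.restrict P ⟶ G.restrict P where
  app f := α.app (P.map f)
  naturality η := α.naturality (P.map₂ η)
  app_comp f g := by
    rw [Category.assoc, α.app_comp, ← Category.assoc, α.naturality, Category.assoc]
  app_id a := by
    rw [← Category.assoc, ← α.naturality, Category.assoc, α.app_id]

end Icon

/-! ### Lax Beck pairs -/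

section Beck

variable {E : Type u} [Category.{v} E] {C : Type u₂} [Bicategory.{w₂, v₂} C]

/-- Pseudofunctors `E ⥤ C` acting as `ob` on objects. -/
abbrev CovOn (ob : E → C) := PseudoOn (fun X : LocallyDiscrete E => ob X.as)

/-- Pseudofunctors `Eᵒᵖ ⥤ C` acting as `ob` on objects. -/
abbrev ContraOn (ob : E → C) := PseudoOn (fun X : LocallyDiscrete Eᵒᵖ => ob X.as.unop)

section

variable {ob : E → C}

/-- The 1-cell `T f`. -/
abbrev CovOn.map (T : CovOn ob) {X Y : E} (f : X ⟶ Y) : ob X ⟶ ob Y := T.obj.map f.toLoc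

/-- The component at `f` of an icon. -/
abbrev CovOn.app {T T' : CovOn ob} (α : T ⟶ T') {X Y : E} (f : X ⟶ Y) :
    CovOn.map T f ⟶ CovOn.map T' f := α.hom.app f.toLoc

/-- The 1-cell `D f`. -/
abbrev ContraOn.map (D : ContraOn ob) {X Y : E} (f : X ⟶ Y) : ob Y ⟶ ob X :=
  D.obj.map f.op.toLoc

/-- The component at `f` of an icon. -/
abbrev ContraOn.app {D D' : ContraOn ob} (β : D ⟶ D') {X Y : E} (f : X ⟶ Y) :
    ContraOn.map D f ⟶ ContraOn.map D' f := β.hom.app f.op.toLoc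

end

/-- A pair of pseudofunctors `F_⊗ : E ⥤ C` and `F_Δ : Eᵒᵖ ⥤ C` which agree on objects (both act
as `ob`), with a 2-cell for each pullback square in `E`; the coherence conditions are imposed in
`PairOn.IsLaxBeck` below. -/
structure PairOn (ob : E → C) where
  /-- the covariant pseudofunctor `F_⊗` -/
  tensor : CovOn ob
  /-- the contravariant pseudofunctor `F_Δ` -/
  delta : ContraOn ob
  /-- the Beck 2-cell of the pullback square with top `f'`, left side `g'`, bottom `f` and right
  side `g` -/
  beck {P X Y Z : E} {g' : P ⟶ X} {f' : P ⟶ Y} {f : X ⟶ Z} {g : Y ⟶ Z}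
    (h : IsPullback g' f' f g) :
    ContraOn.map delta g' ≫ CovOn.map tensor f' ⟶ CovOn.map tensor f ≫ ContraOn.map delta g

namespace PairOn

variable {ob : E → C} (F : PairOn ob)

/-- The 1-cell `F_⊗ f`. -/
abbrev t {X Y : E} (f : X ⟶ Y) : ob X ⟶ ob Y := CovOn.map F.tensor f

/-- The 1-cell `F_Δ f`. -/
abbrev d {X Y : E} (f : X ⟶ Y) : ob Y ⟶ ob X := ContraOn.map F.delta f

/-- The unit constraint of `F_⊗`. -/
abbrev tId (X : E) : F.t (𝟙 X) ⟶ 𝟙 (ob X) := F.tensor.obj.mapId ⟨X⟩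

/-- The unit constraint of `F_Δ`. -/
abbrev dId (X : E) : F.d (𝟙 X) ⟶ 𝟙 (ob X) := F.delta.obj.mapId ⟨op X⟩

/-- The composition constraint of `F_⊗`. -/
abbrev tComp {X Y Z : E} (f : X ⟶ Y) (g : Y ⟶ Z) : F.t (f ≫ g) ⟶ F.t f ≫ F.t g :=
  F.tensor.obj.mapComp f.toLoc g.toLoc

/-- The composition constraint of `F_Δ`. -/
abbrev dComp {X Y Z : E} (f : X ⟶ Y) (g : Y ⟶ Z) : F.d (f ≫ g) ⟶ F.d g ≫ F.d f :=
  F.delta.obj.mapComp g.op.toLoc f.op.toLoc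

/-- The Beck–Chevalley coherence conditions. As the constraints of `F_⊗` and `F_Δ` are invertible,
each equation of pastings is written with the constraints at the codomain moved to the side of the
Beck 2-cell of the outer square. -/
structure IsLaxBeck : Prop where
  /-- horizontal double pullback condition -/
  horizontal {P₂ P₁ X₂ X₁ Y Z : E} {f₂' : P₂ ⟶ P₁} {f₁' : P₁ ⟶ Y} {g'' : P₂ ⟶ X₂} {g' : P₁ ⟶ X₁}
    {g : Y ⟶ Z} {f₂ : X₂ ⟶ X₁} {f₁ : X₁ ⟶ Z}
    (h₂ : IsPullback g'' f₂' f₂ g') (h₁ : IsPullback g' f₁' f₁ g) :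
    F.beck (h₂.paste_vert h₁) ≫ F.tComp f₂ f₁ ▷ F.d g =
      F.d g'' ◁ F.tComp f₂' f₁' ≫ (α_ (F.d g'') (F.t f₂') (F.t f₁')).inv ≫
        F.beck h₂ ▷ F.t f₁' ≫ (α_ (F.t f₂) (F.d g') (F.t f₁')).hom ≫
          F.t f₂ ◁ F.beck h₁ ≫ (α_ (F.t f₂) (F.t f₁) (F.d g)).inv
  /-- vertical double pullback condition -/
  vertical {P₂ P₁ X Y₂ Y₁ Z : E} {f'' : P₂ ⟶ Y₂} {f' : P₁ ⟶ Y₁} {f : X ⟶ Z} {g₂' : P₂ ⟶ P₁}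
    {g₁' : P₁ ⟶ X} {g₂ : Y₂ ⟶ Y₁} {g₁ : Y₁ ⟶ Z}
    (h₂ : IsPullback g₂' f'' f' g₂) (h₁ : IsPullback g₁' f' f g₁) :
    F.beck (h₂.paste_horiz h₁) ≫ F.t f ◁ F.dComp g₂ g₁ =
      F.dComp g₂' g₁' ▷ F.t f'' ≫ (α_ (F.d g₁') (F.d g₂') (F.t f'')).hom ≫
        F.d g₁' ◁ F.beck h₂ ≫ (α_ (F.d g₁') (F.t f') (F.d g₂)).inv ≫
          F.beck h₁ ▷ F.d g₂ ≫ (α_ (F.t f) (F.d g₁) (F.d g₂)).hom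
  /-- horizontal nullary pullback condition -/
  horizontal_id {X Y : E} (f : X ⟶ Y) :
    F.beck (IsPullback.id_horiz f) ≫ F.t f ◁ F.dId Y =
      F.dId X ▷ F.t f ≫ (λ_ (F.t f)).hom ≫ (ρ_ (F.t f)).inv
  /-- vertical nullary pullback condition -/
  vertical_id {X Y : E} (g : X ⟶ Y) :
    F.beck (IsPullback.id_vert g) ≫ F.tId Y ▷ F.d g =
      F.d g ◁ F.tId X ≫ (ρ_ (F.d g)).hom ≫ (λ_ (F.d g)).inv

/-- All the Beck 2-cells are invertible. -/
def IsInvertible : Prop :=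
  ∀ {P X Y Z : E} {g' : P ⟶ X} {f' : P ⟶ Y} {f : X ⟶ Z} {g : Y ⟶ Z}
    (h : IsPullback g' f' f g), IsIso (F.beck h)

/-- A morphism of pairs: icons `α : F_⊗ ⟶ G_⊗` and `β : F_Δ ⟶ G_Δ` compatible with the Beck
2-cells. -/
@[ext]
structure Hom (F G : PairOn ob) where
  /-- the icon `α` -/
  tensor : F.tensor ⟶ G.tensor
  /-- the icon `β` -/
  delta : F.delta ⟶ G.delta
  comm {P X Y Z : E} {g' : P ⟶ X} {f' : P ⟶ Y} {f : X ⟶ Z} {g : Y ⟶ Z}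
    (h : IsPullback g' f' f g) :
    (ContraOn.app delta g' ▷ F.t f' ≫ G.d g' ◁ CovOn.app tensor f') ≫ G.beck h =
      F.beck h ≫ CovOn.app tensor f ▷ F.d g ≫ G.t f ◁ ContraOn.app delta g

@[simps id_tensor id_delta comp_tensor comp_delta]
instance : Category (PairOn ob) where
  Hom F G := Hom F G
  id F :=
    { tensor := 𝟙 F.tensor
      delta := 𝟙 F.delta
      comm := fun h => by simp [CovOn.app, ContraOn.app] }
  comp {F G H} α β :=
    { tensor := α.tensor ≫ β.tensor
      delta := α.delta ≫ β.delta
      comm := fun {P X Y Z g' f' f g} h => by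
        have hα := α.comm h
        have hβ := β.comm h
        show ((ContraOn.app α.delta g' ≫ ContraOn.app β.delta g') ▷ F.t f' ≫
            H.d g' ◁ (CovOn.app α.tensor f' ≫ CovOn.app β.tensor f')) ≫ H.beck h =
          F.beck h ≫ (CovOn.app α.tensor f ≫ CovOn.app β.tensor f) ▷ F.d g ≫
            H.t f ◁ (ContraOn.app α.delta g ≫ ContraOn.app β.delta g)
        simp only [comp_whiskerRight, whiskerLeft_comp, Category.assoc] at hα hβ ⊢
        rw [← whisker_exchange_assoc, hβ, reassoc_of% hα, whisker_exchange_assoc] }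

@[ext]
theorem hom_ext {F G : PairOn ob} {α β : F ⟶ G} (h₁ : α.tensor = β.tensor)
    (h₂ : α.delta = β.delta) : α = β :=
  Hom.ext h₁ h₂

end PairOn

variable (E C) in
/-- Pairs of pseudofunctors which agree on objects, with a 2-cell for each pullback square. This
category is the disjoint union, over all functions `ob : E → C`, of the categories `PairOn ob`. -/
abbrev Pair := Σ ob : E → C, PairOn ob

variable (E C) in
/-- The pairs satisfying the Beck–Chevalley coherence conditions. -/
abbrev isLaxBeckPair : ObjectProperty (Pair E C) := fun F => F.2.IsLaxBeck

variable (E C) in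
/-- The pairs satisfying the Beck–Chevalley coherence conditions, with invertible Beck 2-cells. -/
abbrev isBeckPair : ObjectProperty (Pair E C) := fun F => F.2.IsLaxBeck ∧ F.2.IsInvertible

variable (E C) in
/-- The category of lax Beck pairs. -/
abbrev LaxBeckPair := (isLaxBeckPair E C).FullSubcategory

variable (E C) in
/-- The category of Beck pairs. -/
abbrev BeckPair := (isBeckPair E C).FullSubcategory

end Beck

/-! ### From functors on `Span_iso(E)` to pairs -/

section Restriction

variable {E : Type u} [Category.{v} E] [PullbackChoice E] {C : Type u₂} [Bicategory.{w₂, v₂} C]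

/-- The 2-cell `F(s, t) ⟶ F(s, 1) ; F(1, t)`, a constraint of `F`. -/
noncomputable def OplaxOn.factor {ob : SpanIso E → C} (F : OplaxOn ob) {T X Y : E}
    (s : T ⟶ X) (t : T ⟶ Y) :
    F.map (SpanIso.mk s t) ⟶ F.map (SpanIso.mk s (𝟙 T)) ≫ F.map (SpanIso.mk (𝟙 T) t) :=
  F.map₂ (SpanIso.factor s t).hom ≫ F.mapComp (SpanIso.mk s (𝟙 T)) (SpanIso.mk (𝟙 T) t)

theorem OplaxOn.factor_naturality {ob : SpanIso E → C} {F G : OplaxOn ob} (α : F ⟶ G) {T X Y : E}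
    (s : T ⟶ X) (t : T ⟶ Y) :
    F.factor s t ≫ α.app (SpanIso.mk s (𝟙 T)) ▷ F.map (SpanIso.mk (𝟙 T) t) ≫
        G.map (SpanIso.mk s (𝟙 T)) ◁ α.app (SpanIso.mk (𝟙 T) t) =
      α.app (SpanIso.mk s t) ≫ G.factor s t := by
  rw [OplaxOn.factor, OplaxOn.factor, Category.assoc, α.app_comp, ← Category.assoc, α.naturality,
    Category.assoc]

/-- The objects of `Greg_{⊗,Δ}(Span_iso(E), C)`: gregarious functors which restrict to
pseudofunctors along `(-)_⊗` and `(-)_Δ` and whose constraints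
`F(s, t) ⟶ F(s, 1) ; F(1, t)` are invertible. -/
structure IsGregTensorDelta {ob : SpanIso E → C} (F : OplaxOn ob) : Prop where
  isGregarious : IsGregarious F.toOplax
  isPseudo_tensor : IsPseudo ((tensorEmb E).toOplax.comp F.toOplax)
  isPseudo_delta : IsPseudo ((deltaEmb E).toOplax.comp F.toOplax)
  isIso_factor {T X Y : E} (s : T ⟶ X) (t : T ⟶ Y) : IsIso (F.factor s t)

/-- The part of `Greg_{⊗,Δ}(Span_iso(E), C)` with a given action on objects. -/
abbrev GregOn (ob : SpanIso E → C) :=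
  ObjectProperty.FullSubcategory (fun F : OplaxOn ob => IsGregTensorDelta F)

variable (E C) in
/-- The category `Greg_{⊗,Δ}(Span_iso(E), C)`. The morphisms are icons. -/
abbrev GregTensorDelta := Σ ob : SpanIso E → C, GregOn ob

/-- The Beck 2-cell of a pullback square: the composite of the inverse of
`F(g', f') ⟶ F(g', 1) ; F(1, f')`, the image of the isomorphism `(g', f') ≅ (1, f) ; (g, 1)`, and
the constraint `F((1, f) ; (g, 1)) ⟶ F(1, f) ; F(g, 1)`. -/
noncomputable def GregOn.beckCell {ob : SpanIso E → C} (F : GregOn ob) {P X Y Z : E} {g' : P ⟶ X}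
    {f' : P ⟶ Y} {f : X ⟶ Z} {g : Y ⟶ Z} (h : IsPullback g' f' f g) :
    F.obj.map (SpanIso.mk g' (𝟙 P)) ≫ F.obj.map (SpanIso.mk (𝟙 P) f') ⟶
      F.obj.map (SpanIso.mk (𝟙 X) f) ≫ F.obj.map (SpanIso.mk g (𝟙 Y)) :=
  haveI : IsIso (F.obj.factor g' f') := F.property.isIso_factor g' f'
  inv (F.obj.factor g' f') ≫ F.obj.map₂ (SpanIso.ofIsPullback h).hom ≫
    F.obj.mapComp (SpanIso.mk (𝟙 X) f) (SpanIso.mk g (𝟙 Y))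

theorem GregOn.factor_beckCell {ob : SpanIso E → C} (F : GregOn ob) {P X Y Z : E} {g' : P ⟶ X}
    {f' : P ⟶ Y} {f : X ⟶ Z} {g : Y ⟶ Z} (h : IsPullback g' f' f g) :
    F.obj.factor g' f' ≫ F.beckCell h = F.obj.map₂ (SpanIso.ofIsPullback h).hom ≫
      F.obj.mapComp (SpanIso.mk (𝟙 X) f) (SpanIso.mk g (𝟙 Y)) := by
  have : IsIso (F.obj.factor g' f') := F.property.isIso_factor g' f'
  simp [GregOn.beckCell]

theorem GregOn.beckCell_naturality {ob : SpanIso E → C} {F G : GregOn ob} (α : F ⟶ G)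
    {P X Y Z : E} {g' : P ⟶ X} {f' : P ⟶ Y} {f : X ⟶ Z} {g : Y ⟶ Z} (h : IsPullback g' f' f g) :
    (α.hom.app (SpanIso.mk g' (𝟙 P)) ▷ F.obj.map (SpanIso.mk (𝟙 P) f') ≫
        G.obj.map (SpanIso.mk g' (𝟙 P)) ◁ α.hom.app (SpanIso.mk (𝟙 P) f')) ≫ G.beckCell h =
      F.beckCell h ≫ α.hom.app (SpanIso.mk (𝟙 X) f) ▷ F.obj.map (SpanIso.mk g (𝟙 Y)) ≫
        G.obj.map (SpanIso.mk (𝟙 X) f) ◁ α.hom.app (SpanIso.mk g (𝟙 Y)) := by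
  have : IsIso (F.obj.factor g' f') := F.property.isIso_factor g' f'
  have h₁ := OplaxOn.factor_naturality α.hom g' f'
  rw [← cancel_epi (F.obj.factor g' f')]
  calc
    _ = (F.obj.factor g' f' ≫ α.hom.app (SpanIso.mk g' (𝟙 P)) ▷ F.obj.map (SpanIso.mk (𝟙 P) f') ≫
        G.obj.map (SpanIso.mk g' (𝟙 P)) ◁ α.hom.app (SpanIso.mk (𝟙 P) f')) ≫ G.beckCell h :=
      (Category.assoc _ _ _).symm
    _ = α.hom.app (SpanIso.mk g' f') ≫ G.obj.map₂ (SpanIso.ofIsPullback h).hom ≫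
        G.obj.mapComp (SpanIso.mk (𝟙 X) f) (SpanIso.mk g (𝟙 Y)) := by
      rw [h₁, Category.assoc, GregOn.factor_beckCell]
    _ = (F.obj.factor g' f' ≫ F.beckCell h) ≫
        α.hom.app (SpanIso.mk (𝟙 X) f) ▷ F.obj.map (SpanIso.mk g (𝟙 Y)) ≫
          G.obj.map (SpanIso.mk (𝟙 X) f) ◁ α.hom.app (SpanIso.mk g (𝟙 Y)) := by
      rw [GregOn.factor_beckCell, Category.assoc, α.hom.app_comp, ← Category.assoc,
        ← Category.assoc, α.hom.naturality]
    _ = _ := Category.assoc _ _ _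

/-- The pair attached to an object of `Greg_{⊗,Δ}(Span_iso(E), C)`. -/
noncomputable def GregOn.toPair {ob : SpanIso E → C} (F : GregOn ob) :
    PairOn (fun X : E => ob (SpanIso.of X)) where
  tensor := ⟨F.obj.restrict (tensorEmb E), F.property.isPseudo_tensor⟩
  delta := ⟨F.obj.restrict (deltaEmb E), F.property.isPseudo_delta⟩
  beck h := F.beckCell h

/-- The functor `F ↦ (F_⊗, F_Δ, b)` for a given action on objects. -/
noncomputable def GregOn.toPairFunctor (ob : SpanIso E → C) :
    GregOn ob ⥤ PairOn (fun X : E => ob (SpanIso.of X)) where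
  obj F := F.toPair
  map {F G} α :=
    { tensor := ObjectProperty.homMk (OplaxOn.restrictIcon (tensorEmb E) α.hom)
      delta := ObjectProperty.homMk (OplaxOn.restrictIcon (deltaEmb E) α.hom)
      comm := fun h => GregOn.beckCell_naturality α h }

variable (E C) in
/-- The functor `(-)_{⊗Δ}`, with values in pairs: it sends `F` to the restrictions `F_⊗`, `F_Δ` of
`F` along the embeddings, equipped with the Beck 2-cells. -/
noncomputable def tensorDelta : GregTensorDelta E C ⥤ Pair E C :=
  Sigma.desc (fun ob => GregOn.toPairFunctor ob ⋙
    Sigma.incl (C := fun ob : E → C => PairOn ob) (fun X : E => ob (SpanIso.of X)))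

/-- Pseudofunctors belong to `Greg_{⊗,Δ}(Span_iso(E), C)`. -/
theorem IsGregTensorDelta.of_isPseudo {ob : SpanIso E → C} {F : OplaxOn ob}
    (hF : IsPseudo F.toOplax) : IsGregTensorDelta F := by
  have hId : ∀ a, IsIso (F.mapId a) := hF.isIso_mapId
  have hComp : ∀ {a b c : SpanIso E} (f : a ⟶ b) (g : b ⟶ c), IsIso (F.mapComp f g) :=
    hF.isIso_mapComp
  have h₂ : ∀ {a b : SpanIso E} {f g : a ⟶ b} (e : f ≅ g), IsIso (F.map₂ e.hom) := fun e =>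
    (F.toOplax.map₂Iso e).isIso_hom
  refine ⟨⟨hId, fun f g _ => hComp f g⟩, ⟨fun a => ?_, fun f g => ?_⟩,
    ⟨fun a => ?_, fun f g => ?_⟩, fun s t => ?_⟩
  · exact @IsIso.comp_isIso _ _ _ _ _ _ _ (h₂ ((tensorEmb E).mapId a)) (hId _)
  · exact @IsIso.comp_isIso _ _ _ _ _ _ _ (h₂ ((tensorEmb E).mapComp f g)) (hComp _ _)
  · exact @IsIso.comp_isIso _ _ _ _ _ _ _ (h₂ ((deltaEmb E).mapId a)) (hId _)
  · exact @IsIso.comp_isIso _ _ _ _ _ _ _ (h₂ ((deltaEmb E).mapComp f g)) (hComp _ _)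
  · exact @IsIso.comp_isIso _ _ _ _ _ _ _ (h₂ (SpanIso.factor s t)) (hComp _ _)

variable (E C) in
/-- The inclusion of the category of pseudofunctors and icons in `Greg_{⊗,Δ}(Span_iso(E), C)`. -/
noncomputable def pseudoInclusion : PseudoIcon (SpanIso E) C ⥤ GregTensorDelta E C :=
  Sigma.Functor.sigma (fun _ => ObjectProperty.ιOfLE (fun _ h => IsGregTensorDelta.of_isPseudo h))

end Restriction

end SpanBeck

/-! A span $(s,t)$ is the composite of $(s,1)$ and $(1,t)$, so a functor $F$ with invertible
constraints $F(s,t)\to F_\Delta s;F_\otimes t$ is governed by $F_\otimes$, $F_\Delta$ and its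
remaining constraints. Let $(p,q)$ be a pullback of $t$ and $u$. The constraint of $F$ at $(s,t)$
and $(u,v)$ becomes $F_\Delta(p;s);F_\otimes(q;v)\cong F_\Delta s;F_\Delta p;F_\otimes q;F_\otimes
v\to F_\Delta s;F_\otimes t;F_\Delta u;F_\otimes v$, where the only new ingredient is the Beck
2-cell (`GregOn.pb_wFactor_wFactor`). The image of an isomorphism $e$ of spans is recovered
similarly: the Beck 2-cell of the pullback square with sides $e,e,1,1$ gives a cell $F_\Delta
e;F_\otimes e\to 1$ (`GregOn.map₂_wFactor`). Hence a morphism of pairs extends to exactly one icon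
(`GregOn.extend`), which is full faithfulness.

The Beck–Chevalley conditions for $F$ come from the associativity of its constraints at triples of
spans with some identity legs (`OplaxOn.pb_assoc`) and from the unit laws.

Conversely, for a lax Beck pair the formulas above define an action on isomorphisms of spans and
binary constraints (`PairOn.wMap`, `PairOn.wPb`). A triple composite of spans is built from three
pullback squares, and the horizontal and vertical conditions break both sides of the associativity
law into the same three Beck 2-cells (`PairOn.IsLaxBeck.wPb_assoc`); the nullary conditions give the
unit laws. The nullary conditions also make the Beck 2-cells of identity squares invertible, hence
the constraints whose second span has an invertible left leg. Left adjoints in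
$\mathbf{Span}_{\mathrm{iso}}(\mathcal E)$ are such spans (`SpanIso.isIso_left_of_isLeftAdjoint`),
so the functor is gregarious. Its pair is isomorphic to the given one through the unit cells
$F_\Delta 1;F_\otimes f\cong F_\otimes f$ and $F_\Delta g;F_\otimes 1\cong F_\Delta g$
(`PairOn.IsLaxBeck.comparison`). Invertible Beck 2-cells correspond to invertible constraints, which
gives the second equivalence.

Calculations are made on families of whiskered 2-cells natural in the whiskering 1-cell;
`whiskerLeft_cellOfFamily` turns such a family into a 2-cell. -/

namespace SpanBeck

/-! ### Whiskered constraints of oplax functors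

A 2-cell `f ⟶ g` of `C` is determined by its whiskerings `h ≫ f ⟶ h ≫ g`. Bracketing all composites
of 1-cells to the left removes the associators from the coherence laws of oplax functors. -/

section Whiskered

variable {B : Type u₁} [Bicategory.{w₁, v₁} B] {C : Type u₂} [Bicategory.{w₂, v₂} C]
  {ob : B → C}

namespace OplaxOn

variable (F : OplaxOn ob)

/-- The constraint of `F` attached to a 2-cell `R ⟶ S ≫ T`, whiskered by `h`. -/
def wComp {x : C} {a b c : B} (h : x ⟶ ob a) {R : a ⟶ c} {S : a ⟶ b} {T : b ⟶ c}
    (σ : R ⟶ S ≫ T) : h ≫ F.map R ⟶ (h ≫ F.map S) ≫ F.map T :=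
  h ◁ (F.map₂ σ ≫ F.mapComp S T) ≫ (α_ _ _ _).inv

/-- The constraint of `F` attached to a 2-cell `R ⟶ 𝟙 a`, whiskered by `h`. -/
def wId {x : C} {a : B} (h : x ⟶ ob a) {R : a ⟶ a} (ι : R ⟶ 𝟙 a) : h ≫ F.map R ⟶ h :=
  h ◁ (F.map₂ ι ≫ F.mapId a) ≫ (ρ_ h).hom

theorem wComp_naturality {x : C} {a b c : B} {h h' : x ⟶ ob a} (θ : h ⟶ h') {R : a ⟶ c}
    {S : a ⟶ b} {T : b ⟶ c} (σ : R ⟶ S ≫ T) :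
    θ ▷ F.map R ≫ F.wComp h' σ = F.wComp h σ ≫ θ ▷ F.map S ▷ F.map T := by
  simp only [wComp, ← whisker_exchange_assoc, Category.assoc, whiskerRight_comp,
    Iso.hom_inv_id, Category.comp_id]

theorem wId_naturality {x : C} {a : B} {h h' : x ⟶ ob a} (θ : h ⟶ h') {R : a ⟶ a}
    (ι : R ⟶ 𝟙 a) : θ ▷ F.map R ≫ F.wId h' ι = F.wId h ι ≫ θ := by
  simp only [wId, ← whisker_exchange_assoc, Category.assoc, whiskerRight_id,
    Iso.inv_hom_id, Category.comp_id]

theorem whiskerLeft_wComp {x y : C} {a b c : B} (k : y ⟶ x) (h : x ⟶ ob a) {R : a ⟶ c}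
    {S : a ⟶ b} {T : b ⟶ c} (σ : R ⟶ S ≫ T) :
    k ◁ F.wComp h σ = (α_ _ _ _).inv ≫ F.wComp (k ≫ h) σ ≫ (α_ _ _ _).hom ▷ _ ≫
      (α_ _ _ _).hom := by
  simp [wComp]

theorem whiskerLeft_wId {x y : C} {a : B} (k : y ⟶ x) (h : x ⟶ ob a) {R : a ⟶ a}
    (ι : R ⟶ 𝟙 a) : k ◁ F.wId h ι = (α_ _ _ _).inv ≫ F.wId (k ≫ h) ι := by
  simp [wId]

theorem map₂_wComp {x : C} {a b c : B} (h : x ⟶ ob a) {Q R : a ⟶ c} {S : a ⟶ b} {T : b ⟶ c}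
    (η : Q ⟶ R) (σ : R ⟶ S ≫ T) :
    h ◁ F.map₂ η ≫ F.wComp h σ = F.wComp h (η ≫ σ) := by
  simp [wComp, F.map₂_comp]

/-- Associativity of the whiskered constraints. -/
theorem wComp_assoc {x : C} {a b c d : B} (h : x ⟶ ob a) {R : a ⟶ d} {S : a ⟶ c} {T : c ⟶ d}
    {U : a ⟶ b} {V : b ⟶ c} {W : b ⟶ d} (σ : R ⟶ S ≫ T) (τ : S ⟶ U ≫ V) (ρ : R ⟶ U ≫ W)
    (ω : W ⟶ V ≫ T) (e : σ ≫ τ ▷ T ≫ (α_ U V T).hom = ρ ≫ U ◁ ω) :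
    F.wComp h σ ≫ F.wComp h τ ▷ F.map T = F.wComp h ρ ≫ F.wComp (h ≫ F.map U) ω := by
  -- The law before whiskering: the naturality squares move `τ` and `ω` in front of the constraints,
  -- where `map₂_associator` applies and `e` compares the resulting 2-cells.
  have e' : F.map₂ σ ≫ F.mapComp S T ≫ (F.map₂ τ ≫ F.mapComp U V) ▷ F.map T ≫
      (α_ _ _ _).hom = F.map₂ ρ ≫ F.mapComp U W ≫ F.map U ◁ (F.map₂ ω ≫ F.mapComp V T) := by
    rw [comp_whiskerRight, whiskerLeft_comp, ← reassoc_of% F.mapComp_naturality_right,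
      Category.assoc, ← reassoc_of% F.mapComp_naturality_left, ← F.map₂_associator]
    simp only [← Category.assoc, ← F.map₂_comp]
    simp only [Category.assoc, e]
  have e'' : h ◁ (F.map₂ σ ≫ F.mapComp S T ≫ (F.map₂ τ ≫ F.mapComp U V) ▷ F.map T) =
      h ◁ (F.map₂ ρ ≫ F.mapComp U W ≫ F.map U ◁ (F.map₂ ω ≫ F.mapComp V T)) ≫
        h ◁ (α_ _ _ _).inv := by
    rw [← whiskerLeft_comp, Category.assoc, Category.assoc, ← reassoc_of% e', Iso.hom_inv_id,
      Category.comp_id]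
  have e₃ := e'' =≫ ((α_ _ _ _).inv ≫ (α_ _ _ _).inv ▷ _)
  simpa [wComp] using e₃

/-- Left unitality of the whiskered constraints. -/
theorem wComp_wId_left {x : C} {a b : B} (h : x ⟶ ob a) {R T : a ⟶ b} {S : a ⟶ a}
    (σ : R ⟶ S ≫ T) (ι : S ⟶ 𝟙 a) (θ : R ⟶ T) (e : σ ≫ ι ▷ T ≫ (λ_ T).hom = θ) :
    F.wComp h σ ≫ F.wId h ι ▷ F.map T = h ◁ F.map₂ θ := by
  rw [← e, F.map₂_comp, F.map₂_comp, F.map₂_leftUnitor, reassoc_of% F.mapComp_naturality_left]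
  simp [wComp, wId]

/-- Right unitality of the whiskered constraints. -/
theorem wComp_wId_right {x : C} {a b : B} (h : x ⟶ ob a) {R S : a ⟶ b} {T : b ⟶ b}
    (σ : R ⟶ S ≫ T) (ι : T ⟶ 𝟙 b) (θ : R ⟶ S) (e : σ ≫ S ◁ ι ≫ (ρ_ S).hom = θ) :
    F.wComp h σ ≫ F.wId (h ≫ F.map S) ι = h ◁ F.map₂ θ := by
  rw [← e, F.map₂_comp, F.map₂_comp, F.map₂_rightUnitor, reassoc_of% F.mapComp_naturality_right]
  simp [wComp, wId]

end OplaxOn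
end Whiskered

/-! ### Whiskered form of the structure of a pair -/

section WhiskeredPair

variable {E : Type u} [Category.{v} E] {C : Type u₂} [Bicategory.{w₂, v₂} C]

/-- The 2-cell `k ⟶ f ≫ g` of the locally discrete bicategory given by an equality. -/
def locComp {X Y Z : E} {f : X ⟶ Y} {g : Y ⟶ Z} {k : X ⟶ Z} (e : f ≫ g = k) :
    k.toLoc ⟶ f.toLoc ≫ g.toLoc :=
  eqToHom (by subst e; rfl)

/-- The 2-cell `f ⟶ 𝟙 X` of the locally discrete bicategory given by an equality. -/
def locId {X : E} {f : X ⟶ X} (e : f = 𝟙 X) : f.toLoc ⟶ 𝟙 (LocallyDiscrete.mk X) :=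
  eqToHom (by subst e; rfl)

/-- Discharges the hypotheses of the laws of `wComp` and `wId` for $F_\otimes$ and $F_\Delta$, whose
source 2-cells are mere equalities. -/
theorem loc_hom₂_eq {a b : LocallyDiscrete E} {f g : a ⟶ b} (η θ : f ⟶ g) : η = θ :=
  Subsingleton.elim _ _

theorem OplaxOn.map₂_loc_self {ob : LocallyDiscrete E → C} (F : OplaxOn ob)
    {a b : LocallyDiscrete E} {f : a ⟶ b} (η : f ⟶ f) : F.map₂ η = 𝟙 _ := by
  rw [loc_hom₂_eq η (𝟙 f), F.map₂_id]

instance OplaxOn.isIso_map₂_loc {ob : LocallyDiscrete E → C} (F : OplaxOn ob)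
    {a b : LocallyDiscrete E} {f g : a ⟶ b} (η : f ⟶ g) : IsIso (F.map₂ η) := by
  obtain rfl := obj_ext_of_isDiscrete η
  rw [F.map₂_loc_self]
  infer_instance

namespace PairOn

variable {ob : E → C} (F : PairOn ob)

/-- The composition constraint of `F_⊗`, whiskered by `h`. -/
def wt {x : C} {X Y Z : E} (h : x ⟶ ob X) {f : X ⟶ Y} {g : Y ⟶ Z} {k : X ⟶ Z}
    (e : f ≫ g = k) : h ≫ F.t k ⟶ (h ≫ F.t f) ≫ F.t g :=
  F.tensor.obj.wComp (a := ⟨X⟩) h (locComp e)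

/-- The composition constraint of `F_Δ`, whiskered by `h`. -/
def wd {x : C} {X Y Z : E} (h : x ⟶ ob Z) {f : X ⟶ Y} {g : Y ⟶ Z} {k : X ⟶ Z}
    (e : f ≫ g = k) : h ≫ F.d k ⟶ (h ≫ F.d g) ≫ F.d f :=
  F.delta.obj.wComp (a := ⟨op Z⟩) h (locComp (f := g.op) (g := f.op) (congrArg Quiver.Hom.op e))

/-- The unit constraint of `F_⊗`, whiskered by `h`. -/
def wtId {x : C} {X : E} (h : x ⟶ ob X) {f : X ⟶ X} (e : f = 𝟙 X) : h ≫ F.t f ⟶ h :=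
  F.tensor.obj.wId (a := ⟨X⟩) h (locId e)

/-- The unit constraint of `F_Δ`, whiskered by `h`. -/
def wdId {x : C} {X : E} (h : x ⟶ ob X) {f : X ⟶ X} (e : f = 𝟙 X) : h ≫ F.d f ⟶ h :=
  F.delta.obj.wId (a := ⟨op X⟩) h (locId (f := f.op) (congrArg Quiver.Hom.op e))

/-- The Beck 2-cell, whiskered by `h`. -/
def wb {x : C} {P X Y Z : E} (h : x ⟶ ob X) {g' : P ⟶ X} {f' : P ⟶ Y} {f : X ⟶ Z} {g : Y ⟶ Z}
    (sq : IsPullback g' f' f g) : (h ≫ F.d g') ≫ F.t f' ⟶ (h ≫ F.t f) ≫ F.d g :=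
  (α_ _ _ _).hom ≫ h ◁ F.beck sq ≫ (α_ _ _ _).inv

section Naturality

variable {x : C}

theorem wt_naturality {X Y Z : E} {h h' : x ⟶ ob X} (θ : h ⟶ h') {f : X ⟶ Y} {g : Y ⟶ Z}
    {k : X ⟶ Z} (e : f ≫ g = k) :
    θ ▷ F.t k ≫ F.wt h' e = F.wt h e ≫ θ ▷ F.t f ▷ F.t g :=
  F.tensor.obj.wComp_naturality (a := ⟨X⟩) θ _

theorem wd_naturality {X Y Z : E} {h h' : x ⟶ ob Z} (θ : h ⟶ h') {f : X ⟶ Y} {g : Y ⟶ Z}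
    {k : X ⟶ Z} (e : f ≫ g = k) :
    θ ▷ F.d k ≫ F.wd h' e = F.wd h e ≫ θ ▷ F.d g ▷ F.d f :=
  F.delta.obj.wComp_naturality (a := ⟨op Z⟩) θ _

theorem wtId_naturality {X : E} {h h' : x ⟶ ob X} (θ : h ⟶ h') {f : X ⟶ X} (e : f = 𝟙 X) :
    θ ▷ F.t f ≫ F.wtId h' e = F.wtId h e ≫ θ :=
  F.tensor.obj.wId_naturality (a := ⟨X⟩) θ _

theorem wdId_naturality {X : E} {h h' : x ⟶ ob X} (θ : h ⟶ h') {f : X ⟶ X} (e : f = 𝟙 X) :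
    θ ▷ F.d f ≫ F.wdId h' e = F.wdId h e ≫ θ :=
  F.delta.obj.wId_naturality (a := ⟨op X⟩) θ _

theorem wb_naturality {P X Y Z : E} {h h' : x ⟶ ob X} (θ : h ⟶ h') {g' : P ⟶ X} {f' : P ⟶ Y}
    {f : X ⟶ Z} {g : Y ⟶ Z} (sq : IsPullback g' f' f g) :
    θ ▷ F.d g' ▷ F.t f' ≫ F.wb h' sq = F.wb h sq ≫ θ ▷ F.t f ▷ F.d g := by
  have := whisker_exchange θ (F.beck sq)
  simp only [wb, Category.assoc, whiskerRight_comp] at this ⊢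
  rw [← cancel_epi (α_ _ _ _).inv, Iso.inv_hom_id_assoc, ← cancel_mono (α_ _ _ _).hom]
  simpa only [Category.assoc, Iso.inv_hom_id, Category.comp_id] using this.symm

variable {y : C} (k : y ⟶ x)

theorem whiskerLeft_wt {X Y Z : E} (h : x ⟶ ob X) {f : X ⟶ Y} {g : Y ⟶ Z} {fg : X ⟶ Z}
    (e : f ≫ g = fg) : k ◁ F.wt h e = (α_ _ _ _).inv ≫ F.wt (k ≫ h) e ≫ (α_ _ _ _).hom ▷ _ ≫
      (α_ _ _ _).hom :=
  F.tensor.obj.whiskerLeft_wComp (a := ⟨X⟩) k h _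

theorem whiskerLeft_wd {X Y Z : E} (h : x ⟶ ob Z) {f : X ⟶ Y} {g : Y ⟶ Z} {fg : X ⟶ Z}
    (e : f ≫ g = fg) : k ◁ F.wd h e = (α_ _ _ _).inv ≫ F.wd (k ≫ h) e ≫ (α_ _ _ _).hom ▷ _ ≫
      (α_ _ _ _).hom :=
  F.delta.obj.whiskerLeft_wComp (a := ⟨op Z⟩) k h _

theorem whiskerLeft_wtId {X : E} (h : x ⟶ ob X) {f : X ⟶ X} (e : f = 𝟙 X) :
    k ◁ F.wtId h e = (α_ _ _ _).inv ≫ F.wtId (k ≫ h) e :=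
  F.tensor.obj.whiskerLeft_wId (a := ⟨X⟩) k h _

theorem whiskerLeft_wdId {X : E} (h : x ⟶ ob X) {f : X ⟶ X} (e : f = 𝟙 X) :
    k ◁ F.wdId h e = (α_ _ _ _).inv ≫ F.wdId (k ≫ h) e :=
  F.delta.obj.whiskerLeft_wId (a := ⟨op X⟩) k h _

theorem whiskerLeft_wb {P X Y Z : E} (h : x ⟶ ob X) {g' : P ⟶ X} {f' : P ⟶ Y}
    {f : X ⟶ Z} {g : Y ⟶ Z} (sq : IsPullback g' f' f g) :
    k ◁ F.wb h sq = (α_ _ _ _).inv ≫ (α_ _ _ _).inv ▷ _ ≫ F.wb (k ≫ h) sq ≫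
      (α_ _ _ _).hom ▷ _ ≫ (α_ _ _ _).hom := by
  simp [wb]

end Naturality

section Laws

variable {x : C}

theorem wt_assoc {X Y Z W : E} (h : x ⟶ ob X) {f : X ⟶ Y} {g : Y ⟶ Z} {k : Z ⟶ W} {fg : X ⟶ Z}
    {gk : Y ⟶ W} {fgk : X ⟶ W} (e₁ : f ≫ g = fg) (e₂ : fg ≫ k = fgk) (e₃ : g ≫ k = gk)
    (e₄ : f ≫ gk = fgk) :
    F.wt h e₂ ≫ F.wt h e₁ ▷ F.t k = F.wt h e₄ ≫ F.wt (h ≫ F.t f) e₃ :=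
  F.tensor.obj.wComp_assoc (a := ⟨X⟩) h _ _ _ _ (loc_hom₂_eq _ _)

theorem wd_assoc {X Y Z W : E} (h : x ⟶ ob W) {f : X ⟶ Y} {g : Y ⟶ Z} {k : Z ⟶ W} {fg : X ⟶ Z}
    {gk : Y ⟶ W} {fgk : X ⟶ W} (e₁ : f ≫ g = fg) (e₂ : fg ≫ k = fgk) (e₃ : g ≫ k = gk)
    (e₄ : f ≫ gk = fgk) :
    F.wd h e₄ ≫ F.wd h e₃ ▷ F.d f = F.wd h e₂ ≫ F.wd (h ≫ F.d k) e₁ :=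
  F.delta.obj.wComp_assoc (a := ⟨op W⟩) h _ _ _ _ (loc_hom₂_eq _ _)

theorem wt_wtId_left {X Y : E} (h : x ⟶ ob X) {i : X ⟶ X} {f : X ⟶ Y} (hi : i = 𝟙 X)
    (e : i ≫ f = f) : F.wt h e ≫ F.wtId h hi ▷ F.t f = 𝟙 _ :=
  (F.tensor.obj.wComp_wId_left (a := ⟨X⟩) h _ _ (𝟙 _) (loc_hom₂_eq _ _)).trans
    (by rw [F.tensor.obj.map₂_id, whiskerLeft_id])

theorem wt_wtId_right {X Y : E} (h : x ⟶ ob X) {i : Y ⟶ Y} {f : X ⟶ Y} (hi : i = 𝟙 Y)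
    (e : f ≫ i = f) : F.wt h e ≫ F.wtId (h ≫ F.t f) hi = 𝟙 _ :=
  (F.tensor.obj.wComp_wId_right (a := ⟨X⟩) h _ _ (𝟙 _) (loc_hom₂_eq _ _)).trans
    (by rw [F.tensor.obj.map₂_id, whiskerLeft_id])

theorem wd_wdId_left {X Y : E} (h : x ⟶ ob Y) {i : Y ⟶ Y} {f : X ⟶ Y} (hi : i = 𝟙 Y)
    (e : f ≫ i = f) : F.wd h e ≫ F.wdId h hi ▷ F.d f = 𝟙 _ :=
  (F.delta.obj.wComp_wId_left (a := ⟨op Y⟩) h _ _ (𝟙 _) (loc_hom₂_eq _ _)).trans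
    (by rw [F.delta.obj.map₂_id, whiskerLeft_id])

theorem wd_wdId_right {X Y : E} (h : x ⟶ ob Y) {i : X ⟶ X} {f : X ⟶ Y} (hi : i = 𝟙 X)
    (e : i ≫ f = f) : F.wd h e ≫ F.wdId (h ≫ F.d f) hi = 𝟙 _ :=
  (F.delta.obj.wComp_wId_right (a := ⟨op Y⟩) h _ _ (𝟙 _) (loc_hom₂_eq _ _)).trans
    (by rw [F.delta.obj.map₂_id, whiskerLeft_id])

instance isIso_wt {X Y Z : E} (h : x ⟶ ob X) {f : X ⟶ Y} {g : Y ⟶ Z} {k : X ⟶ Z}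
    (e : f ≫ g = k) : IsIso (F.wt h e) := by
  have : IsIso (F.tensor.obj.mapComp f.toLoc g.toLoc) := F.tensor.property.isIso_mapComp _ _
  unfold wt OplaxOn.wComp
  infer_instance

instance isIso_wd {X Y Z : E} (h : x ⟶ ob Z) {f : X ⟶ Y} {g : Y ⟶ Z} {k : X ⟶ Z}
    (e : f ≫ g = k) : IsIso (F.wd h e) := by
  have : IsIso (F.delta.obj.mapComp g.op.toLoc f.op.toLoc) := F.delta.property.isIso_mapComp _ _
  unfold wd OplaxOn.wComp
  infer_instance

instance isIso_wtId {X : E} (h : x ⟶ ob X) {f : X ⟶ X} (e : f = 𝟙 X) : IsIso (F.wtId h e) := by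
  have : IsIso (F.tensor.obj.mapId ⟨X⟩) := F.tensor.property.isIso_mapId _
  unfold wtId OplaxOn.wId
  infer_instance

instance isIso_wdId {X : E} (h : x ⟶ ob X) {f : X ⟶ X} (e : f = 𝟙 X) : IsIso (F.wdId h e) := by
  have : IsIso (F.delta.obj.mapId ⟨op X⟩) := F.delta.property.isIso_mapId _
  unfold wdId OplaxOn.wId
  infer_instance

theorem wt_rfl {X Y Z : E} (h : x ⟶ ob X) (f : X ⟶ Y) (g : Y ⟶ Z) :
    F.wt h (rfl : f ≫ g = f ≫ g) = h ◁ F.tComp f g ≫ (α_ _ _ _).inv := by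
  unfold wt OplaxOn.wComp
  erw [F.tensor.obj.map₂_loc_self, Category.id_comp]

theorem wd_rfl {X Y Z : E} (h : x ⟶ ob Z) (f : X ⟶ Y) (g : Y ⟶ Z) :
    F.wd h (rfl : f ≫ g = f ≫ g) = h ◁ F.dComp f g ≫ (α_ _ _ _).inv := by
  unfold wd OplaxOn.wComp
  erw [F.delta.obj.map₂_loc_self, Category.id_comp]

theorem wtId_rfl {X : E} (h : x ⟶ ob X) : F.wtId h rfl = h ◁ F.tId X ≫ (ρ_ h).hom := by
  unfold wtId OplaxOn.wId
  erw [F.tensor.obj.map₂_loc_self, Category.id_comp]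

theorem wdId_rfl {X : E} (h : x ⟶ ob X) : F.wdId h rfl = h ◁ F.dId X ≫ (ρ_ h).hom := by
  unfold wdId OplaxOn.wId
  erw [F.delta.obj.map₂_loc_self, Category.id_comp]

end Laws

section Beck

variable {F} {x : C}

/-- Pushing the associators to the ends gives the condition for left-bracketed composites. One
direction serves to apply the condition at an arbitrary `h`, the other to establish it from the case
of an identity. -/
theorem wb_horizontal_iff {P₂ P₁ X₂ X₁ Y Z : E} (h : x ⟶ ob X₂) {f₂' : P₂ ⟶ P₁}
    {f₁' : P₁ ⟶ Y} {g'' : P₂ ⟶ X₂} {g' : P₁ ⟶ X₁} {g : Y ⟶ Z} {f₂ : X₂ ⟶ X₁} {f₁ : X₁ ⟶ Z}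
    (sq₂ : IsPullback g'' f₂' f₂ g') (sq₁ : IsPullback g' f₁' f₁ g) :
    F.wb h (sq₂.paste_vert sq₁) ≫ F.wt h rfl ▷ F.d g =
        F.wt (h ≫ F.d g'') rfl ≫ F.wb h sq₂ ▷ F.t f₁' ≫ F.wb (h ≫ F.t f₂) sq₁ ↔
      h ◁ (F.beck (sq₂.paste_vert sq₁) ≫ F.tComp f₂ f₁ ▷ F.d g) =
      h ◁ (F.d g'' ◁ F.tComp f₂' f₁' ≫ (α_ (F.d g'') (F.t f₂') (F.t f₁')).inv ≫
        F.beck sq₂ ▷ F.t f₁' ≫ (α_ (F.t f₂) (F.d g') (F.t f₁')).hom ≫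
          F.t f₂ ◁ F.beck sq₁ ≫ (α_ (F.t f₂) (F.t f₁) (F.d g)).inv) := by
  rw [← cancel_epi (α_ _ _ _).hom,
    ← cancel_mono ((α_ h (F.t f₂ ≫ F.t f₁) (F.d g)).inv ≫ (α_ h (F.t f₂) (F.t f₁)).inv ▷ F.d g)]
  simp only [wb, wt_rfl]
  simp

theorem wb_vertical_iff {P₂ P₁ X Y₂ Y₁ Z : E} (h : x ⟶ ob X) {f'' : P₂ ⟶ Y₂}
    {f' : P₁ ⟶ Y₁} {f : X ⟶ Z} {g₂' : P₂ ⟶ P₁} {g₁' : P₁ ⟶ X} {g₂ : Y₂ ⟶ Y₁} {g₁ : Y₁ ⟶ Z}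
    (sq₂ : IsPullback g₂' f'' f' g₂) (sq₁ : IsPullback g₁' f' f g₁) :
    F.wb h (sq₂.paste_horiz sq₁) ≫ F.wd (h ≫ F.t f) rfl =
        F.wd h rfl ▷ F.t f'' ≫ F.wb (h ≫ F.d g₁') sq₂ ≫ F.wb h sq₁ ▷ F.d g₂ ↔
      h ◁ (F.beck (sq₂.paste_horiz sq₁) ≫ F.t f ◁ F.dComp g₂ g₁) =
      h ◁ (F.dComp g₂' g₁' ▷ F.t f'' ≫ (α_ (F.d g₁') (F.d g₂') (F.t f'')).hom ≫
        F.d g₁' ◁ F.beck sq₂ ≫ (α_ (F.d g₁') (F.t f') (F.d g₂)).inv ≫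
          F.beck sq₁ ▷ F.d g₂ ≫ (α_ (F.t f) (F.d g₁) (F.d g₂)).hom) := by
  rw [← cancel_epi (α_ _ _ _).hom,
    ← cancel_mono ((α_ h (F.t f) (F.d g₁ ≫ F.d g₂)).inv ≫ (α_ (h ≫ F.t f) (F.d g₁) (F.d g₂)).inv)]
  simp only [wb, wd_rfl]
  simp

theorem wb_horizontal_id_iff {X Y : E} (h : x ⟶ ob X) (f : X ⟶ Y) :
    F.wb h (IsPullback.id_horiz f) ≫ F.wdId (h ≫ F.t f) rfl = F.wdId h rfl ▷ F.t f ↔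
      h ◁ (F.beck (IsPullback.id_horiz f) ≫ F.t f ◁ F.dId Y) =
      h ◁ (F.dId X ▷ F.t f ≫ (λ_ (F.t f)).hom ≫ (ρ_ (F.t f)).inv) := by
  rw [← cancel_epi (α_ _ _ _).hom, ← cancel_mono (h ◁ (ρ_ (F.t f)).hom)]
  simp only [wb, wdId_rfl]
  simp

theorem wb_vertical_id_iff {X Y : E} (h : x ⟶ ob Y) (g : X ⟶ Y) :
    F.wb h (IsPullback.id_vert g) ≫ F.wtId h rfl ▷ F.d g = F.wtId (h ≫ F.d g) rfl ↔
      h ◁ (F.beck (IsPullback.id_vert g) ≫ F.tId Y ▷ F.d g) =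
      h ◁ (F.d g ◁ F.tId X ≫ (ρ_ (F.d g)).hom ≫ (λ_ (F.d g)).inv) := by
  rw [← cancel_epi (α_ _ _ _).hom, ← cancel_mono (h ◁ (λ_ (F.d g)).hom)]
  simp only [wb, wtId_rfl]
  simp

/-- Equations `e`, `e'` in place of literal composites make the condition applicable to squares
whose sides are composites only propositionally, without transport. -/
theorem IsLaxBeck.wb_horizontal (hF : F.IsLaxBeck) {P₂ P₁ X₂ X₁ Y Z : E} (h : x ⟶ ob X₂)
    {f₂' : P₂ ⟶ P₁} {f₁' : P₁ ⟶ Y} {g'' : P₂ ⟶ X₂} {g' : P₁ ⟶ X₁} {g : Y ⟶ Z} {f₂ : X₂ ⟶ X₁}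
    {f₁ : X₁ ⟶ Z} {f' : P₂ ⟶ Y} {f : X₂ ⟶ Z} (sq : IsPullback g'' f' f g)
    (sq₂ : IsPullback g'' f₂' f₂ g') (sq₁ : IsPullback g' f₁' f₁ g) (e : f₂ ≫ f₁ = f)
    (e' : f₂' ≫ f₁' = f') :
    F.wb h sq ≫ F.wt h e ▷ F.d g =
      F.wt (h ≫ F.d g'') e' ≫ F.wb h sq₂ ▷ F.t f₁' ≫ F.wb (h ≫ F.t f₂) sq₁ := by
  subst e e'
  exact (wb_horizontal_iff h sq₂ sq₁).2 (congrArg _ (hF.horizontal sq₂ sq₁))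

theorem IsLaxBeck.wb_vertical (hF : F.IsLaxBeck) {P₂ P₁ X Y₂ Y₁ Z : E} (h : x ⟶ ob X)
    {f'' : P₂ ⟶ Y₂} {f' : P₁ ⟶ Y₁} {f : X ⟶ Z} {g₂' : P₂ ⟶ P₁} {g₁' : P₁ ⟶ X} {g₂ : Y₂ ⟶ Y₁}
    {g₁ : Y₁ ⟶ Z} {g' : P₂ ⟶ X} {g : Y₂ ⟶ Z} (sq : IsPullback g' f'' f g)
    (sq₂ : IsPullback g₂' f'' f' g₂) (sq₁ : IsPullback g₁' f' f g₁) (e : g₂ ≫ g₁ = g)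
    (e' : g₂' ≫ g₁' = g') :
    F.wb h sq ≫ F.wd (h ≫ F.t f) e =
      F.wd h e' ▷ F.t f'' ≫ F.wb (h ≫ F.d g₁') sq₂ ≫ F.wb h sq₁ ▷ F.d g₂ := by
  subst e e'
  exact (wb_vertical_iff h sq₂ sq₁).2 (congrArg _ (hF.vertical sq₂ sq₁))

theorem IsLaxBeck.wb_horizontal_id (hF : F.IsLaxBeck) {X Y : E} (h : x ⟶ ob X) {f : X ⟶ Y}
    {i : X ⟶ X} {j : Y ⟶ Y} (sq : IsPullback i f f j) (hi : i = 𝟙 X) (hj : j = 𝟙 Y) :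
    F.wb h sq ≫ F.wdId (h ≫ F.t f) hj = F.wdId h hi ▷ F.t f := by
  subst hi hj
  exact (wb_horizontal_id_iff h f).2 (congrArg _ (hF.horizontal_id f))

theorem IsLaxBeck.wb_vertical_id (hF : F.IsLaxBeck) {X Y : E} (h : x ⟶ ob Y) {g : X ⟶ Y}
    {i : X ⟶ X} {j : Y ⟶ Y} (sq : IsPullback g i j g) (hi : i = 𝟙 X) (hj : j = 𝟙 Y) :
    F.wb h sq ≫ F.wtId h hj ▷ F.d g = F.wtId (h ≫ F.d g) hi := by
  subst hi hj
  exact (wb_vertical_id_iff h g).2 (congrArg _ (hF.vertical_id g))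

end Beck

end PairOn
end WhiskeredPair

/-! ### Calculus of whiskered Beck 2-cells -/

section Calculus

variable {E : Type u} [Category.{v} E] {C : Type u₂} [Bicategory.{w₂, v₂} C]

theorem isPullback_iso_iso {X Y : E} (e : X ⟶ Y) [IsIso e] : IsPullback e e (𝟙 Y) (𝟙 Y) :=
  IsPullback.of_horiz_isIso ⟨rfl⟩

namespace PairOn

variable {ob : E → C} (F : PairOn ob) {x : C}

/-- The 2-cell `h ; F_Δ e ; F_⊗ e ⟶ h` attached to an isomorphism `e`. -/
def wc {P X : E} (h : x ⟶ ob X) (e : P ⟶ X) [IsIso e] : (h ≫ F.d e) ≫ F.t e ⟶ h :=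
  F.wb h (isPullback_iso_iso e) ≫ F.wtId h rfl ▷ F.d (𝟙 X) ≫ F.wdId h rfl

/-- The action of an isomorphism `e : (s, t) ≅ (s', t')` of spans. -/
def wMap {P P' X Y : E} (h : x ⟶ ob X) {e : P ⟶ P'} [IsIso e] {s : P ⟶ X} {t : P ⟶ Y}
    {s' : P' ⟶ X} {t' : P' ⟶ Y} (hs : e ≫ s' = s) (ht : e ≫ t' = t) :
    (h ≫ F.d s) ≫ F.t t ⟶ (h ≫ F.d s') ≫ F.t t' :=
  F.wd h hs ▷ F.t t ≫ F.wt _ ht ≫ F.wc (h ≫ F.d s') e ▷ F.t t'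

theorem wc_naturality {P X : E} {h h' : x ⟶ ob X} (θ : h ⟶ h') (e : P ⟶ X) [IsIso e] :
    θ ▷ F.d e ▷ F.t e ≫ F.wc h' e = F.wc h e ≫ θ := by
  simp only [wc, reassoc_of% F.wb_naturality, Category.assoc]
  rw [← comp_whiskerRight_assoc, F.wtId_naturality, comp_whiskerRight_assoc, F.wdId_naturality]

/-- The constraint attached to a presentation of the span `(a, b)` as a composite of `(s, t)`
and `(u, v)` by means of a pullback of `t` and `u`. -/
def wPb {P S T X Y Z : E} (h : x ⟶ ob X) {p : P ⟶ S} {q : P ⟶ T} {s : S ⟶ X} {t : S ⟶ Y}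
    {u : T ⟶ Y} {v : T ⟶ Z} {a : P ⟶ X} {b : P ⟶ Z} (sq : IsPullback p q t u)
    (ha : p ≫ s = a) (hb : q ≫ v = b) :
    (h ≫ F.d a) ≫ F.t b ⟶ (((h ≫ F.d s) ≫ F.t t) ≫ F.d u) ≫ F.t v :=
  F.wd h ha ▷ F.t b ≫ F.wt _ hb ≫ F.wb (h ≫ F.d s) sq ▷ F.t v

theorem wMap_naturality {P P' X Y : E} {h h' : x ⟶ ob X} (θ : h ⟶ h') {e : P ⟶ P'} [IsIso e]
    {s : P ⟶ X} {t : P ⟶ Y} {s' : P' ⟶ X} {t' : P' ⟶ Y} (hs : e ≫ s' = s) (ht : e ≫ t' = t) :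
    θ ▷ F.d s ▷ F.t t ≫ F.wMap h' hs ht = F.wMap h hs ht ≫ θ ▷ F.d s' ▷ F.t t' := by
  simp only [wMap, Category.assoc]
  rw [← comp_whiskerRight_assoc, F.wd_naturality, comp_whiskerRight_assoc,
    reassoc_of% F.wt_naturality, ← comp_whiskerRight, ← comp_whiskerRight, F.wc_naturality]

theorem wPb_naturality {P S T X Y Z : E} {h h' : x ⟶ ob X} (θ : h ⟶ h') {p : P ⟶ S} {q : P ⟶ T}
    {s : S ⟶ X} {t : S ⟶ Y} {u : T ⟶ Y} {v : T ⟶ Z} {a : P ⟶ X} {b : P ⟶ Z}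
    (sq : IsPullback p q t u) (ha : p ≫ s = a) (hb : q ≫ v = b) :
    θ ▷ F.d a ▷ F.t b ≫ F.wPb h' sq ha hb =
      F.wPb h sq ha hb ≫ θ ▷ F.d s ▷ F.t t ▷ F.d u ▷ F.t v := by
  simp only [wPb, Category.assoc]
  rw [← comp_whiskerRight_assoc, F.wd_naturality, comp_whiskerRight_assoc,
    reassoc_of% F.wt_naturality, ← comp_whiskerRight, ← comp_whiskerRight, F.wb_naturality]

/-- Moving the action of an isomorphism of spans past composition constraints. -/
theorem wMap_wd_wt {P P' S T X Y : E} (h : x ⟶ ob X) {e : P ⟶ P'} [IsIso e] {p : P' ⟶ S}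
    {q : P' ⟶ T} {p' : P ⟶ S} {q' : P ⟶ T} {s : S ⟶ X} {v : T ⟶ Y} {a : P' ⟶ X} {b : P' ⟶ Y}
    {a' : P ⟶ X} {b' : P ⟶ Y} (ha : p ≫ s = a) (hb : q ≫ v = b) (hp : e ≫ p = p')
    (hq : e ≫ q = q') (hea : e ≫ a = a') (heb : e ≫ b = b') (ha' : p' ≫ s = a')
    (hb' : q' ≫ v = b') :
    F.wMap h hea heb ≫ F.wd h ha ▷ F.t b ≫ F.wt _ hb =
      F.wd h ha' ▷ F.t b' ≫ F.wt _ hb' ≫ F.wMap (h ≫ F.d s) hp hq ▷ F.t v := by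
  simp only [wMap, Category.assoc, comp_whiskerRight]
  -- The cell cancelling `e` slides past the constraints; what remains is associativity of
  -- $F_\Delta$ at `e`, `p`, `s` and of $F_\otimes$ at `e`, `q`, `v`.
  rw [← comp_whiskerRight_assoc (F.wc (h ≫ F.d a) e), ← F.wc_naturality,
    comp_whiskerRight_assoc, ← reassoc_of% F.wt_naturality, ← comp_whiskerRight_assoc,
    F.wd_assoc h hp ha' ha hea, comp_whiskerRight_assoc, F.wt_naturality,
    ← reassoc_of% F.wt_assoc _ hq hb' hb heb, reassoc_of% F.wt_naturality]

variable {F}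

namespace IsLaxBeck

/-- Writing `f` as `𝟙 X ≫ f` presents the square as a pasting of the square `(e, e, 1, 1)` with the
identity square of `f`. The Beck 2-cell of the latter consists of unit constraints, so only the cell
cancelling `e` survives. -/
theorem wb_wdId_of_isIso (hF : F.IsLaxBeck) {P X Y : E} (h : x ⟶ ob X) {e : P ⟶ X} [IsIso e]
    {f : X ⟶ Y} {k : P ⟶ Y}
    (sq : IsPullback e k f (𝟙 Y)) (he : e ≫ f = k) :
    F.wb h sq ≫ F.wdId (h ≫ F.t f) rfl = F.wt (h ≫ F.d e) he ≫ F.wc h e ▷ F.t f := by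
  have H := hF.wb_horizontal h sq (isPullback_iso_iso e) (IsPullback.id_horiz f)
    (Category.id_comp f) he =≫ (F.wtId h rfl ▷ F.t f ▷ F.d (𝟙 Y))
  rw [Category.assoc, ← comp_whiskerRight, F.wt_wtId_left, id_whiskerRight, Category.comp_id] at H
  rw [H]
  simp only [Category.assoc, wc, comp_whiskerRight]
  rw [← reassoc_of% F.wb_naturality, hF.wb_horizontal_id]

/-- Beck 2-cells are compatible with isomorphisms of the apex. -/
theorem wMap_wb (hF : F.IsLaxBeck) {P P' X Y Z : E} (h : x ⟶ ob X) {e : P ⟶ P'} [IsIso e]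
    {g' : P' ⟶ X} {f' : P' ⟶ Y}
    {f : X ⟶ Z} {g : Y ⟶ Z} {a : P ⟶ X} {b : P ⟶ Y} (sq : IsPullback g' f' f g)
    (sq' : IsPullback a b f g) (ha : e ≫ g' = a) (hb : e ≫ f' = b) :
    F.wMap h ha hb ≫ F.wb h sq = F.wb h sq' := by
  -- Writing `g` as `𝟙 Y ≫ g` presents `sq'` as a pasting of this square onto `sq`; its Beck 2-cell
  -- is evaluated by `wb_wdId_of_isIso`.
  have sq₂ : IsPullback e b f' (𝟙 Y) := IsPullback.of_horiz_isIso ⟨by simp [hb]⟩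
  have H := hF.wb_vertical h sq' sq₂ sq (Category.id_comp g) ha =≫ F.wdId _ rfl
  simp only [Category.assoc] at H
  rw [F.wd_wdId_right, Category.comp_id, F.wdId_naturality,
    reassoc_of% hF.wb_wdId_of_isIso _ sq₂ hb] at H
  rw [H]
  simp only [wMap, Category.assoc]

theorem wc_id (hF : F.IsLaxBeck) {X : E} (h : x ⟶ ob X) {e : X ⟶ X} [IsIso e] (he : e = 𝟙 X) :
    F.wc h e = F.wtId (h ≫ F.d e) he ≫ F.wdId h he := by
  subst he
  rw [wc, reassoc_of% hF.wb_vertical_id]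

theorem wMap_id (hF : F.IsLaxBeck) {P X Y : E} (h : x ⟶ ob X) {e : P ⟶ P} [IsIso e] {s : P ⟶ X}
    {t : P ⟶ Y}
    (he : e = 𝟙 P) (hs : e ≫ s = s) (ht : e ≫ t = t) : F.wMap h hs ht = 𝟙 _ := by
  rw [wMap, hF.wc_id _ he, comp_whiskerRight, reassoc_of% F.wt_wtId_left, ← comp_whiskerRight,
    F.wd_wdId_right, id_whiskerRight]

/-- An instance of invariance under change of apex, since the cell cancelling `e'` starts with the
Beck 2-cell of `(e', e', 1, 1)`. -/
theorem wMap_wc (hF : F.IsLaxBeck) {P P' X : E} (h : x ⟶ ob X) {e : P ⟶ P'} [IsIso e]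
    {e' : P' ⟶ X} [IsIso e']
    {k : P ⟶ X} [IsIso k] (hk : e ≫ e' = k) : F.wMap h hk hk ≫ F.wc h e' = F.wc h k := by
  rw [wc, wc, reassoc_of% hF.wMap_wb h (isPullback_iso_iso e') (isPullback_iso_iso k)]

/-- The composition constraints of the second action are moved in front of the first action, after
which `wMap_wc` merges the two cancellations into one. -/
theorem wMap_comp (hF : F.IsLaxBeck) {P P' P'' X Y : E} (h : x ⟶ ob X) {e : P ⟶ P'} [IsIso e]
    {e' : P' ⟶ P''}
    [IsIso e'] {k : P ⟶ P''} [IsIso k] {s : P ⟶ X} {t : P ⟶ Y} {s' : P' ⟶ X} {t' : P' ⟶ Y}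
    {s'' : P'' ⟶ X} {t'' : P'' ⟶ Y} (hk : e ≫ e' = k) (hs : e ≫ s' = s) (ht : e ≫ t' = t)
    (hs' : e' ≫ s'' = s') (ht' : e' ≫ t'' = t') (ks : k ≫ s'' = s) (kt : k ≫ t'' = t) :
    F.wMap h hs ht ≫ F.wMap h hs' ht' = F.wMap h ks kt := by
  conv_lhs => rw [wMap.eq_1 F h hs' ht']
  rw [reassoc_of% F.wMap_wd_wt h hs' ht' hk hk hs ht ks kt, ← comp_whiskerRight, hF.wMap_wc,
    wMap]

theorem wMap_wPb (hF : F.IsLaxBeck) {P P' S T X Y Z : E} (h : x ⟶ ob X) {e : P' ⟶ P} [IsIso e]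
    {p : P ⟶ S}
    {q : P ⟶ T} {s : S ⟶ X} {t : S ⟶ Y} {u : T ⟶ Y} {v : T ⟶ Z} {a : P ⟶ X} {b : P ⟶ Z}
    {p' : P' ⟶ S} {q' : P' ⟶ T} {a' : P' ⟶ X} {b' : P' ⟶ Z}
    (sq : IsPullback p q t u) (ha : p ≫ s = a) (hb : q ≫ v = b)
    (sq' : IsPullback p' q' t u) (ha' : p' ≫ s = a') (hb' : q' ≫ v = b')
    (hp : e ≫ p = p') (hq : e ≫ q = q') (hea : e ≫ a = a') (heb : e ≫ b = b') :
    F.wMap h hea heb ≫ F.wPb h sq ha hb = F.wPb h sq' ha' hb' := by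
  rw [wPb, reassoc_of% F.wMap_wd_wt h ha hb hp hq hea heb ha' hb', ← comp_whiskerRight,
    hF.wMap_wb _ sq sq', wPb]

/-- A triangle-type identity: the Beck 2-cell creates $F_\otimes e$, which is then cancelled against
$F_\Delta e$. Pasting `sq` onto `(e, e, 1, 1)` gives the vertical identity square of `k`, so only a
unit constraint is left. -/
theorem wd_wb_wc (hF : F.IsLaxBeck) {P Q X : E} (h : x ⟶ ob X) {p : P ⟶ Q} {e : Q ⟶ X} [IsIso e]
    {k : P ⟶ X}
    (hk : p ≫ e = k) (sq : IsPullback p (𝟙 P) e k) :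
    F.wd h hk ▷ F.t (𝟙 P) ≫ F.wb (h ≫ F.d e) sq ≫ F.wc h e ▷ F.d k = F.wtId (h ≫ F.d k) rfl := by
  have H := hF.wb_vertical h (IsPullback.id_vert k) sq (isPullback_iso_iso e)
    (Category.comp_id k) hk =≫ ((F.wtId h rfl ▷ F.d (𝟙 X) ≫ F.wdId h rfl) ▷ F.d k)
  simp only [Category.assoc, comp_whiskerRight] at H
  rw [← reassoc_of% F.wd_naturality, F.wd_wdId_left, Category.comp_id,
    hF.wb_vertical_id _ _ rfl rfl] at H
  rw [H]
  simp only [wc, comp_whiskerRight]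

/-- The same cancellation with the roles of $F_\otimes$ and $F_\Delta$ exchanged: the pasting is
horizontal and yields the horizontal identity square of `k`. -/
theorem wt_wb_wc (hF : F.IsLaxBeck) {P Q X : E} (h : x ⟶ ob P) {q : P ⟶ Q} {e : Q ⟶ X} [IsIso e]
    {k : P ⟶ X}
    (hk : q ≫ e = k) (sq : IsPullback (𝟙 P) q k e) :
    F.wt (h ≫ F.d (𝟙 P)) hk ≫ F.wb h sq ▷ F.t e ≫ F.wc (h ≫ F.t k) e =
      F.wdId h rfl ▷ F.t k := by
  have H := hF.wb_horizontal h (IsPullback.id_horiz k) sq (isPullback_iso_iso e)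
    (Category.comp_id k) hk =≫ (F.wtId (h ≫ F.t k) rfl ▷ F.d (𝟙 X) ≫ F.wdId (h ≫ F.t k) rfl)
  simp only [Category.assoc] at H
  rw [← comp_whiskerRight_assoc, F.wt_wtId_right, id_whiskerRight, Category.id_comp,
    hF.wb_horizontal_id _ _ rfl rfl] at H
  rw [H]
  simp only [wc]

theorem wPb_wMap_left (hF : F.IsLaxBeck) {P S S' T X Y Z : E} (h : x ⟶ ob X) {p : P ⟶ S}
    {q : P ⟶ T} {s : S ⟶ X}
    {t : S ⟶ Y} {u : T ⟶ Y} {v : T ⟶ Z} {a : P ⟶ X} {b : P ⟶ Z} {e : S ⟶ S'} [IsIso e]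
    {s' : S' ⟶ X} {t' : S' ⟶ Y} {p' : P ⟶ S'} (sq : IsPullback p q t u) (ha : p ≫ s = a)
    (hb : q ≫ v = b) (hs : e ≫ s' = s) (ht : e ≫ t' = t) (hp : p ≫ e = p')
    (sq' : IsPullback p' q t' u) (ha' : p' ≫ s' = a) :
    F.wPb h sq ha hb ≫ F.wMap h hs ht ▷ F.d u ▷ F.t v = F.wPb h sq' ha' hb := by
  -- The square `sq` is this one pasted with `sq'`. The extra Beck 2-cell and the cell cancelling
  -- `e` are absorbed together by `wd_wb_wc`.
  have sq₂ : IsPullback p (𝟙 P) e p' := IsPullback.of_vert_isIso ⟨by simp [hp]⟩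
  have key : F.wd h ha ▷ F.t q ≫ F.wb (h ≫ F.d s) sq ≫ F.wMap h hs ht ▷ F.d u =
      F.wd h ha' ▷ F.t q ≫ F.wb (h ≫ F.d s') sq' := by
    simp only [wMap, comp_whiskerRight]
    rw [← reassoc_of% F.wb_naturality, reassoc_of% hF.wb_horizontal _ sq sq₂ sq' ht
      (Category.id_comp q), ← F.wb_naturality, ← comp_whiskerRight_assoc,
      F.wd_assoc h hp ha' hs ha, comp_whiskerRight_assoc, reassoc_of% F.wt_naturality]
    simp only [← comp_whiskerRight_assoc]
    rw [hF.wd_wb_wc _ hp sq₂, reassoc_of% F.wt_wtId_left]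
  simp only [wPb, Category.assoc]
  rw [← comp_whiskerRight, reassoc_of% F.wt_naturality, reassoc_of% F.wt_naturality,
    ← comp_whiskerRight, ← comp_whiskerRight, key]

theorem wPb_wMap_right (hF : F.IsLaxBeck) {P S T T' X Y Z : E} (h : x ⟶ ob X) {p : P ⟶ S}
    {q : P ⟶ T} {s : S ⟶ X}
    {t : S ⟶ Y} {u : T ⟶ Y} {v : T ⟶ Z} {a : P ⟶ X} {b : P ⟶ Z} {e : T ⟶ T'} [IsIso e]
    {u' : T' ⟶ Y} {v' : T' ⟶ Z} {q' : P ⟶ T'} (sq : IsPullback p q t u) (ha : p ≫ s = a)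
    (hb : q ≫ v = b) (hu : e ≫ u' = u) (hv : e ≫ v' = v) (hq : q ≫ e = q')
    (sq' : IsPullback p q' t u') (hb' : q' ≫ v' = b) :
    F.wPb h sq ha hb ≫ F.wMap ((h ≫ F.d s) ≫ F.t t) hu hv = F.wPb h sq' ha hb' := by
  -- The square `sq` is this one pasted with `sq'`, now vertically; the extra Beck 2-cell is
  -- absorbed by `wt_wb_wc`.
  have sq₂ : IsPullback (𝟙 P) q q' e := IsPullback.of_horiz_isIso ⟨by simp [hq]⟩
  have key : F.wt ((h ≫ F.d s) ≫ F.d p) hq ≫ (F.wd (h ≫ F.d s) (Category.id_comp p) ▷ F.t q ≫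
      F.wb ((h ≫ F.d s) ≫ F.d p) sq₂ ≫ F.wb (h ≫ F.d s) sq' ▷ F.d e) ▷ F.t e ≫ F.wc _ e =
        F.wb (h ≫ F.d s) sq' := by
    simp only [comp_whiskerRight, Category.assoc]
    rw [F.wc_naturality, ← reassoc_of% F.wt_naturality, reassoc_of% hF.wt_wb_wc _ hq sq₂,
      ← comp_whiskerRight_assoc, F.wd_wdId_right, id_whiskerRight, Category.id_comp]
  simp only [wPb, wMap, Category.assoc]
  rw [← comp_whiskerRight_assoc (F.wb _ sq), hF.wb_vertical _ sq sq₂ sq' hu (Category.id_comp p),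
    reassoc_of% F.wt_naturality _ hv, ← reassoc_of% F.wt_assoc _ hq hb' hv hb, ← comp_whiskerRight,
    ← comp_whiskerRight, key]

/-- Associativity of the constraints. -/
theorem wPb_assoc (hF : F.IsLaxBeck) {R S T U V W X₀ X₁ X₂ X₃ : E} (h : x ⟶ ob X₀)
    {a₁ : U ⟶ X₀} {b₁ : U ⟶ X₁} {a₂ : V ⟶ X₁} {b₂ : V ⟶ X₂} {a₃ : T ⟶ X₂} {b₃ : T ⟶ X₃}
    {s : S ⟶ X₀} {t : S ⟶ X₂} {w : W ⟶ X₁} {z : W ⟶ X₃} {r : R ⟶ X₀} {r' : R ⟶ X₃}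
    {p : R ⟶ S} {q : R ⟶ T} {p' : S ⟶ U} {q' : S ⟶ V} {p'' : R ⟶ U} {q'' : R ⟶ W}
    {p₃ : W ⟶ V} {q₃ : W ⟶ T}
    (sqσ : IsPullback p q t a₃) (hr : p ≫ s = r) (hr' : q ≫ b₃ = r')
    (sqτ : IsPullback p' q' b₁ a₂) (hs : p' ≫ a₁ = s) (ht : q' ≫ b₂ = t)
    (sqρ : IsPullback p'' q'' b₁ w) (hr₂ : p'' ≫ a₁ = r) (hr₂' : q'' ≫ z = r')
    (sqω : IsPullback p₃ q₃ b₂ a₃) (hw : p₃ ≫ a₂ = w) (hz : q₃ ≫ b₃ = z)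
    (e₁ : p ≫ p' = p'') (e₂ : p ≫ q' = q'' ≫ p₃) (e₃ : q'' ≫ q₃ = q) :
    F.wPb h sqσ hr hr' ≫ F.wPb h sqτ hs ht ▷ F.d a₃ ▷ F.t b₃ =
      F.wPb h sqρ hr₂ hr₂' ≫ F.wPb ((h ≫ F.d a₁) ≫ F.t b₁) sqω hw hz := by
  -- The third square of the triple composite: `sqσ` is its horizontal pasting with `sqω`, and `sqρ`
  -- its vertical pasting with `sqτ`. Both sides thus involve the Beck 2-cells of `sq₂`, `sqτ` and
  -- `sqω`.
  have sq₂ : IsPullback p q'' q' p₃ :=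
    IsPullback.of_bot (by rw [e₃, ht]; exact sqσ) e₂ sqω
  have key : F.wb (h ≫ F.d s) sqσ ≫
      (F.wd h hs ▷ F.t t ≫ F.wt _ ht ≫ F.wb (h ≫ F.d a₁) sqτ ▷ F.t b₂) ▷ F.d a₃ =
      F.wd h hs ▷ F.d p ▷ F.t q ≫ F.wt _ e₃ ≫ F.wb _ sq₂ ▷ F.t q₃ ≫
        F.wb (h ≫ F.d a₁) sqτ ▷ F.d p₃ ▷ F.t q₃ ≫ F.wb _ sqω := by
    simp only [comp_whiskerRight]
    rw [← reassoc_of% F.wb_naturality, reassoc_of% hF.wb_horizontal _ sqσ sq₂ sqω ht e₃,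
      ← F.wb_naturality]
  simp only [wPb, Category.assoc]
  rw [← comp_whiskerRight (F.wb _ sqσ), key, ← comp_whiskerRight_assoc (F.wb _ sqρ),
    hF.wb_vertical _ sqρ sq₂ sqτ hw e₁, reassoc_of% F.wt_naturality _ hz,
    ← reassoc_of% F.wt_assoc _ e₃ hr' hz hr₂']
  simp only [comp_whiskerRight, Category.assoc]
  rw [← comp_whiskerRight_assoc (F.wt ((h ≫ F.d a₁) ≫ F.d p'') e₃), ← F.wt_naturality,
    comp_whiskerRight_assoc,
    ← reassoc_of% F.wt_naturality _ hr', ← reassoc_of% F.wt_naturality _ hr',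
    ← comp_whiskerRight_assoc (F.wd h hr₂), ← F.wd_assoc h e₁ hr₂ hs hr, comp_whiskerRight_assoc]

/-- The square is a vertical identity square, so the nullary condition replaces its Beck 2-cell by
unit constraints, which cancel against the composition constraints. -/
theorem wPb_id_left (hF : F.IsLaxBeck) {P X Y : E} (h : x ⟶ ob X) {l : P ⟶ X} {r : P ⟶ Y}
    (sq : IsPullback l (𝟙 P) (𝟙 X) l) (hl : l ≫ 𝟙 X = l) (hr : 𝟙 P ≫ r = r) :
    F.wPb h sq hl hr ≫ (F.wtId (h ≫ F.d (𝟙 X)) rfl ≫ F.wdId h rfl) ▷ F.d l ▷ F.t r = 𝟙 _ := by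
  simp only [wPb, Category.assoc, comp_whiskerRight]
  rw [← comp_whiskerRight_assoc (F.wb _ _), hF.wb_vertical_id _ _ rfl rfl,
    reassoc_of% F.wt_wtId_left,
    ← comp_whiskerRight, F.wd_wdId_left, id_whiskerRight]

theorem wPb_id_right (hF : F.IsLaxBeck) {P X Y : E} (h : x ⟶ ob X) {l : P ⟶ X} {r : P ⟶ Y}
    (sq : IsPullback (𝟙 P) r r (𝟙 Y)) (hl : 𝟙 P ≫ l = l) (hr : r ≫ 𝟙 Y = r) :
    F.wPb h sq hl hr ≫ F.wtId _ rfl ≫ F.wdId _ rfl = 𝟙 _ := by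
  simp only [wPb, Category.assoc]
  rw [reassoc_of% F.wtId_naturality, hF.wb_horizontal_id _ _ rfl rfl, reassoc_of% F.wt_wtId_right,
    ← comp_whiskerRight, F.wd_wdId_right, id_whiskerRight]

end IsLaxBeck
end PairOn
end Calculus

/-! ### 2-cells from families of whiskered 2-cells -/

section Family

variable {C : Type u₂} [Bicategory.{w₂, v₂} C]

/-- The 2-cell determined by a family of whiskered 2-cells. -/
abbrev cellOfFamily {a b : C} {f g : a ⟶ b} (φ : ∀ (x : C) (h : x ⟶ a), h ≫ f ⟶ h ≫ g) : f ⟶ g :=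
  (λ_ f).inv ≫ φ a (𝟙 a) ≫ (λ_ g).hom

/-- A Yoneda argument: `pre` turns the whiskering by `h` of the member at the identity into the
member at `h ≫ 𝟙 a`, and naturality along the right unitor of `h` brings it back to `h`. -/
theorem whiskerLeft_cellOfFamily {a b : C} {f g : a ⟶ b}
    (φ : ∀ (x : C) (h : x ⟶ a), h ≫ f ⟶ h ≫ g)
    (nat : ∀ {x : C} {h h' : x ⟶ a} (θ : h ⟶ h'), θ ▷ f ≫ φ x h' = φ x h ≫ θ ▷ g)
    (pre : ∀ {x y : C} (k : y ⟶ x) (h : x ⟶ a),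
      k ◁ φ x h = (α_ _ _ _).inv ≫ φ y (k ≫ h) ≫ (α_ _ _ _).hom)
    {x : C} (h : x ⟶ a) : h ◁ cellOfFamily φ = φ x h := by
  have := nat (ρ_ h).hom
  rw [cellOfFamily, whiskerLeft_comp, whiskerLeft_comp, pre]
  simp only [Category.assoc, triangle_assoc_comp_left, ← this, triangle_assoc_comp_left_inv_assoc]
  simp only [inv_hom_whiskerRight_assoc]

theorem hom₂_ext_of_whiskerLeft {a b : C} {f g : a ⟶ b} {η θ : f ⟶ g}
    (H : ∀ {x : C} (h : x ⟶ a), h ◁ η = h ◁ θ) : η = θ :=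
  (whiskerLeft_iff η θ).1 (H (𝟙 a))

end Family

/-! ### Stability of the whiskered calculus under precomposition -/

section Whiskering

variable {E : Type u} [Category.{v} E] {C : Type u₂} [Bicategory.{w₂, v₂} C]

namespace PairOn

variable {ob : E → C} (F : PairOn ob) {x y : C} (k : y ⟶ x)

theorem whiskerLeft_wc {P X : E} (h : x ⟶ ob X) (e : P ⟶ X) [IsIso e] :
    k ◁ F.wc h e = (α_ _ _ _).inv ≫ (α_ _ _ _).inv ▷ _ ≫ F.wc (k ≫ h) e := by
  simp only [wc, whiskerLeft_comp, whisker_assoc_symm, whiskerLeft_wb, whiskerLeft_wtId,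
    whiskerLeft_wdId, Category.assoc, Iso.hom_inv_id_assoc, comp_whiskerRight,
    hom_inv_whiskerRight_assoc]

/-- Only the bracketing of the whiskering 1-cell changes; naturality in that 1-cell (`h₁`, `h₂`)
carries the associators across the constraints. -/
theorem whiskerLeft_wMap {P P' X Y : E} (h : x ⟶ ob X) {e : P ⟶ P'} [IsIso e]
    {s : P ⟶ X} {t : P ⟶ Y} {s' : P' ⟶ X} {t' : P' ⟶ Y} (hs : e ≫ s' = s) (ht : e ≫ t' = t) :
    k ◁ F.wMap h hs ht = (α_ _ _ _).inv ≫ (α_ _ _ _).inv ▷ _ ≫ F.wMap (k ≫ h) hs ht ≫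
      (α_ _ _ _).hom ▷ _ ≫ (α_ _ _ _).hom := by
  have h₁ := F.wt_naturality ((α_ k h (F.d s')).hom ▷ F.d e ≫ (α_ k (h ≫ F.d s') (F.d e)).hom) ht
  have h₂ := congrArg (· ▷ F.t t') (F.wc_naturality (α_ k h (F.d s')).hom e)
  simp only [wMap, whiskerLeft_comp, whisker_assoc_symm, whiskerLeft_wd, whiskerLeft_wt,
    whiskerLeft_wc, Category.assoc, Iso.hom_inv_id_assoc, comp_whiskerRight,
    hom_inv_whiskerRight_assoc] at h₁ h₂ ⊢
  rw [reassoc_of% h₁, ← reassoc_of% h₂, ← comp_whiskerRight_assoc ((α_ k _ (F.d e)).hom ▷ _),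
    hom_inv_whiskerRight, id_whiskerRight, Category.id_comp]

theorem whiskerLeft_wPb {P S T X Y Z : E} (h : x ⟶ ob X) {p : P ⟶ S} {q : P ⟶ T} {s : S ⟶ X}
    {t : S ⟶ Y} {u : T ⟶ Y} {v : T ⟶ Z} {a : P ⟶ X} {b : P ⟶ Z} (sq : IsPullback p q t u)
    (ha : p ≫ s = a) (hb : q ≫ v = b) :
    k ◁ F.wPb h sq ha hb = (α_ _ _ _).inv ≫ (α_ _ _ _).inv ▷ _ ≫ F.wPb (k ≫ h) sq ha hb ≫
      (α_ _ _ _).hom ▷ _ ▷ _ ▷ _ ≫ (α_ _ _ _).hom ▷ _ ▷ _ ≫ (α_ _ _ _).hom ▷ _ ≫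
        (α_ _ _ _).hom := by
  have h₁ := F.wt_naturality ((α_ k h (F.d s)).hom ▷ F.d p ≫ (α_ k (h ≫ F.d s) (F.d p)).hom) hb
  have h₂ := congrArg (· ▷ F.t v) (F.wb_naturality (α_ k h (F.d s)).hom sq)
  simp only [wPb, whiskerLeft_comp, whisker_assoc_symm, whiskerLeft_wd, whiskerLeft_wt,
    whiskerLeft_wb, Category.assoc, Iso.hom_inv_id_assoc, comp_whiskerRight,
    hom_inv_whiskerRight_assoc] at h₁ h₂ ⊢
  rw [reassoc_of% h₁, ← reassoc_of% h₂, ← comp_whiskerRight_assoc ((α_ k _ (F.d p)).hom ▷ _),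
    hom_inv_whiskerRight, id_whiskerRight, Category.id_comp]

end PairOn
end Whiskering

/-! ### The functor on spans attached to a lax Beck pair -/

section Cells

variable {E : Type u} [Category.{v} E] {C : Type u₂} [Bicategory.{w₂, v₂} C]

namespace PairOn

variable {ob : E → C} (F : PairOn ob)

/-- The action of an isomorphism of spans, as a 2-cell. -/
def cMap {P P' X Y : E} {e : P ⟶ P'} [IsIso e] {s : P ⟶ X} {t : P ⟶ Y}
    {s' : P' ⟶ X} {t' : P' ⟶ Y} (hs : e ≫ s' = s) (ht : e ≫ t' = t) :
    F.d s ≫ F.t t ⟶ F.d s' ≫ F.t t' :=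
  cellOfFamily fun _ h => (α_ _ _ _).inv ≫ F.wMap h hs ht ≫ (α_ _ _ _).hom

/-- The nullary constraint, as a 2-cell. -/
def cId (X : E) : F.d (𝟙 X) ≫ F.t (𝟙 X) ⟶ 𝟙 (ob X) :=
  cellOfFamily fun _ h => (α_ _ _ _).inv ≫ F.wtId _ rfl ≫ F.wdId h rfl ≫ (ρ_ h).inv

/-- The binary constraint attached to a pullback square, as a 2-cell. -/
def cPb {P S T X Y Z : E} {p : P ⟶ S} {q : P ⟶ T} {s : S ⟶ X} {t : S ⟶ Y}
    {u : T ⟶ Y} {v : T ⟶ Z} {a : P ⟶ X} {b : P ⟶ Z} (sq : IsPullback p q t u)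
    (ha : p ≫ s = a) (hb : q ≫ v = b) :
    F.d a ≫ F.t b ⟶ (F.d s ≫ F.t t) ≫ F.d u ≫ F.t v :=
  cellOfFamily fun _ h => (α_ _ _ _).inv ≫ F.wPb h sq ha hb ≫
    (α_ _ _ _).hom ▷ _ ▷ _ ≫ (α_ _ _ _).hom ≫ (α_ _ _ _).hom

variable {x : C}

/-- Recovers the whole family from the 2-cell, so that the laws of `wMap` become laws of `cMap`. -/
theorem whiskerLeft_cMap {P P' X Y : E} (h : x ⟶ ob X) {e : P ⟶ P'} [IsIso e] {s : P ⟶ X}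
    {t : P ⟶ Y} {s' : P' ⟶ X} {t' : P' ⟶ Y} (hs : e ≫ s' = s) (ht : e ≫ t' = t) :
    h ◁ F.cMap hs ht = (α_ _ _ _).inv ≫ F.wMap h hs ht ≫ (α_ _ _ _).hom := by
  unfold cMap
  refine whiskerLeft_cellOfFamily _ (fun θ => ?_) (fun k h => ?_) h
  · simp [reassoc_of% F.wMap_naturality θ hs ht]
  · simp [whiskerLeft_wMap]

theorem whiskerLeft_cId {X : E} (h : x ⟶ ob X) :
    h ◁ F.cId X = (α_ _ _ _).inv ≫ F.wtId _ rfl ≫ F.wdId h rfl ≫ (ρ_ h).inv := by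
  unfold cId
  refine whiskerLeft_cellOfFamily _ (fun θ => ?_) (fun k h => ?_) h
  · simp [reassoc_of% F.wtId_naturality, reassoc_of% F.wdId_naturality]
  · have : F.wtId (k ≫ h ≫ F.d (𝟙 X)) rfl = (α_ _ _ _).inv ▷ _ ≫ F.wtId _ rfl ≫ (α_ _ _ _).hom := by
      rw [← F.wtId_naturality, inv_hom_whiskerRight_assoc]
    simp [whiskerLeft_wtId, whiskerLeft_wdId, this]

theorem whiskerLeft_cPb {P S T X Y Z : E} (h : x ⟶ ob X) {p : P ⟶ S} {q : P ⟶ T} {s : S ⟶ X}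
    {t : S ⟶ Y} {u : T ⟶ Y} {v : T ⟶ Z} {a : P ⟶ X} {b : P ⟶ Z} (sq : IsPullback p q t u)
    (ha : p ≫ s = a) (hb : q ≫ v = b) :
    h ◁ F.cPb sq ha hb = (α_ _ _ _).inv ≫ F.wPb h sq ha hb ≫
      (α_ _ _ _).hom ▷ _ ▷ _ ≫ (α_ _ _ _).hom ≫ (α_ _ _ _).hom := by
  unfold cPb
  refine whiskerLeft_cellOfFamily _ (fun θ => ?_) (fun k h => ?_) h
  · simp [reassoc_of% F.wPb_naturality θ sq ha hb]
  · simp [whiskerLeft_wPb]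
    congr 1
    bicategory

variable {F}

theorem IsLaxBeck.cMap_id (hF : F.IsLaxBeck) {P X Y : E} {e : P ⟶ P} [IsIso e] {s : P ⟶ X}
    {t : P ⟶ Y}
    (he : e = 𝟙 P) (hs : e ≫ s = s) (ht : e ≫ t = t) : F.cMap hs ht = 𝟙 _ :=
  hom₂_ext_of_whiskerLeft fun h => by
    rw [F.whiskerLeft_cMap, hF.wMap_id h he]
    simp

theorem IsLaxBeck.cMap_comp (hF : F.IsLaxBeck) {P P' P'' X Y : E} {e : P ⟶ P'} [IsIso e]
    {e' : P' ⟶ P''}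
    [IsIso e'] {k : P ⟶ P''} [IsIso k] {s : P ⟶ X} {t : P ⟶ Y} {s' : P' ⟶ X} {t' : P' ⟶ Y}
    {s'' : P'' ⟶ X} {t'' : P'' ⟶ Y} (hk : e ≫ e' = k) (hs : e ≫ s' = s) (ht : e ≫ t' = t)
    (hs' : e' ≫ s'' = s') (ht' : e' ≫ t'' = t') (ks : k ≫ s'' = s) (kt : k ≫ t'' = t) :
    F.cMap hs ht ≫ F.cMap hs' ht' = F.cMap ks kt :=
  hom₂_ext_of_whiskerLeft fun h => by
    rw [whiskerLeft_comp, F.whiskerLeft_cMap, F.whiskerLeft_cMap, F.whiskerLeft_cMap,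
      ← hF.wMap_comp h hk hs ht hs' ht' ks kt]
    simp

theorem IsLaxBeck.cMap_cPb (hF : F.IsLaxBeck) {P P' S T X Y Z : E} {e : P' ⟶ P} [IsIso e]
    {p : P ⟶ S}
    {q : P ⟶ T} {s : S ⟶ X} {t : S ⟶ Y} {u : T ⟶ Y} {v : T ⟶ Z} {a : P ⟶ X} {b : P ⟶ Z}
    {p' : P' ⟶ S} {q' : P' ⟶ T} {a' : P' ⟶ X} {b' : P' ⟶ Z}
    (sq : IsPullback p q t u) (ha : p ≫ s = a) (hb : q ≫ v = b)
    (sq' : IsPullback p' q' t u) (ha' : p' ≫ s = a') (hb' : q' ≫ v = b')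
    (hp : e ≫ p = p') (hq : e ≫ q = q') (hea : e ≫ a = a') (heb : e ≫ b = b') :
    F.cMap hea heb ≫ F.cPb sq ha hb = F.cPb sq' ha' hb' :=
  hom₂_ext_of_whiskerLeft fun h => by
    rw [whiskerLeft_comp, F.whiskerLeft_cMap, F.whiskerLeft_cPb, F.whiskerLeft_cPb,
      ← hF.wMap_wPb h sq ha hb sq' ha' hb' hp hq hea heb]
    simp

theorem IsLaxBeck.cPb_cMap_left (hF : F.IsLaxBeck) {P S S' T X Y Z : E} {p : P ⟶ S} {q : P ⟶ T}
    {s : S ⟶ X}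
    {t : S ⟶ Y} {u : T ⟶ Y} {v : T ⟶ Z} {a : P ⟶ X} {b : P ⟶ Z} {e : S ⟶ S'} [IsIso e]
    {s' : S' ⟶ X} {t' : S' ⟶ Y} {p' : P ⟶ S'} (sq : IsPullback p q t u) (ha : p ≫ s = a)
    (hb : q ≫ v = b) (hs : e ≫ s' = s) (ht : e ≫ t' = t) (hp : p ≫ e = p')
    (sq' : IsPullback p' q t' u) (ha' : p' ≫ s' = a) :
    F.cPb sq ha hb ≫ F.cMap hs ht ▷ (F.d u ≫ F.t v) = F.cPb sq' ha' hb :=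
  hom₂_ext_of_whiskerLeft fun h => by
    rw [whiskerLeft_comp, whisker_assoc_symm, F.whiskerLeft_cMap, F.whiskerLeft_cPb,
      F.whiskerLeft_cPb, ← hF.wPb_wMap_left h sq ha hb hs ht hp sq' ha']
    simp

theorem IsLaxBeck.cPb_cMap_right (hF : F.IsLaxBeck) {P S T T' X Y Z : E} {p : P ⟶ S} {q : P ⟶ T}
    {s : S ⟶ X}
    {t : S ⟶ Y} {u : T ⟶ Y} {v : T ⟶ Z} {a : P ⟶ X} {b : P ⟶ Z} {e : T ⟶ T'} [IsIso e]
    {u' : T' ⟶ Y} {v' : T' ⟶ Z} {q' : P ⟶ T'} (sq : IsPullback p q t u) (ha : p ≫ s = a)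
    (hb : q ≫ v = b) (hu : e ≫ u' = u) (hv : e ≫ v' = v) (hq : q ≫ e = q')
    (sq' : IsPullback p q' t u') (hb' : q' ≫ v' = b) :
    F.cPb sq ha hb ≫ (F.d s ≫ F.t t) ◁ F.cMap hu hv = F.cPb sq' ha hb' :=
  hom₂_ext_of_whiskerLeft fun h => by
    rw [whiskerLeft_comp, comp_whiskerLeft_symm, F.whiskerLeft_cMap, F.whiskerLeft_cPb,
      F.whiskerLeft_cPb, ← hF.wPb_wMap_right h sq ha hb hu hv hq sq' hb']
    simp only [Category.assoc, Iso.hom_inv_id_assoc]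
    rw [reassoc_of% F.wMap_naturality]

theorem IsLaxBeck.cPb_assoc (hF : F.IsLaxBeck) {R S T U V W X₀ X₁ X₂ X₃ : E}
    {a₁ : U ⟶ X₀} {b₁ : U ⟶ X₁} {a₂ : V ⟶ X₁} {b₂ : V ⟶ X₂} {a₃ : T ⟶ X₂} {b₃ : T ⟶ X₃}
    {s : S ⟶ X₀} {t : S ⟶ X₂} {w : W ⟶ X₁} {z : W ⟶ X₃} {r : R ⟶ X₀} {r' : R ⟶ X₃}
    {p : R ⟶ S} {q : R ⟶ T} {p' : S ⟶ U} {q' : S ⟶ V} {p'' : R ⟶ U} {q'' : R ⟶ W}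
    {p₃ : W ⟶ V} {q₃ : W ⟶ T}
    (sqσ : IsPullback p q t a₃) (hr : p ≫ s = r) (hr' : q ≫ b₃ = r')
    (sqτ : IsPullback p' q' b₁ a₂) (hs : p' ≫ a₁ = s) (ht : q' ≫ b₂ = t)
    (sqρ : IsPullback p'' q'' b₁ w) (hr₂ : p'' ≫ a₁ = r) (hr₂' : q'' ≫ z = r')
    (sqω : IsPullback p₃ q₃ b₂ a₃) (hw : p₃ ≫ a₂ = w) (hz : q₃ ≫ b₃ = z)
    (e₁ : p ≫ p' = p'') (e₂ : p ≫ q' = q'' ≫ p₃) (e₃ : q'' ≫ q₃ = q) :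
    F.cPb sqρ hr₂ hr₂' ≫ (F.d a₁ ≫ F.t b₁) ◁ F.cPb sqω hw hz =
      F.cPb sqσ hr hr' ≫ F.cPb sqτ hs ht ▷ (F.d a₃ ≫ F.t b₃) ≫ (α_ _ _ _).hom :=
  hom₂_ext_of_whiskerLeft fun h => by
    have H := hF.wPb_assoc h sqσ hr hr' sqτ hs ht sqρ hr₂ hr₂' sqω hw hz e₁ e₂ e₃
    simp only [whiskerLeft_comp]
    rw [comp_whiskerLeft_symm, whisker_assoc_symm, F.whiskerLeft_cPb, F.whiskerLeft_cPb,
      F.whiskerLeft_cPb, F.whiskerLeft_cPb]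
    simp only [Category.assoc, Iso.hom_inv_id_assoc]
    -- Naturality removes the rebracketing in front of the second constraint and exposes the
    -- whiskered law `H`; only associators are left to compare.
    rw [reassoc_of% F.wPb_naturality, ← reassoc_of% H]
    simp
    congr 2
    bicategory

theorem IsLaxBeck.cPb_id_left (hF : F.IsLaxBeck) {P X Y : E} {l : P ⟶ X} {r : P ⟶ Y}
    (sq : IsPullback l (𝟙 P) (𝟙 X) l) (hl : l ≫ 𝟙 X = l) (hr : 𝟙 P ≫ r = r) :
    F.cPb sq hl hr ≫ F.cId X ▷ (F.d l ≫ F.t r) ≫ (λ_ _).hom = 𝟙 _ :=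
  hom₂_ext_of_whiskerLeft fun h => by
    have H := hF.wPb_id_left h sq hl hr
    simp only [comp_whiskerRight] at H
    rw [whiskerLeft_comp, whiskerLeft_comp, whisker_assoc_symm, F.whiskerLeft_cId,
      F.whiskerLeft_cPb]
    simp [reassoc_of% H]

theorem IsLaxBeck.cPb_id_right (hF : F.IsLaxBeck) {P X Y : E} {l : P ⟶ X} {r : P ⟶ Y}
    (sq : IsPullback (𝟙 P) r r (𝟙 Y)) (hl : 𝟙 P ≫ l = l) (hr : r ≫ 𝟙 Y = r) :
    F.cPb sq hl hr ≫ (F.d l ≫ F.t r) ◁ F.cId Y ≫ (ρ_ _).hom = 𝟙 _ :=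
  hom₂_ext_of_whiskerLeft fun h => by
    have H := hF.wPb_id_right h sq hl hr
    rw [whiskerLeft_comp, whiskerLeft_comp, comp_whiskerLeft_symm, F.whiskerLeft_cId,
      F.whiskerLeft_cPb]
    simp only [Category.assoc, Iso.hom_inv_id_assoc]
    rw [reassoc_of% F.wtId_naturality, reassoc_of% F.wdId_naturality, reassoc_of% H]
    simp

end PairOn

end Cells

/-! ### The oplax functor attached to a lax Beck pair -/

section Build

variable {E : Type u} [Category.{v} E] [PullbackChoice E] {C : Type u₂} [Bicategory.{w₂, v₂} C]

open PullbackChoice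

/-- The morphism of apices underlying a 2-cell of `Span_iso(E)`. -/
abbrev SpanIso.apexHom {A B : SpanIso E} {S T : A ⟶ B} (η : S ⟶ T) : S.of.apex ⟶ T.of.apex :=
  η.iso.hom.hom

instance SpanIso.isIso_apexHom {A B : SpanIso E} {S T : A ⟶ B} (η : S ⟶ T) :
    IsIso (SpanIso.apexHom η) :=
  ⟨η.iso.inv.hom, congrArg Span.Hom.hom η.iso.hom_inv_id, congrArg Span.Hom.hom η.iso.inv_hom_id⟩

theorem SpanIso.hom₂_ext {A B : SpanIso E} {S T : A ⟶ B} {η θ : S ⟶ T}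
    (h : SpanIso.apexHom η = SpanIso.apexHom θ) : η = θ :=
  Pith.hom₂_ext _ (Span.hom_ext h)

/-- As 2-cells are invertible, `η` identifies the apex of `R` with the chosen pullback, and pullback
squares are stable under a change of apex. -/
theorem SpanIso.isPullback_of_hom {A B D : SpanIso E} {R : A ⟶ D} {S : A ⟶ B} {T : B ⟶ D}
    (η : R ⟶ S ≫ T) {p : R.of.apex ⟶ S.of.apex} {q : R.of.apex ⟶ T.of.apex}
    (hp : SpanIso.apexHom η ≫ fst S.of.r T.of.l = p)
    (hq : SpanIso.apexHom η ≫ snd S.of.r T.of.l = q) : IsPullback p q S.of.r T.of.l := by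
  refine (isPullback S.of.r T.of.l).of_iso (asIso (SpanIso.apexHom η)).symm (Iso.refl _)
    (Iso.refl _) (Iso.refl _) ?_ ?_ (by simp) (by simp)
  · exact (Category.comp_id _).trans ((Iso.eq_inv_comp _).2 hp)
  · exact (Category.comp_id _).trans ((Iso.eq_inv_comp _).2 hq)

namespace PairOn

variable {ob : E → C} {F : PairOn ob}

/-- The image of an isomorphism onto a composite is absorbed by replacing the chosen pullback with
the induced one. The coherence laws of the functor thus reduce to laws for constraints at arbitrary
pullback squares. -/
theorem IsLaxBeck.cMap_apexHom_cPb (hF : F.IsLaxBeck) {A B D : SpanIso E} {R : A ⟶ D}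
    {S : A ⟶ B} {T : B ⟶ D} (η : R ⟶ S ≫ T) {p : R.of.apex ⟶ S.of.apex}
    {q : R.of.apex ⟶ T.of.apex} (hp : SpanIso.apexHom η ≫ fst S.of.r T.of.l = p)
    (hq : SpanIso.apexHom η ≫ snd S.of.r T.of.l = q)
    (ha : p ≫ S.of.l = R.of.l) (hb : q ≫ T.of.r = R.of.r) :
    F.cMap (e := SpanIso.apexHom η) η.iso.hom.hom_l η.iso.hom.hom_r ≫
      F.cPb (isPullback S.of.r T.of.l) rfl rfl =
        F.cPb (SpanIso.isPullback_of_hom η hp hq) ha hb :=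
  hF.cMap_cPb _ _ _ _ ha hb hp hq _ _

/-- The functor on `Span_iso(E)` attached to a lax Beck pair. -/
noncomputable def IsLaxBeck.toOplaxOn (hF : F.IsLaxBeck) :
    OplaxOn (fun X : SpanIso E => ob X.as.as) where
  map S := F.d S.of.l ≫ F.t S.of.r
  map₂ η := F.cMap (e := SpanIso.apexHom η) η.iso.hom.hom_l η.iso.hom.hom_r
  mapId X := F.cId X.as.as
  mapComp S T := F.cPb (isPullback S.of.r T.of.l) rfl rfl
  map₂_id S := hF.cMap_id rfl _ _
  map₂_comp η θ := (hF.cMap_comp rfl _ _ _ _ _ _).symm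
  mapComp_naturality_left η T :=
    (hF.cMap_apexHom_cPb (η ▷ T) (pbLift_fst _ _ _) (pbLift_snd _ _ _)
      ((Category.assoc _ _ _).trans (congrArg _ η.iso.hom.hom_l)) rfl).trans
      (hF.cPb_cMap_left _ _ _ _ _ rfl _ _).symm
  mapComp_naturality_right S _ _ η :=
    (hF.cMap_apexHom_cPb (S ◁ η) (pbLift_fst _ _ _) (pbLift_snd _ _ _) rfl
      ((Category.assoc _ _ _).trans (congrArg _ η.iso.hom.hom_r))).trans
      (hF.cPb_cMap_right _ _ _ _ _ rfl _ _).symm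
  map₂_associator S T U := by
    have H := hF.cMap_apexHom_cPb (α_ S T U).hom (pbLift_fst _ _ _) (pbLift_snd _ _ _)
      (Category.assoc _ _ _) (pbLift_snd_assoc _ _ _ _)
    refine (Category.assoc _ _ _).symm.trans ((H =≫ _).trans ?_)
    exact hF.cPb_assoc _ _ _ _ _ _ _ _ _ _ _ _ rfl (pbLift_fst _ _ _).symm (pbLift_snd _ _ _)
  map₂_leftUnitor {A B} S := by
    -- `H` factors the constraint at the chosen square into the image of the left unitor and the
    -- constraint at an identity square; `cPb_id_left` cancels the latter against the nullary
    -- constraint.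
    have H := hF.cMap_cPb (e := SpanIso.apexHom (λ_ S).hom) (IsPullback.id_vert S.of.l)
      (Category.comp_id _) (Category.id_comp _) (isPullback (𝟙 A.as.as) S.of.l) rfl rfl
      ((pb_w (𝟙 A.as.as) S.of.l).symm.trans (Category.comp_id _)) (Category.comp_id _)
      (λ_ S).hom.iso.hom.hom_l (λ_ S).hom.iso.hom.hom_r
    refine ((Category.comp_id _).symm.trans ?_).trans
      ((Category.assoc _ _ _).symm.trans (H =≫ (F.cId _ ▷ _ ≫ (λ_ _).hom)))
    rw [hF.cPb_id_left]
  map₂_rightUnitor {A B} S := by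
    have H := hF.cMap_cPb (e := SpanIso.apexHom (ρ_ S).hom) (IsPullback.id_horiz S.of.r)
      (Category.id_comp _) (Category.comp_id _) (isPullback S.of.r (𝟙 B.as.as)) rfl rfl
      (Category.comp_id _) ((pb_w S.of.r (𝟙 B.as.as)).trans (Category.comp_id _))
      (ρ_ S).hom.iso.hom.hom_l (ρ_ S).hom.iso.hom.hom_r
    refine ((Category.comp_id _).symm.trans ?_).trans
      ((Category.assoc _ _ _).symm.trans (H =≫ (_ ◁ F.cId _ ≫ (ρ_ _).hom)))
    rw [hF.cPb_id_right]

end PairOn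
end Build

/-! ### Constraints of functors on spans attached to pullback squares -/

section SpanConstraints

variable {E : Type u} [Category.{v} E] [PullbackChoice E] {C : Type u₂} [Bicategory.{w₂, v₂} C]

open PullbackChoice

/-- An isomorphism of spans, as a 2-cell of `Span_iso(E)`. -/
noncomputable def SpanIso.homMk {P P' X Y : E} (e : P ⟶ P') [IsIso e] {s : P ⟶ X} {t : P ⟶ Y}
    {s' : P' ⟶ X} {t' : P' ⟶ Y} (hs : e ≫ s' = s) (ht : e ≫ t' = t) :
    SpanIso.mk s t ⟶ SpanIso.mk s' t' :=
  (SpanIso.iso (S := SpanIso.mk s t) (T := SpanIso.mk s' t') (asIso e) hs ht).hom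

/-- The isomorphism of spans from `(a, b)` to the composite of `(s, t)` and `(u, v)` induced by a
pullback of `t` and `u`. -/
noncomputable def SpanIso.homPb {P S T X Y Z : E} {p : P ⟶ S} {q : P ⟶ T} {s : S ⟶ X}
    {t : S ⟶ Y} {u : T ⟶ Y} {v : T ⟶ Z} {a : P ⟶ X} {b : P ⟶ Z} (sq : IsPullback p q t u)
    (ha : p ≫ s = a) (hb : q ≫ v = b) :
    SpanIso.mk a b ⟶ SpanIso.mk s t ≫ SpanIso.mk u v :=
  (SpanIso.iso (S := SpanIso.mk a b) (T := SpanIso.mk s t ≫ SpanIso.mk u v)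
    (show P ≅ pt t u from
      { hom := pbLift p q sq.w
        inv := sq.lift (fst t u) (snd t u) (pb_w t u)
        hom_inv_id := sq.hom_ext (by simp) (by simp)
        inv_hom_id := pb_ext (by simp) (by simp) })
    (show pbLift p q sq.w ≫ fst t u ≫ s = a by simp [ha])
    (show pbLift p q sq.w ≫ snd t u ≫ v = b by simp [hb])).hom

/-- The apex equation behind associativity of constraints, tested on the projections to `U`, `V` and
`T`. -/
theorem pbLift_assoc_aux {R S T U V W X₁ X₂ : E} {b₁ : U ⟶ X₁} {a₂ : V ⟶ X₁} {b₂ : V ⟶ X₂}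
    {a₃ : T ⟶ X₂} {t : S ⟶ X₂} {w : W ⟶ X₁} {p : R ⟶ S} {q : R ⟶ T} {p' : S ⟶ U} {q' : S ⟶ V}
    {p'' : R ⟶ U} {q'' : R ⟶ W} {p₃ : W ⟶ V} {q₃ : W ⟶ T} (h₁ h₂ h₃ h₄ h₅ h₆ h₇ h₈)
    (e₁ : p ≫ p' = p'') (e₂ : p ≫ q' = q'' ≫ p₃) (e₃ : q'' ≫ q₃ = q) :
    pbLift (f := t) (g := a₃) p q h₁ ≫
      pbLift (f := snd b₁ a₂ ≫ b₂) (g := a₃) (fst t a₃ ≫ pbLift p' q' h₂) (snd t a₃) h₃ ≫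
      pbLift (f := b₁) (g := fst b₂ a₃ ≫ a₂) (fst (snd b₁ a₂ ≫ b₂) a₃ ≫ fst b₁ a₂)
        (pbLift (fst (snd b₁ a₂ ≫ b₂) a₃ ≫ snd b₁ a₂) (snd (snd b₁ a₂ ≫ b₂) a₃) h₄) h₅ =
    pbLift (f := b₁) (g := w) p'' q'' h₆ ≫ pbLift (f := b₁) (g := fst b₂ a₃ ≫ a₂) (fst b₁ w)
      (snd b₁ w ≫ pbLift p₃ q₃ h₇) h₈ := by
  refine pb_ext ?_ (pb_ext ?_ ?_) <;> simp [e₁, e₂, e₃]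

namespace OplaxOn

variable {ob : SpanIso E → C} (F : OplaxOn ob) {x : C}

/-- The whiskered constraint of `F` attached to a pullback square. -/
noncomputable def pb {P S T X Y Z : E} (h : x ⟶ ob (SpanIso.of X)) {p : P ⟶ S} {q : P ⟶ T}
    {s : S ⟶ X} {t : S ⟶ Y} {u : T ⟶ Y} {v : T ⟶ Z} {a : P ⟶ X} {b : P ⟶ Z}
    (sq : IsPullback p q t u) (ha : p ≫ s = a) (hb : q ≫ v = b) :
    h ≫ F.map (SpanIso.mk a b) ⟶ (h ≫ F.map (SpanIso.mk s t)) ≫ F.map (SpanIso.mk u v) :=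
  F.wComp h (SpanIso.homPb sq ha hb)

/-- Both sides split the span over `R` into those over `U`, `V`, `T`, through an intermediate
composite over `S` or over `W`. The relations between constraints used below that involve no units
arise by making some of the squares degenerate. -/
theorem pb_assoc {R S T U V W X₀ X₁ X₂ X₃ : E} (h : x ⟶ ob (SpanIso.of X₀))
    {a₁ : U ⟶ X₀} {b₁ : U ⟶ X₁} {a₂ : V ⟶ X₁} {b₂ : V ⟶ X₂} {a₃ : T ⟶ X₂} {b₃ : T ⟶ X₃}
    {s : S ⟶ X₀} {t : S ⟶ X₂} {w : W ⟶ X₁} {z : W ⟶ X₃} {r : R ⟶ X₀} {r' : R ⟶ X₃}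
    {p : R ⟶ S} {q : R ⟶ T} {p' : S ⟶ U} {q' : S ⟶ V} {p'' : R ⟶ U} {q'' : R ⟶ W}
    {p₃ : W ⟶ V} {q₃ : W ⟶ T}
    (sqσ : IsPullback p q t a₃) (hr : p ≫ s = r) (hr' : q ≫ b₃ = r')
    (sqτ : IsPullback p' q' b₁ a₂) (hs : p' ≫ a₁ = s) (ht : q' ≫ b₂ = t)
    (sqρ : IsPullback p'' q'' b₁ w) (hr₂ : p'' ≫ a₁ = r) (hr₂' : q'' ≫ z = r')
    (sqω : IsPullback p₃ q₃ b₂ a₃) (hw : p₃ ≫ a₂ = w) (hz : q₃ ≫ b₃ = z)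
    (e₁ : p ≫ p' = p'') (e₂ : p ≫ q' = q'' ≫ p₃) (e₃ : q'' ≫ q₃ = q) :
    F.pb h sqσ hr hr' ≫ F.pb h sqτ hs ht ▷ F.map (SpanIso.mk a₃ b₃) =
      F.pb h sqρ hr₂ hr₂' ≫ F.pb (h ≫ F.map (SpanIso.mk a₁ b₁)) sqω hw hz := by
  refine F.wComp_assoc h _ _ _ _ (SpanIso.hom₂_ext ?_)
  exact pbLift_assoc_aux _ _ _ _ _ _ _ _ e₁ e₂ e₃

/-- The whiskered nullary constraint of `F`. -/
noncomputable def wUnit {X : E} (h : x ⟶ ob (SpanIso.of X)) :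
    h ≫ F.map (SpanIso.mk (𝟙 X) (𝟙 X)) ⟶ h :=
  F.wId h (𝟙 (𝟙 (SpanIso.of X)))

/-- The isomorphism onto the composite, followed by the left unitor of spans, is the projection `q`;
the rest is left unitality of `F`. -/
theorem pb_wUnit_left {P T X Z : E} (h : x ⟶ ob (SpanIso.of X)) {p : P ⟶ X} {q : P ⟶ T} [IsIso q]
    {u : T ⟶ X} {v : T ⟶ Z} {a : P ⟶ X} {b : P ⟶ Z} (sq : IsPullback p q (𝟙 X) u)
    (ha : p ≫ 𝟙 X = a) (hb : q ≫ v = b) (hu : q ≫ u = a) :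
    F.pb h sq ha hb ≫ F.wUnit h ▷ F.map (SpanIso.mk u v) =
      h ◁ F.map₂ (SpanIso.homMk q hu hb) := by
  refine F.wComp_wId_left h _ _ _ (SpanIso.hom₂_ext ?_)
  change pbLift p q _ ≫ pbLift (fst _ _ ≫ 𝟙 _) (snd _ _) _ ≫ snd _ _ = q
  simp

theorem pb_wUnit_right {P S X Y : E} (h : x ⟶ ob (SpanIso.of X)) {p : P ⟶ S} [IsIso p] {q : P ⟶ Y}
    {s : S ⟶ X} {t : S ⟶ Y} {a : P ⟶ X} {b : P ⟶ Y} (sq : IsPullback p q t (𝟙 Y))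
    (ha : p ≫ s = a) (hb : q ≫ 𝟙 Y = b) (ht : p ≫ t = b) :
    F.pb h sq ha hb ≫ F.wUnit (h ≫ F.map (SpanIso.mk s t)) =
      h ◁ F.map₂ (SpanIso.homMk p ha ht) := by
  refine F.wComp_wId_right h _ _ _ (SpanIso.hom₂_ext ?_)
  change pbLift p q _ ≫ pbLift (fst _ _) (snd _ _ ≫ 𝟙 _) _ ≫ fst _ _ = p
  simp

theorem map₂_homMk_id {P X Y : E} {s : P ⟶ X} {t : P ⟶ Y} {e : P ⟶ P} [IsIso e] (he : e = 𝟙 P)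
    (hs : e ≫ s = s) (ht : e ≫ t = t) : F.map₂ (SpanIso.homMk e hs ht) = 𝟙 _ := by
  rw [← F.map₂_id]
  exact congrArg F.map₂ (SpanIso.hom₂_ext he)

/-- The whiskered form of the constraint `F(s, t) ⟶ F(s, 1) ; F(1, t)`. -/
noncomputable def wFactor {T X Y : E} (h : x ⟶ ob (SpanIso.of X)) (s : T ⟶ X) (t : T ⟶ Y) :
    h ≫ F.map (SpanIso.mk s t) ⟶
      (h ≫ F.map (SpanIso.mk s (𝟙 T))) ≫ F.map (SpanIso.mk (𝟙 T) t) :=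
  F.pb h (IsPullback.id_horiz (𝟙 T)) (Category.id_comp s) (Category.id_comp t)

theorem wFactor_eq {T X Y : E} (h : x ⟶ ob (SpanIso.of X)) (s : T ⟶ X) (t : T ⟶ Y) :
    F.wFactor h s t = h ◁ F.factor s t ≫ (α_ _ _ _).inv := by
  have : SpanIso.homPb (IsPullback.id_horiz (𝟙 T)) (Category.id_comp s) (Category.id_comp t) =
    (SpanIso.factor s t).hom := SpanIso.hom₂_ext rfl
  rw [wFactor, pb, wComp, this, factor]

/-- The whiskered composition constraint of the restriction of `F` along `(-)_⊗`. -/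
noncomputable def pbT {X Y Z : E} (h : x ⟶ ob (SpanIso.of X)) {f : X ⟶ Y} {g : Y ⟶ Z} {k : X ⟶ Z}
    (e : f ≫ g = k) : h ≫ F.map (SpanIso.mk (𝟙 X) k) ⟶
      (h ≫ F.map (SpanIso.mk (𝟙 X) f)) ≫ F.map (SpanIso.mk (𝟙 Y) g) :=
  F.pb h (IsPullback.id_horiz f) (Category.id_comp (𝟙 X)) e

/-- The whiskered composition constraint of the restriction of `F` along `(-)_Δ`. -/
noncomputable def pbD {X Y Z : E} (h : x ⟶ ob (SpanIso.of Z)) {f : X ⟶ Y} {g : Y ⟶ Z} {k : X ⟶ Z}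
    (e : f ≫ g = k) : h ≫ F.map (SpanIso.mk k (𝟙 X)) ⟶
      (h ≫ F.map (SpanIso.mk g (𝟙 Y))) ≫ F.map (SpanIso.mk f (𝟙 X)) :=
  F.pb h (IsPullback.id_vert f) e (Category.id_comp (𝟙 X))

end OplaxOn

namespace GregOn

variable {ob : SpanIso E → C} (F : GregOn ob) {x : C}

instance isIso_wFactor {T X Y : E} (h : x ⟶ ob (SpanIso.of X)) (s : T ⟶ X) (t : T ⟶ Y) :
    IsIso (F.obj.wFactor h s t) := by
  have : IsIso (F.obj.factor s t) := F.property.isIso_factor s t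
  rw [OplaxOn.wFactor_eq]
  infer_instance

/-- The whiskered Beck 2-cell. -/
noncomputable def wBeck {P X Y Z : E} (h : x ⟶ ob (SpanIso.of X)) {g' : P ⟶ X} {f' : P ⟶ Y}
    {f : X ⟶ Z} {g : Y ⟶ Z} (sq : IsPullback g' f' f g) :
    (h ≫ F.obj.map (SpanIso.mk g' (𝟙 P))) ≫ F.obj.map (SpanIso.mk (𝟙 P) f') ⟶
      (h ≫ F.obj.map (SpanIso.mk (𝟙 X) f)) ≫ F.obj.map (SpanIso.mk g (𝟙 Y)) :=
  (α_ _ _ _).hom ≫ h ◁ F.beckCell sq ≫ (α_ _ _ _).inv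

/-- The definition of the Beck 2-cell freed of its inverse. As the factorization cell is invertible,
the equation characterizes the whiskered Beck 2-cell. -/
theorem wFactor_wBeck {P X Y Z : E} (h : x ⟶ ob (SpanIso.of X)) {g' : P ⟶ X} {f' : P ⟶ Y}
    {f : X ⟶ Z} {g : Y ⟶ Z} (sq : IsPullback g' f' f g) :
    F.obj.wFactor h g' f' ≫ F.wBeck h sq =
      F.obj.pb h sq (Category.comp_id g') (Category.comp_id f') := by
  have e : SpanIso.homPb sq (Category.comp_id g') (Category.comp_id f') =
    (SpanIso.ofIsPullback sq).hom := SpanIso.hom₂_ext rfl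
  rw [OplaxOn.wFactor_eq, wBeck, Category.assoc, Iso.inv_hom_id_assoc, ← whiskerLeft_comp_assoc,
    GregOn.factor_beckCell, OplaxOn.pb, OplaxOn.wComp, e]

/-- The span isomorphism in the constraint of the restriction is the one induced by the identity
square of `f`. -/
theorem toPair_wt {X Y Z : E} (h : x ⟶ ob (SpanIso.of X)) {f : X ⟶ Y} {g : Y ⟶ Z} {k : X ⟶ Z}
    (e : f ≫ g = k) : F.toPair.wt h e = F.obj.pbT h e := by
  subst e
  have e : SpanIso.homPb (IsPullback.id_horiz f) (Category.id_comp (𝟙 X)) rfl =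
    (SpanIso.tensorComp f g).hom := SpanIso.hom₂_ext rfl
  rw [PairOn.wt_rfl, OplaxOn.pbT, OplaxOn.pb, e]
  rfl

theorem toPair_wd {X Y Z : E} (h : x ⟶ ob (SpanIso.of Z)) {f : X ⟶ Y} {g : Y ⟶ Z} {k : X ⟶ Z}
    (e : f ≫ g = k) : F.toPair.wd h e = F.obj.pbD h e := by
  subst e
  have e : SpanIso.homPb (IsPullback.id_vert f) rfl (Category.id_comp (𝟙 X)) =
    (SpanIso.deltaComp g f).hom := SpanIso.hom₂_ext rfl
  rw [PairOn.wd_rfl, OplaxOn.pbD, OplaxOn.pb, e]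
  rfl

theorem toPair_wtId {X : E} (h : x ⟶ ob (SpanIso.of X)) :
    F.toPair.wtId h rfl = F.obj.wUnit h := by
  rw [PairOn.wtId_rfl]
  rfl

theorem toPair_wdId {X : E} (h : x ⟶ ob (SpanIso.of X)) :
    F.toPair.wdId h rfl = F.obj.wUnit h := by
  rw [PairOn.wdId_rfl]
  rfl

/-- After precomposition with the factorization cell, only constraints of `F` at pullback squares
occur. Both sides then split `(g'', f')` into `(1, f₂)`, `(1, f₁)`, `(g, 1)`, and agree by repeated
associativity. -/
theorem wBeck_horizontal {P₂ P₁ X₂ X₁ Y Z : E} (h : x ⟶ ob (SpanIso.of X₂))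
    {f₂' : P₂ ⟶ P₁} {f₁' : P₁ ⟶ Y} {g'' : P₂ ⟶ X₂} {g' : P₁ ⟶ X₁} {g : Y ⟶ Z} {f₂ : X₂ ⟶ X₁}
    {f₁ : X₁ ⟶ Z} {f' : P₂ ⟶ Y} {f : X₂ ⟶ Z} (sq : IsPullback g'' f' f g)
    (sq₂ : IsPullback g'' f₂' f₂ g') (sq₁ : IsPullback g' f₁' f₁ g) (e : f₂ ≫ f₁ = f)
    (e' : f₂' ≫ f₁' = f') :
    F.wBeck h sq ≫ F.obj.pbT h e ▷ F.obj.map (SpanIso.mk g (𝟙 Y)) =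
      F.obj.pbT (h ≫ F.obj.map (SpanIso.mk g'' (𝟙 P₂))) e' ≫
        F.wBeck h sq₂ ▷ F.obj.map (SpanIso.mk (𝟙 P₁) f₁') ≫
          F.wBeck (h ≫ F.obj.map (SpanIso.mk (𝟙 X₂) f₂)) sq₁ := by
  have hρ : F.obj.wFactor h g'' f' ≫ F.obj.pbT _ e' =
      F.obj.pb h (IsPullback.id_horiz f₂') (Category.id_comp g'') e' ≫
        F.obj.wFactor h g'' f₂' ▷ _ :=
    (F.obj.pb_assoc h _ _ _ _ _ _ _ _ _ _ _ _ (by simp) (by simp) (by simp)).symm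
  rw [← cancel_epi (F.obj.wFactor h g'' f'), reassoc_of% F.wFactor_wBeck, reassoc_of% hρ,
    ← comp_whiskerRight_assoc, F.wFactor_wBeck]
  refine (F.obj.pb_assoc h _ _ _ _ _ _ sq₂ (Category.comp_id g'') e' sq₁ (Category.comp_id g')
    (Category.comp_id f₁') (by simp) sq₂.w e').trans ?_
  rw [← F.wFactor_wBeck]
  refine (Category.assoc _ _ _).symm.trans (Eq.trans ?_ (Category.assoc _ _ _))
  refine congrArg (· ≫ _) ?_
  exact (F.obj.pb_assoc h _ _ _ _ _ _ _ _ _ _ _ _ (by simp) (by simp) (by simp)).symm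

/-- The same argument, for the splitting of `(g', f'')` into `(1, f)`, `(g₁, 1)`, `(g₂, 1)`. -/
theorem wBeck_vertical {P₂ P₁ X Y₂ Y₁ Z : E} (h : x ⟶ ob (SpanIso.of X))
    {f'' : P₂ ⟶ Y₂} {f' : P₁ ⟶ Y₁} {f : X ⟶ Z} {g₂' : P₂ ⟶ P₁} {g₁' : P₁ ⟶ X} {g₂ : Y₂ ⟶ Y₁}
    {g₁ : Y₁ ⟶ Z} {g' : P₂ ⟶ X} {g : Y₂ ⟶ Z} (sq : IsPullback g' f'' f g)
    (sq₂ : IsPullback g₂' f'' f' g₂) (sq₁ : IsPullback g₁' f' f g₁) (e : g₂ ≫ g₁ = g)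
    (e' : g₂' ≫ g₁' = g') :
    F.wBeck h sq ≫ F.obj.pbD (h ≫ F.obj.map (SpanIso.mk (𝟙 X) f)) e =
      F.obj.pbD h e' ▷ F.obj.map (SpanIso.mk (𝟙 P₂) f'') ≫
        F.wBeck (h ≫ F.obj.map (SpanIso.mk g₁' (𝟙 P₁))) sq₂ ≫
          F.wBeck h sq₁ ▷ F.obj.map (SpanIso.mk g₂ (𝟙 Y₂)) := by
  have hρ : F.obj.wFactor h g' f'' ≫ F.obj.pbD h e' ▷ _ =
      F.obj.pb h (IsPullback.id_vert g₂') e' (Category.id_comp f'') ≫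
        F.obj.wFactor _ g₂' f'' :=
    F.obj.pb_assoc h _ _ _ _ _ _ _ _ _ _ _ _ (by simp) (by simp) (by simp)
  have hσ : F.obj.pb h (IsPullback.id_vert g₂') e' (Category.id_comp f'') ≫
      F.obj.pb _ sq₂ (Category.comp_id g₂') (Category.comp_id f'') =
      F.obj.pb h sq₂ e' (Category.comp_id f'') ≫ F.obj.wFactor h g₁' f' ▷ _ :=
    (F.obj.pb_assoc h _ _ _ _ _ _ _ _ _ _ _ _ (by simp) (by simp) (by simp)).symm
  rw [← cancel_epi (F.obj.wFactor h g' f''), reassoc_of% F.wFactor_wBeck, reassoc_of% hρ,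
    reassoc_of% F.wFactor_wBeck, reassoc_of% hσ, ← comp_whiskerRight, F.wFactor_wBeck]
  exact (F.obj.pb_assoc h _ _ _ _ _ _ _ _ _ _ _ _ e' sq₂.w (by simp)).symm

/-- Precomposed with the factorization cell, both sides are the image under `F` of the same identity
isomorphism of spans, by the two unit laws. -/
theorem wBeck_horizontal_id {X Y : E} (h : x ⟶ ob (SpanIso.of X)) (f : X ⟶ Y) :
    F.wBeck h (IsPullback.id_horiz f) ≫ F.obj.wUnit (h ≫ F.obj.map (SpanIso.mk (𝟙 X) f)) =
      F.obj.wUnit h ▷ F.obj.map (SpanIso.mk (𝟙 X) f) := by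
  rw [← cancel_epi (F.obj.wFactor h (𝟙 X) f), reassoc_of% F.wFactor_wBeck]
  refine (F.obj.pb_wUnit_right h _ _ _ (by simp)).trans
    (Eq.trans ?_ (F.obj.pb_wUnit_left h _ _ _ (by simp)).symm)
  rfl

theorem wBeck_vertical_id {X Y : E} (h : x ⟶ ob (SpanIso.of Y)) (g : X ⟶ Y) :
    F.wBeck h (IsPullback.id_vert g) ≫ F.obj.wUnit h ▷
      F.obj.map (SpanIso.mk g (𝟙 X)) =
      F.obj.wUnit (h ≫ F.obj.map (SpanIso.mk g (𝟙 X))) := by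
  rw [← cancel_epi (F.obj.wFactor h g (𝟙 X)), reassoc_of% F.wFactor_wBeck]
  refine (F.obj.pb_wUnit_left h _ _ _ (by simp)).trans
    (Eq.trans ?_ (F.obj.pb_wUnit_right h _ _ _ (by simp)).symm)
  rfl

/-- The pair attached to an object of `Greg_{⊗,Δ}(Span_iso(E), C)` is a lax Beck pair. -/
theorem isLaxBeck_toPair : F.toPair.IsLaxBeck where
  horizontal sq₂ sq₁ := by
    refine (whiskerLeft_iff _ _).1 ((PairOn.wb_horizontal_iff (F := F.toPair) (𝟙 _) sq₂ sq₁).1 ?_)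
    rw [toPair_wt, toPair_wt]
    exact F.wBeck_horizontal _ _ sq₂ sq₁ rfl rfl
  vertical sq₂ sq₁ := by
    refine (whiskerLeft_iff _ _).1 ((PairOn.wb_vertical_iff (F := F.toPair) (𝟙 _) sq₂ sq₁).1 ?_)
    rw [toPair_wd, toPair_wd]
    exact F.wBeck_vertical _ _ sq₂ sq₁ rfl rfl
  horizontal_id f := by
    refine (whiskerLeft_iff _ _).1 ((PairOn.wb_horizontal_id_iff (F := F.toPair) (𝟙 _) f).1 ?_)
    rw [toPair_wdId, toPair_wdId]
    exact F.wBeck_horizontal_id _ f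
  vertical_id g := by
    refine (whiskerLeft_iff _ _).1 ((PairOn.wb_vertical_id_iff (F := F.toPair) (𝟙 _) g).1 ?_)
    rw [toPair_wtId, toPair_wtId]
    exact F.wBeck_vertical_id _ g

end GregOn
end SpanConstraints

/-! ### Morphisms of pairs come from unique icons -/

section Icons

theorem OplaxOn.wComp_icon {B : Type u₁} [Bicategory.{w₁, v₁} B] {C : Type u₂}
    [Bicategory.{w₂, v₂} C] {ob : B → C} {F G : OplaxOn ob} (α : F ⟶ G) {x : C} {a b c : B}
    (h : x ⟶ ob a) {R : a ⟶ c} {S : a ⟶ b} {T : b ⟶ c} (σ : R ⟶ S ≫ T) :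
    F.wComp h σ ≫ (h ◁ α.app S) ▷ F.map T ≫ (h ≫ G.map S) ◁ α.app T =
      h ◁ α.app R ≫ G.wComp h σ := by
  have H := congrArg (h ◁ ·) (α.app_comp S T)
  have H' := congrArg (h ◁ ·) (α.naturality σ)
  simp only [whiskerLeft_comp] at H H'
  simp only [wComp, whiskerLeft_comp, Category.assoc, ← reassoc_of% H', ← reassoc_of% H]
  simp

theorem OplaxOn.wId_icon {B : Type u₁} [Bicategory.{w₁, v₁} B] {C : Type u₂}
    [Bicategory.{w₂, v₂} C] {ob : B → C} {F G : OplaxOn ob} (α : F ⟶ G) {x : C} {a : B}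
    (h : x ⟶ ob a) {R : a ⟶ a} (ι : R ⟶ 𝟙 a) :
    h ◁ α.app R ≫ G.wId h ι = F.wId h ι := by
  simp only [wId, ← whiskerLeft_comp_assoc, ← reassoc_of% α.naturality ι, α.app_id]

variable {E : Type u} [Category.{v} E] [PullbackChoice E] {C : Type u₂} [Bicategory.{w₂, v₂} C]

open PullbackChoice

namespace OplaxOn

variable {ob : SpanIso E → C} (F : OplaxOn ob) {x : C}

theorem wFactor_naturality {T X Y : E} {h h' : x ⟶ ob (SpanIso.of X)} (θ : h ⟶ h') (s : T ⟶ X)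
    (t : T ⟶ Y) : θ ▷ F.map (SpanIso.mk s t) ≫ F.wFactor h' s t =
      F.wFactor h s t ≫ θ ▷ F.map (SpanIso.mk s (𝟙 T)) ▷ F.map (SpanIso.mk (𝟙 T) t) :=
  F.wComp_naturality θ _

theorem wFactor_wUnit_left {T X : E} (h : x ⟶ ob (SpanIso.of T)) (t : T ⟶ X) :
    F.wFactor h (𝟙 T) t ≫ F.wUnit h ▷ F.map (SpanIso.mk (𝟙 T) t) = 𝟙 _ := by
  refine (F.pb_wUnit_left h _ _ _ (Category.id_comp _)).trans ?_
  rw [F.map₂_homMk_id rfl, whiskerLeft_id]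

theorem wFactor_wUnit_right {T X : E} (h : x ⟶ ob (SpanIso.of X)) (s : T ⟶ X) :
    F.wFactor h s (𝟙 T) ≫ F.wUnit (h ≫ F.map (SpanIso.mk s (𝟙 T))) =
      𝟙 _ := by
  refine (F.pb_wUnit_right h _ _ _ (Category.id_comp _)).trans ?_
  rw [F.map₂_homMk_id rfl, whiskerLeft_id]

/-- The isomorphism `e` followed by the splitting of `(s', t')` is the comparison attached to the
square `(e, e, 1, 1)`. The action of `F` on 2-cells thereby becomes a special case of its
constraints. -/
theorem map₂_homMk_wFactor {P P' X Y : E} (h : x ⟶ ob (SpanIso.of X)) {e : P ⟶ P'} [IsIso e]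
    {s : P ⟶ X} {t : P ⟶ Y} {s' : P' ⟶ X} {t' : P' ⟶ Y} (hs : e ≫ s' = s) (ht : e ≫ t' = t) :
    h ◁ F.map₂ (SpanIso.homMk e hs ht) ≫ F.wFactor h s' t' =
      F.pb h (isPullback_iso_iso e) hs ht := by
  refine (F.map₂_wComp h _ _).trans (congrArg (F.wComp h) (SpanIso.hom₂_ext ?_))
  change e ≫ pbLift (f := 𝟙 P') (g := 𝟙 P') (𝟙 P') (𝟙 P') _ = pbLift e e _
  exact pb_ext (by simp) (by simp)

end OplaxOn

namespace GregOn

variable {ob : SpanIso E → C} (F : GregOn ob) {x : C}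

/-- The constraints of `F` in terms of those of its restrictions and the Beck 2-cells. -/
theorem pb_wFactor_wFactor {P S T X Y Z : E} (h : x ⟶ ob (SpanIso.of X)) {p : P ⟶ S} {q : P ⟶ T}
    {s : S ⟶ X} {t : S ⟶ Y} {u : T ⟶ Y} {v : T ⟶ Z} {a : P ⟶ X} {b : P ⟶ Z}
    (sq : IsPullback p q t u) (ha : p ≫ s = a) (hb : q ≫ v = b) :
    F.obj.pb h sq ha hb ≫ F.obj.wFactor h s t ▷ F.obj.map (SpanIso.mk u v) ≫
        F.obj.wFactor _ u v =
      F.obj.wFactor h a b ≫ F.obj.pbD h ha ▷ F.obj.map (SpanIso.mk (𝟙 P) b) ≫ F.obj.pbT _ hb ≫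
        F.wBeck _ sq ▷ F.obj.map (SpanIso.mk (𝟙 T) v) := by
  -- Four instances of associativity: splitting off `(s, 1)` on the left (`h₁`, `h₄`) and `(1, v)`
  -- on the right (`h₂`, `h₃`) leaves the span `(p, q)`, on which the Beck 2-cell acts.
  have h₁ : F.obj.wFactor h a b ≫ F.obj.pbD h ha ▷ F.obj.map (SpanIso.mk (𝟙 P) b) =
      F.obj.pb h (IsPullback.id_vert p) ha (Category.id_comp b) ≫ F.obj.wFactor _ p b :=
    F.obj.pb_assoc h _ _ _ _ _ _ _ _ _ _ _ _ (by simp) (by simp) (by simp)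
  have h₂ : F.obj.wFactor (h ≫ F.obj.map (SpanIso.mk s (𝟙 S))) p b ≫ F.obj.pbT _ hb =
      F.obj.pb _ (IsPullback.id_horiz q) (Category.id_comp p) hb ≫ F.obj.wFactor _ p q ▷ _ :=
    (F.obj.pb_assoc _ _ _ _ _ _ _ _ _ _ _ _ _ (by simp) (by simp) (by simp)).symm
  have h₃ : F.obj.pb (h ≫ F.obj.map (SpanIso.mk s (𝟙 S))) (IsPullback.id_horiz q)
      (Category.id_comp p) hb ≫ F.obj.pb _ sq (Category.comp_id p) (Category.comp_id q) ▷ _ =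
      F.obj.pb _ sq (Category.comp_id p) hb ≫ F.obj.wFactor _ u v :=
    F.obj.pb_assoc _ _ _ _ _ _ _ _ _ _ _ _ _ (by simp) (by simp) (by simp)
  have h₄ : F.obj.pb h sq ha hb ≫ F.obj.wFactor h s t ▷ F.obj.map (SpanIso.mk u v) =
      F.obj.pb h (IsPullback.id_vert p) ha (Category.id_comp b) ≫
        F.obj.pb _ sq (Category.comp_id p) hb :=
    F.obj.pb_assoc h _ _ _ _ _ _ _ _ _ _ _ _ (by simp) (by simp) (by simp)
  rw [reassoc_of% h₁, reassoc_of% h₂, ← comp_whiskerRight, F.wFactor_wBeck, h₃, reassoc_of% h₄]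

/-- The 2-cell `h ; F(e, 1) ; F(1, e) ⟶ h` attached to an isomorphism `e`. -/
noncomputable def wCancel {P X : E} (h : x ⟶ ob (SpanIso.of X)) (e : P ⟶ X) [IsIso e] :
    (h ≫ F.obj.map (SpanIso.mk e (𝟙 P))) ≫ F.obj.map (SpanIso.mk (𝟙 P) e) ⟶ h :=
  F.wBeck h (isPullback_iso_iso e) ≫ F.obj.wUnit h ▷ _ ≫
    F.obj.wUnit h

/-- The action of `F` on 2-cells in terms of its restrictions and the Beck 2-cells. -/
theorem map₂_wFactor {P P' X Y : E} (h : x ⟶ ob (SpanIso.of X)) {e : P ⟶ P'} [IsIso e]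
    {s : P ⟶ X} {t : P ⟶ Y} {s' : P' ⟶ X} {t' : P' ⟶ Y} (hs : e ≫ s' = s) (ht : e ≫ t' = t) :
    h ◁ F.obj.map₂ (SpanIso.homMk e hs ht) ≫ F.obj.wFactor h s' t' =
      F.obj.wFactor h s t ≫ F.obj.pbD h hs ▷ F.obj.map (SpanIso.mk (𝟙 P) t) ≫ F.obj.pbT _ ht ≫
        F.wCancel _ e ▷ F.obj.map (SpanIso.mk (𝟙 P') t') := by
  -- For the square `(e, e, 1, 1)` the two middle spans of the fourfold splitting are identities;
  -- the nullary constraint discards them.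
  have H := F.pb_wFactor_wFactor h (isPullback_iso_iso e) hs ht =≫
    ((F.obj.wUnit _ ▷ _ ≫ F.obj.wUnit _) ▷
      F.obj.map (SpanIso.mk (𝟙 P') t'))
  rw [F.obj.map₂_homMk_wFactor]
  simp only [Category.assoc, ← comp_whiskerRight] at H
  refine Eq.trans ?_ H
  rw [comp_whiskerRight]
  have h₁ := F.obj.wFactor_naturality
    (F.obj.wUnit (h ≫ F.obj.map (SpanIso.mk s' (𝟙 P')))) (𝟙 P') t'
  rw [← reassoc_of% h₁, F.obj.wFactor_wUnit_left]
  erw [Category.comp_id]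
  rw [← comp_whiskerRight, F.obj.wFactor_wUnit_right, id_whiskerRight, Category.comp_id]

end GregOn
end Icons

/-! ### Extending morphisms of pairs to icons -/

section HComp

variable {C : Type u₂} [Bicategory.{w₂, v₂} C]

/-- Horizontal composition of 2-cells. -/
def hComp {a b c : C} {h h' : a ⟶ b} {f f' : b ⟶ c} (φ : h ⟶ h') (α : f ⟶ f') :
    h ≫ f ⟶ h' ≫ f' :=
  φ ▷ f ≫ h' ◁ α

theorem id_hComp {a b c : C} (h : a ⟶ b) {f f' : b ⟶ c} (α : f ⟶ f') :
    hComp (𝟙 h) α = h ◁ α := by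
  simp [hComp]

theorem whiskerRight_hComp {a b c : C} {h h' h'' : a ⟶ b} {f f' : b ⟶ c} (ξ : h ⟶ h')
    (φ : h' ⟶ h'') (α : f ⟶ f') : ξ ▷ f ≫ hComp φ α = hComp (ξ ≫ φ) α := by
  simp [hComp]

theorem hComp_whiskerRight {a b c : C} {h h' h'' : a ⟶ b} {f f' : b ⟶ c} (φ : h ⟶ h')
    (α : f ⟶ f') (ξ : h' ⟶ h'') : hComp φ α ≫ ξ ▷ f' = hComp (φ ≫ ξ) α := by
  simp [hComp, whisker_exchange]

theorem hComp_comp_hComp {a b c : C} {h h' h'' : a ⟶ b} {f f' f'' : b ⟶ c} (φ : h ⟶ h')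
    (α : f ⟶ f') (φ' : h' ⟶ h'') (α' : f' ⟶ f'') :
    hComp φ α ≫ hComp φ' α' = hComp (φ ≫ φ') (α ≫ α') := by
  simp only [hComp, comp_whiskerRight, whiskerLeft_comp, Category.assoc]
  rw [whisker_exchange_assoc]

theorem id_hComp_id {a b c : C} (h : a ⟶ b) (f : b ⟶ c) : hComp (𝟙 h) (𝟙 f) = 𝟙 _ := by
  simp [hComp]

theorem whiskerLeft_hComp {a b c d : C} (k : a ⟶ b) {h h' : b ⟶ c} {f f' : c ⟶ d} (φ : h ⟶ h')
    (α : f ⟶ f') :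
    k ◁ hComp φ α ≫ (α_ k h' f').inv = (α_ k h f).inv ≫ hComp (k ◁ φ) α := by
  simp [hComp]

end HComp

/-! ### Compatibility of morphisms of pairs with the whiskered structure -/

section PairHom

variable {E : Type u} [Category.{v} E] {C : Type u₂} [Bicategory.{w₂, v₂} C]

namespace PairOn

variable {ob : E → C} {F G : PairOn ob} (m : F ⟶ G) {x : C}

/-- The icon law for horizontal composites built from the left; in this form the components of `m`
can be pushed through long whiskered composites. -/
theorem hComp_wt {X Y Z : E} {h h' : x ⟶ ob X} (φ : h ⟶ h') {f : X ⟶ Y} {g : Y ⟶ Z}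
    {k : X ⟶ Z} (e : f ≫ g = k) :
    hComp φ (CovOn.app m.tensor k) ≫ G.wt h' e =
      F.wt h e ≫ hComp (hComp φ (CovOn.app m.tensor f)) (CovOn.app m.tensor g) := by
  have := OplaxOn.wComp_icon m.tensor.hom (a := ⟨X⟩) h' (locComp e)
  refine (Category.assoc _ _ _).trans ((congrArg (φ ▷ F.t k ≫ ·) this.symm).trans ?_)
  refine ((reassoc_of% (F.wt_naturality φ e)) _).trans ?_
  simp only [hComp, comp_whiskerRight, Category.assoc]

theorem hComp_wd {X Y Z : E} {h h' : x ⟶ ob Z} (φ : h ⟶ h') {f : X ⟶ Y} {g : Y ⟶ Z}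
    {k : X ⟶ Z} (e : f ≫ g = k) :
    hComp φ (ContraOn.app m.delta k) ≫ G.wd h' e =
      F.wd h e ≫ hComp (hComp φ (ContraOn.app m.delta g)) (ContraOn.app m.delta f) := by
  have := OplaxOn.wComp_icon m.delta.hom (a := ⟨op Z⟩) h'
    (locComp (f := g.op) (g := f.op) (congrArg Quiver.Hom.op e))
  refine (Category.assoc _ _ _).trans ((congrArg (φ ▷ F.d k ≫ ·) this.symm).trans ?_)
  refine ((reassoc_of% (F.wd_naturality φ e)) _).trans ?_
  simp only [hComp, comp_whiskerRight, Category.assoc]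

theorem hComp_wtId {X : E} {h h' : x ⟶ ob X} (φ : h ⟶ h') {f : X ⟶ X} (e : f = 𝟙 X) :
    hComp φ (CovOn.app m.tensor f) ≫ G.wtId h' e = F.wtId h e ≫ φ := by
  have := OplaxOn.wId_icon m.tensor.hom (a := ⟨X⟩) h' (locId e)
  refine (Category.assoc _ _ _).trans ((congrArg (φ ▷ F.t f ≫ ·) this).trans ?_)
  exact F.wtId_naturality φ e

theorem hComp_wdId {X : E} {h h' : x ⟶ ob X} (φ : h ⟶ h') {f : X ⟶ X} (e : f = 𝟙 X) :
    hComp φ (ContraOn.app m.delta f) ≫ G.wdId h' e = F.wdId h e ≫ φ := by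
  have := OplaxOn.wId_icon m.delta.hom (a := ⟨op X⟩) h'
    (locId (f := f.op) (congrArg Quiver.Hom.op e))
  refine (Category.assoc _ _ _).trans ((congrArg (φ ▷ F.d f ≫ ·) this).trans ?_)
  exact F.wdId_naturality φ e

theorem hComp_wb {P X Y Z : E} {h h' : x ⟶ ob X} (φ : h ⟶ h') {g' : P ⟶ X} {f' : P ⟶ Y}
    {f : X ⟶ Z} {g : Y ⟶ Z} (sq : IsPullback g' f' f g) :
    hComp (hComp φ (ContraOn.app m.delta g')) (CovOn.app m.tensor f') ≫ G.wb h' sq =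
      F.wb h sq ≫ hComp (hComp φ (CovOn.app m.tensor f)) (ContraOn.app m.delta g) := by
  have H := congrArg (h' ◁ ·) (m.comm sq)
  have H' := F.wb_naturality φ sq
  simp only [whiskerLeft_comp, Category.assoc] at H
  simp only [hComp, comp_whiskerRight, Category.assoc]
  rw [← reassoc_of% H']
  congr 1
  simp only [wb, Category.assoc, whisker_assoc, comp_whiskerLeft, Iso.inv_hom_id_assoc]
  rw [reassoc_of% H]

end PairOn

end PairHom

theorem OplaxOn.wComp_id {B : Type u₁} [Bicategory.{w₁, v₁} B] {C : Type u₂}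
    [Bicategory.{w₂, v₂} C] {ob : B → C} (F : OplaxOn ob) {x : C} {a b c : B} (h : x ⟶ ob a)
    (S : a ⟶ b) (T : b ⟶ c) :
    F.wComp h (𝟙 (S ≫ T)) = h ◁ F.mapComp S T ≫ (α_ _ _ _).inv := by
  rw [wComp, F.map₂_id, Category.id_comp]

theorem OplaxOn.wId_id {B : Type u₁} [Bicategory.{w₁, v₁} B] {C : Type u₂}
    [Bicategory.{w₂, v₂} C] {ob : B → C} (F : OplaxOn ob) {x : C} {a : B} (h : x ⟶ ob a) :
    F.wId h (𝟙 (𝟙 a)) = h ◁ F.mapId a ≫ (ρ_ h).hom := by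
  rw [wId, F.map₂_id, Category.id_comp]

/-! ### Extension of morphisms of pairs to icons, and full faithfulness -/

section Extension

variable {E : Type u} [Category.{v} E] [PullbackChoice E] {C : Type u₂} [Bicategory.{w₂, v₂} C]

open PullbackChoice

theorem OplaxOn.wUnit_eq {ob : SpanIso E → C} (F : OplaxOn ob) {x : C} {X : E}
    (h : x ⟶ ob (SpanIso.of X)) :
    F.wUnit h = h ◁ F.mapId (SpanIso.of X) ≫ (ρ_ h).hom :=
  F.wId_id h

/-- The isomorphism of spans induced by the chosen square itself is an identity. -/
theorem OplaxOn.pb_isPullback {ob : SpanIso E → C} (F : OplaxOn ob) {x : C} {A B D : SpanIso E}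
    (h : x ⟶ ob A) (S : A ⟶ B) (T : B ⟶ D) :
    F.pb h (isPullback S.of.r T.of.l) (s := S.of.l) (v := T.of.r) rfl rfl =
      h ◁ F.mapComp S T ≫ (α_ h (F.map S) (F.map T)).inv := by
  refine Eq.trans (congrArg (F.wComp h) (SpanIso.hom₂_ext ?_)) (F.wComp_id h S T)
  change pbLift _ _ _ = 𝟙 _
  exact pb_ext (by simp) (by simp)

namespace GregOn

variable {ob : SpanIso E → C} {F G : GregOn ob} (m : F.toPair ⟶ G.toPair) {x : C}

/-- The components at the spans `(1, f)` of a morphism of pairs. -/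
noncomputable abbrev tensorApp {X Y : E} (f : X ⟶ Y) :
    F.obj.map (SpanIso.mk (𝟙 X) f) ⟶ G.obj.map (SpanIso.mk (𝟙 X) f) :=
  CovOn.app m.tensor f

/-- The components at the spans `(g, 1)` of a morphism of pairs. -/
noncomputable abbrev deltaApp {X Y : E} (g : X ⟶ Y) :
    F.obj.map (SpanIso.mk g (𝟙 X)) ⟶ G.obj.map (SpanIso.mk g (𝟙 X)) :=
  ContraOn.app m.delta g

theorem hComp_pbT {X Y Z : E} {h h' : x ⟶ ob (SpanIso.of X)} (φ : h ⟶ h') {f : X ⟶ Y} {g : Y ⟶ Z}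
    {k : X ⟶ Z} (e : f ≫ g = k) :
    hComp φ (tensorApp m k) ≫ G.obj.pbT h' e =
      F.obj.pbT h e ≫ hComp (hComp φ (tensorApp m f)) (tensorApp m g) := by
  rw [← toPair_wt, ← toPair_wt]
  exact PairOn.hComp_wt m φ e

theorem hComp_pbD {X Y Z : E} {h h' : x ⟶ ob (SpanIso.of Z)} (φ : h ⟶ h') {f : X ⟶ Y} {g : Y ⟶ Z}
    {k : X ⟶ Z} (e : f ≫ g = k) :
    hComp φ (deltaApp m k) ≫ G.obj.pbD h' e =
      F.obj.pbD h e ≫ hComp (hComp φ (deltaApp m g)) (deltaApp m f) := by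
  rw [← toPair_wd, ← toPair_wd]
  exact PairOn.hComp_wd m φ e

theorem hComp_tensorApp_wUnit {X : E} {h h' : x ⟶ ob (SpanIso.of X)} (φ : h ⟶ h') :
    hComp φ (tensorApp m (𝟙 X)) ≫ G.obj.wUnit h' = F.obj.wUnit h ≫ φ := by
  rw [← toPair_wtId, ← toPair_wtId]
  exact PairOn.hComp_wtId m φ rfl

theorem hComp_deltaApp_wUnit {X : E} {h h' : x ⟶ ob (SpanIso.of X)} (φ : h ⟶ h') :
    hComp φ (deltaApp m (𝟙 X)) ≫ G.obj.wUnit h' = F.obj.wUnit h ≫ φ := by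
  rw [← toPair_wdId, ← toPair_wdId]
  exact PairOn.hComp_wdId m φ rfl

theorem hComp_wBeck {P X Y Z : E} {h h' : x ⟶ ob (SpanIso.of X)} (φ : h ⟶ h') {g' : P ⟶ X}
    {f' : P ⟶ Y} {f : X ⟶ Z} {g : Y ⟶ Z} (sq : IsPullback g' f' f g) :
    hComp (hComp φ (deltaApp m g')) (tensorApp m f') ≫ G.wBeck h' sq =
      F.wBeck h sq ≫ hComp (hComp φ (tensorApp m f)) (deltaApp m g) :=
  PairOn.hComp_wb m φ sq

theorem hComp_wCancel {P X : E} {h h' : x ⟶ ob (SpanIso.of X)} (φ : h ⟶ h') (e : P ⟶ X) [IsIso e] :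
    hComp (hComp φ (deltaApp m e)) (tensorApp m e) ≫ G.wCancel h' e = F.wCancel h e ≫ φ := by
  rw [wCancel, reassoc_of% hComp_wBeck, reassoc_of% hComp_whiskerRight, hComp_tensorApp_wUnit,
    ← reassoc_of% whiskerRight_hComp, hComp_deltaApp_wUnit, wCancel, Category.assoc, Category.assoc]

/-- The component at the span `(s, t)` of the icon which extends a morphism of pairs. -/
noncomputable def extendApp {T X Y : E} (s : T ⟶ X) (t : T ⟶ Y) :
    F.obj.map (SpanIso.mk s t) ⟶ G.obj.map (SpanIso.mk s t) :=
  haveI : IsIso (G.obj.factor s t) := G.property.isIso_factor s t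
  F.obj.factor s t ≫ hComp (deltaApp m s) (tensorApp m t) ≫ inv (G.obj.factor s t)

theorem extendApp_factor {T X Y : E} (s : T ⟶ X) (t : T ⟶ Y) :
    extendApp m s t ≫ G.obj.factor s t =
      F.obj.factor s t ≫ hComp (deltaApp m s) (tensorApp m t) := by
  have : IsIso (G.obj.factor s t) := G.property.isIso_factor s t
  simp [extendApp]

theorem hComp_wFactor {T X Y : E} {h h' : x ⟶ ob (SpanIso.of X)} (φ : h ⟶ h') (s : T ⟶ X)
    (t : T ⟶ Y) :
    hComp φ (extendApp m s t) ≫ G.obj.wFactor h' s t =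
      F.obj.wFactor h s t ≫ hComp (hComp φ (deltaApp m s)) (tensorApp m t) := by
  have H := congrArg (h' ◁ ·) (extendApp_factor m s t)
  simp only [whiskerLeft_comp, hComp] at H
  simp only [hComp, Category.assoc, comp_whiskerRight]
  rw [← reassoc_of% F.obj.wFactor_naturality φ s t, OplaxOn.wFactor_eq, OplaxOn.wFactor_eq,
    reassoc_of% H]
  simp

theorem hComp_pbD_pbT {P S T X Y : E} {h h' : x ⟶ ob (SpanIso.of X)} (φ : h ⟶ h') {p : P ⟶ S}
    {q : P ⟶ T} {s : S ⟶ X} {v : T ⟶ Y} {a : P ⟶ X} {b : P ⟶ Y} (ha : p ≫ s = a)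
    (hb : q ≫ v = b) :
    hComp (hComp φ (deltaApp m a)) (tensorApp m b) ≫
        G.obj.pbD h' ha ▷ G.obj.map (SpanIso.mk (𝟙 P) b) ≫ G.obj.pbT _ hb =
      F.obj.pbD h ha ▷ F.obj.map (SpanIso.mk (𝟙 P) b) ≫ F.obj.pbT _ hb ≫
        hComp (hComp (hComp (hComp φ (deltaApp m s)) (deltaApp m p)) (tensorApp m q))
          (tensorApp m v) := by
  rw [reassoc_of% hComp_whiskerRight, hComp_pbD, ← reassoc_of% whiskerRight_hComp, hComp_pbT]

/-- The factorization cells of `G` are invertible, so both target spans may be split. By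
`pb_wFactor_wFactor` the constraints are then made of those of the restrictions and a Beck 2-cell,
with all of which `m` is compatible. -/
theorem hComp_pb {P S T X Y Z : E} {h h' : x ⟶ ob (SpanIso.of X)} (φ : h ⟶ h') {p : P ⟶ S}
    {q : P ⟶ T} {s : S ⟶ X} {t : S ⟶ Y} {u : T ⟶ Y} {v : T ⟶ Z} {a : P ⟶ X} {b : P ⟶ Z}
    (sq : IsPullback p q t u) (ha : p ≫ s = a) (hb : q ≫ v = b) :
    hComp φ (extendApp m a b) ≫ G.obj.pb h' sq ha hb =
      F.obj.pb h sq ha hb ≫ hComp (hComp φ (extendApp m s t)) (extendApp m u v) := by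
  rw [← cancel_mono (G.obj.wFactor h' s t ▷ G.obj.map (SpanIso.mk u v)),
    ← cancel_mono (G.obj.wFactor _ u v)]
  simp only [Category.assoc]
  rw [G.pb_wFactor_wFactor, reassoc_of% hComp_wFactor, reassoc_of% hComp_pbD_pbT,
    hComp_whiskerRight, hComp_wBeck, ← whiskerRight_hComp, reassoc_of% hComp_whiskerRight,
    hComp_wFactor, hComp_wFactor, ← whiskerRight_hComp, ← whiskerRight_hComp,
    ← reassoc_of% F.obj.wFactor_naturality, reassoc_of% F.pb_wFactor_wFactor]

/-- The same principle applied to `map₂_wFactor`: composition constraints and the cell cancelling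
`e` commute with `m`. -/
theorem map₂_extendApp {P P' X Y : E} {e : P ⟶ P'} [IsIso e]
    {s : P ⟶ X} {t : P ⟶ Y} {s' : P' ⟶ X} {t' : P' ⟶ Y} (hs : e ≫ s' = s) (ht : e ≫ t' = t) :
    F.obj.map₂ (SpanIso.homMk e hs ht) ≫ extendApp m s' t' =
      extendApp m s t ≫ G.obj.map₂ (SpanIso.homMk e hs ht) := by
  refine (whiskerLeft_iff _ _).1 ?_
  rw [whiskerLeft_comp, whiskerLeft_comp, ← cancel_mono (G.obj.wFactor _ s' t'), Category.assoc,
    Category.assoc, G.map₂_wFactor, ← id_hComp, ← id_hComp, ← id_hComp, hComp_wFactor,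
    reassoc_of% hComp_wFactor, reassoc_of% hComp_pbD_pbT, hComp_whiskerRight, hComp_wCancel,
    ← whiskerRight_hComp, id_hComp _ (F.obj.map₂ _), reassoc_of% F.map₂_wFactor]

instance isIso_wUnit (F : GregOn ob) {X : E} (h : x ⟶ ob (SpanIso.of X)) :
    IsIso (F.obj.wUnit h) := by
  have : IsIso (F.obj.mapId (SpanIso.of X)) := F.property.isGregarious.isIso_mapId _
  rw [OplaxOn.wUnit_eq]
  infer_instance

/-- The nullary constraint of `G`, invertible by normality, undoes the factorization of `(1, f)`,
and `m` respects nullary constraints. -/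
theorem extendApp_tensor {X Y : E} (f : X ⟶ Y) : extendApp m (𝟙 X) f = tensorApp m f := by
  refine (whiskerLeft_iff _ _).1 ?_
  rw [← cancel_mono (G.obj.wFactor _ (𝟙 X) f), ← id_hComp, hComp_wFactor,
    ← cancel_mono (G.obj.wUnit _ ▷ G.obj.map (SpanIso.mk (𝟙 X) f)), Category.assoc,
    Category.assoc, G.obj.wFactor_wUnit_left, hComp_whiskerRight, hComp_deltaApp_wUnit,
    ← whiskerRight_hComp, reassoc_of% F.obj.wFactor_wUnit_left, Category.comp_id, id_hComp]

theorem extendApp_delta {X Y : E} (g : X ⟶ Y) : extendApp m g (𝟙 X) = deltaApp m g := by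
  refine (whiskerLeft_iff _ _).1 ?_
  rw [← cancel_mono (G.obj.wFactor _ g (𝟙 X)), ← id_hComp, hComp_wFactor,
    ← cancel_mono (G.obj.wUnit _), Category.assoc, Category.assoc,
    G.obj.wFactor_wUnit_right, hComp_tensorApp_wUnit, reassoc_of% F.obj.wFactor_wUnit_right,
    Category.comp_id, id_hComp]

/-- The icon which extends a morphism of pairs. -/
noncomputable def extend : F ⟶ G :=
  ObjectProperty.homMk
    { app := fun S => extendApp m S.of.l S.of.r
      naturality := fun {A B S S'} η => by
        have e : η = SpanIso.homMk (s := S.of.l) (t := S.of.r) (s' := S'.of.l) (t' := S'.of.r)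
          (SpanIso.apexHom η) η.iso.hom.hom_l η.iso.hom.hom_r := SpanIso.hom₂_ext rfl
        rw [e]
        exact map₂_extendApp m _ _
      app_comp := fun {A B D} S T => by
        refine (whiskerLeft_iff _ _).1 ?_
        have H := hComp_pb m (𝟙 (𝟙 (ob A))) (isPullback S.of.r T.of.l) (s := S.of.l) (v := T.of.r)
          rfl rfl
        rw [id_hComp, id_hComp, OplaxOn.pb_isPullback, OplaxOn.pb_isPullback] at H
        rw [whiskerLeft_comp _ (F.obj.mapComp S T),
          whiskerLeft_comp _ (extendApp m (S ≫ T).of.l (S ≫ T).of.r)]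
        refine (cancel_mono (α_ _ _ _).inv).1 (Eq.trans ?_ (H.symm.trans
          (Category.assoc _ _ _).symm))
        refine (Category.assoc _ _ _).trans (Eq.trans ?_ (Category.assoc _ _ _).symm)
        exact congrArg (_ ◁ F.obj.mapComp S T ≫ ·) (whiskerLeft_hComp _ _ _)
      app_id := fun A => by
        refine (whiskerLeft_iff _ _).1 ?_
        have H := hComp_tensorApp_wUnit m (𝟙 (𝟙 (ob A)))
        rw [id_hComp, Category.comp_id, ← extendApp_tensor] at H
        rw [OplaxOn.wUnit_eq, OplaxOn.wUnit_eq, ← Category.assoc, cancel_mono] at H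
        rw [whiskerLeft_comp]
        exact H }

theorem map_extend : (toPairFunctor ob).map (extend m) = m := by
  refine PairOn.hom_ext (ObjectProperty.hom_ext _ (OplaxOn.hom_ext ?_))
    (ObjectProperty.hom_ext _ (OplaxOn.hom_ext ?_))
  · exact fun f => extendApp_tensor m f.as
  · exact fun g => extendApp_delta m g.as.unop

instance : (toPairFunctor (E := E) ob).Full where
  map_surjective m := ⟨extend m, map_extend m⟩

/-- The component of an icon at `(s, t)` is determined by those at `(s, 1)` and `(1, t)`, because
the factorization cell of the target can be cancelled. -/
instance : (toPairFunctor (E := E) ob).Faithful where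
  map_injective {F G α β} H := by
    refine ObjectProperty.hom_ext _ (OplaxOn.hom_ext fun {A B} S => ?_)
    have : IsIso (G.obj.factor S.of.l S.of.r) := G.property.isIso_factor _ _
    have h₁ : α.hom.app (SpanIso.mk S.of.l (𝟙 _)) = β.hom.app (SpanIso.mk S.of.l (𝟙 _)) :=
      congrArg (fun m : F.toPair ⟶ G.toPair => deltaApp m S.of.l) H
    have h₂ : α.hom.app (SpanIso.mk (𝟙 _) S.of.r) = β.hom.app (SpanIso.mk (𝟙 _) S.of.r) :=
      congrArg (fun m : F.toPair ⟶ G.toPair => tensorApp m S.of.r) H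
    have hα := OplaxOn.factor_naturality α.hom S.of.l S.of.r
    rw [h₁, h₂, OplaxOn.factor_naturality β.hom S.of.l S.of.r, cancel_mono] at hα
    exact hα.symm

end GregOn
end Extension

/-! ### Invertibility of constraints -/

section Invertible

variable {E : Type u} [Category.{v} E] {C : Type u₂} [Bicategory.{w₂, v₂} C]

namespace PairOn

variable {ob : E → C} {F : PairOn ob}

instance isIso_cId (X : E) : IsIso (F.cId X) := by
  unfold cId
  infer_instance

/-- Apart from the Beck 2-cell, the constraint is made of invertible constraints of $F_\otimes$ and
$F_\Delta$. -/
theorem isIso_cPb {P S T X Y Z : E} {p : P ⟶ S} {q : P ⟶ T} {s : S ⟶ X} {t : S ⟶ Y}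
    {u : T ⟶ Y} {v : T ⟶ Z} {a : P ⟶ X} {b : P ⟶ Z} (sq : IsPullback p q t u)
    (ha : p ≫ s = a) (hb : q ≫ v = b) [IsIso (F.beck sq)] : IsIso (F.cPb sq ha hb) := by
  unfold cPb wPb wb
  infer_instance

namespace IsLaxBeck

theorem isIso_cMap (hF : F.IsLaxBeck) {P P' X Y : E} {e : P ⟶ P'} [IsIso e] {s : P ⟶ X} {t : P ⟶ Y}
    {s' : P' ⟶ X} {t' : P' ⟶ Y} (hs : e ≫ s' = s) (ht : e ≫ t' = t) : IsIso (F.cMap hs ht) := by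
  have hs' : inv e ≫ s = s' := by simp [← hs]
  have ht' : inv e ≫ t = t' := by simp [← ht]
  refine ⟨F.cMap hs' ht', ?_, ?_⟩
  · rw [hF.cMap_comp (IsIso.hom_inv_id e) hs ht hs' ht' (Category.id_comp s) (Category.id_comp t),
      hF.cMap_id rfl]
  · rw [hF.cMap_comp (IsIso.inv_hom_id e) hs' ht' hs ht (Category.id_comp s') (Category.id_comp t'),
      hF.cMap_id rfl]

/-- The nullary condition expresses this Beck 2-cell by unit constraints and unitors, even when the
other Beck 2-cells are not invertible. -/
theorem isIso_beck_id_horiz (hF : F.IsLaxBeck) {X Y : E} (f : X ⟶ Y) :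
    IsIso (F.beck (IsPullback.id_horiz f)) := by
  have : IsIso (F.dId X) := F.delta.property.isIso_mapId _
  have : IsIso (F.dId Y) := F.delta.property.isIso_mapId _
  have : IsIso (F.beck (IsPullback.id_horiz f) ≫ F.t f ◁ F.dId Y) := by
    rw [hF.horizontal_id]
    infer_instance
  exact IsIso.of_isIso_comp_right _ (F.t f ◁ F.dId Y)

theorem isIso_beck_id_vert (hF : F.IsLaxBeck) {X Y : E} (g : X ⟶ Y) :
    IsIso (F.beck (IsPullback.id_vert g)) := by
  have : IsIso (F.tId X) := F.tensor.property.isIso_mapId _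
  have : IsIso (F.tId Y) := F.tensor.property.isIso_mapId _
  have : IsIso (F.beck (IsPullback.id_vert g) ≫ F.tId Y ▷ F.d g) := by
    rw [hF.vertical_id]
    infer_instance
  exact IsIso.of_isIso_comp_right _ (F.tId Y ▷ F.d g)

/-- The projection `q` is a pullback of an identity, hence invertible, and identifies the square
with the vertical identity square of `u`. -/
theorem isIso_cPb_of_left_eq_id (hF : F.IsLaxBeck) {P T X Y Z : E} {p : P ⟶ Y} {q : P ⟶ T}
    {s : Y ⟶ X} {u : T ⟶ Y} {v : T ⟶ Z} {a : P ⟶ X} {b : P ⟶ Z} (sq : IsPullback p q (𝟙 Y) u)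
    (ha : p ≫ s = a) (hb : q ≫ v = b) : IsIso (F.cPb sq ha hb) := by
  have : IsIso q := sq.isIso_snd_of_isIso
  have := hF.isIso_beck_id_vert u
  have hp : q ≫ u = p := by rw [← sq.w, Category.comp_id]
  have ha' : q ≫ u ≫ s = a := by rw [← ha, ← hp, Category.assoc]
  rw [← hF.cMap_cPb (e := q) (IsPullback.id_vert u) rfl (Category.id_comp v) sq ha hb hp
    (Category.comp_id q) ha' hb]
  have := hF.isIso_cMap (e := q) (s' := u ≫ s) ha' hb
  have := F.isIso_cPb (IsPullback.id_vert u) (s := s) rfl (Category.id_comp v)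
  infer_instance

/-- The span `(u, v)` is isomorphic to `(1, inv u ≫ v)`. After this replacement, `p` identifies the
square with the horizontal identity square of `t`. -/
theorem isIso_cPb_of_isIso_right (hF : F.IsLaxBeck) {P S T X Y Z : E} {p : P ⟶ S} {q : P ⟶ T}
    {s : S ⟶ X} {t : S ⟶ Y} {u : T ⟶ Y} [IsIso u] {v : T ⟶ Z} {a : P ⟶ X} {b : P ⟶ Z}
    (sq : IsPullback p q t u) (ha : p ≫ s = a) (hb : q ≫ v = b) : IsIso (F.cPb sq ha hb) := by
  have : IsIso p := sq.isIso_fst_of_isIso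
  have := hF.isIso_beck_id_horiz t
  have hv : u ≫ inv u ≫ v = v := by simp
  have sq' : IsPullback p (q ≫ u) t (𝟙 Y) := IsPullback.of_horiz_isIso ⟨by simp [sq.w]⟩
  have hb' : (q ≫ u) ≫ inv u ≫ v = b := by simp [hb]
  have hb'' : p ≫ t ≫ inv u ≫ v = b := by rw [← hb', sq.w_assoc, Category.assoc]
  have := hF.isIso_cMap (e := u) (Category.comp_id u) hv
  have := hF.isIso_cMap (e := p) ha hb''
  have := F.isIso_cPb (IsPullback.id_horiz t) (s := s) (v := inv u ≫ v) (Category.id_comp s) rfl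
  have : IsIso (F.cPb sq' ha hb') := by
    rw [← hF.cMap_cPb (e := p) (IsPullback.id_horiz t) (Category.id_comp s) rfl sq' ha hb'
      (Category.comp_id p) sq.w ha hb'']
    infer_instance
  have H := hF.cPb_cMap_right sq ha hb (Category.comp_id u) hv rfl sq' hb'
  have : IsIso (F.cPb sq ha hb ≫ (F.d s ≫ F.t t) ◁ F.cMap (Category.comp_id u) hv) := by
    rw [H]
    infer_instance
  exact IsIso.of_isIso_comp_right _ ((F.d s ≫ F.t t) ◁ F.cMap (Category.comp_id u) hv)

end IsLaxBeck
end PairOn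
end Invertible

/-! ### Left adjoints in the bicategory of spans and isomorphisms -/

section LeftAdjoint

variable {E : Type u} [Category.{v} E]

/-- Being a pullback of `f`, the map `q` is a split epimorphism; it is mono because `q ≫ k` is. So
`q` is invertible, and then `k` is. -/
theorem isIso_of_isPullback_of_isSplitEpi {P X Y Z W : E} {p : P ⟶ X} {q : P ⟶ Y} {f : X ⟶ Z}
    {g : Y ⟶ Z} (sq : IsPullback p q f g) [IsSplitEpi f] (k : Y ⟶ W) [IsIso (q ≫ k)] :
    IsIso k := by
  have : IsSplitEpi q := ⟨⟨⟨sq.lift (g ≫ section_ f) (𝟙 Y) (by simp), sq.lift_snd _ _ _⟩⟩⟩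
  have : Mono q := mono_of_mono q k
  have : IsIso q := isIso_of_mono_of_isSplitEpi q
  exact IsIso.of_isIso_comp_left q k

variable [PullbackChoice E]

open PullbackChoice

/-- The left leg of a span which has a right adjoint in `Span_iso(E)` is invertible. -/
theorem SpanIso.isIso_left_of_isLeftAdjoint {A B : SpanIso E} (T : A ⟶ B)
    (hT : Bicategory.IsLeftAdjoint T) : IsIso T.of.l := by
  let R := Bicategory.rightAdjoint T
  have adj := Bicategory.Adjunction.ofIsLeftAdjoint T
  -- Unit and counit are isomorphisms of spans with identity spans, so the left legs of `T ≫ R` and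
  -- of `R ≫ T` are invertible.
  have h₁ : IsIso (fst T.of.r R.of.l ≫ T.of.l) := by
    have : SpanIso.apexHom adj.unit ≫ fst T.of.r R.of.l ≫ T.of.l = 𝟙 _ := adj.unit.iso.hom.hom_l
    have : IsIso (SpanIso.apexHom adj.unit ≫ fst T.of.r R.of.l ≫ T.of.l) := by
      rw [this]; infer_instance
    exact IsIso.of_isIso_comp_left (SpanIso.apexHom adj.unit) _
  have h₂ : IsIso (fst R.of.r T.of.l ≫ R.of.l) := by
    have : SpanIso.apexHom adj.counit ≫ 𝟙 _ = fst R.of.r T.of.l ≫ R.of.l :=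
      adj.counit.iso.hom.hom_l
    rw [← this]
    infer_instance
  -- The section comes from `h₁`. With `h₂` it makes the left leg of `R` invertible, hence also its
  -- pullback, the projection appearing in `h₁`; cancelling that projection leaves the left leg of
  -- `T`.
  have : IsSplitEpi T.of.l := ⟨⟨⟨inv (fst T.of.r R.of.l ≫ T.of.l) ≫ fst T.of.r R.of.l, by simp⟩⟩⟩
  have := isIso_of_isPullback_of_isSplitEpi (isPullback R.of.r T.of.l).flip R.of.l
  have : IsIso (fst T.of.r R.of.l) := (isPullback T.of.r R.of.l).isIso_fst_of_isIso
  exact IsIso.of_isIso_comp_left (fst T.of.r R.of.l) _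

end LeftAdjoint

/-! ### Invertible constraints of the functor attached to a pair -/

section Greg

variable {E : Type u} [Category.{v} E] [PullbackChoice E] {C : Type u₂} [Bicategory.{w₂, v₂} C]

open PullbackChoice

namespace PairOn

variable {ob : E → C} {F : PairOn ob}

theorem IsLaxBeck.isIso_toOplaxOn_map₂ (hF : F.IsLaxBeck) {A B : SpanIso E} {S T : A ⟶ B}
    (η : S ⟶ T) : IsIso (hF.toOplaxOn.map₂ η) :=
  hF.isIso_cMap _ _

/-- For left adjoints and for $F_\otimes$ the second span has an invertible left leg; for $F_\Delta$
and the factorizations the first span has an identity as right leg. Both kinds of constraint are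
invertible. -/
theorem IsLaxBeck.isGregTensorDelta_toOplaxOn (hF : F.IsLaxBeck) :
    IsGregTensorDelta hF.toOplaxOn := by
  refine ⟨⟨fun X => F.isIso_cId _, fun S T hT => ?_⟩, ⟨fun X => ?_, fun f g => ?_⟩,
    ⟨fun X => ?_, fun f g => ?_⟩, fun s t => ?_⟩
  · have := SpanIso.isIso_left_of_isLeftAdjoint T hT
    exact hF.isIso_cPb_of_isIso_right _ _ _
  · have : IsIso (hF.toOplaxOn.mapId ((tensorEmb E).obj X)) := F.isIso_cId _
    exact IsIso.comp_isIso' (hF.isIso_toOplaxOn_map₂ _) this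
  · have : IsIso (hF.toOplaxOn.mapComp ((tensorEmb E).map f) ((tensorEmb E).map g)) :=
      hF.isIso_cPb_of_isIso_right (u := 𝟙 _) _ _ _
    exact IsIso.comp_isIso' (hF.isIso_toOplaxOn_map₂ _) this
  · have : IsIso (hF.toOplaxOn.mapId ((deltaEmb E).obj X)) := F.isIso_cId _
    exact IsIso.comp_isIso' (hF.isIso_toOplaxOn_map₂ _) this
  · have : IsIso (hF.toOplaxOn.mapComp ((deltaEmb E).map f) ((deltaEmb E).map g)) :=
      hF.isIso_cPb_of_left_eq_id _ _ _
    exact IsIso.comp_isIso' (hF.isIso_toOplaxOn_map₂ _) this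
  · have : IsIso (hF.toOplaxOn.mapComp (SpanIso.mk s (𝟙 _)) (SpanIso.mk (𝟙 _) t)) :=
      hF.isIso_cPb_of_left_eq_id _ _ _
    exact IsIso.comp_isIso' (hF.isIso_toOplaxOn_map₂ _) this

theorem IsLaxBeck.isPseudo_toOplaxOn (hF : F.IsLaxBeck) (hF' : F.IsInvertible) :
    IsPseudo (hF.toOplaxOn).toOplax :=
  ⟨fun _ => F.isIso_cId _, fun S T =>
    have := hF' (isPullback S.of.r T.of.l)
    F.isIso_cPb (isPullback S.of.r T.of.l) rfl rfl⟩

end PairOn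

theorem GregOn.isInvertible_toPair_of_isPseudo {ob : SpanIso E → C} (F : GregOn ob)
    (hF : IsPseudo F.obj.toOplax) : F.toPair.IsInvertible := by
  intro P X Y Z g' f' f g h
  have h₁ : IsIso (F.obj.mapComp (SpanIso.mk (𝟙 X) f) (SpanIso.mk g (𝟙 Y))) :=
    hF.isIso_mapComp _ _
  have h₂ : IsIso (F.obj.map₂ (SpanIso.ofIsPullback h).hom) :=
    (F.obj.toOplax.map₂Iso (SpanIso.ofIsPullback h)).isIso_hom
  have h₂ : IsIso (F.obj.factor g' f') := F.property.isIso_factor g' f'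
  change IsIso (F.beckCell h)
  unfold GregOn.beckCell
  infer_instance

end Greg

/-! ### Every lax Beck pair comes from a functor on spans -/

section Isos

/-- Inverses taken componentwise form an icon: each law follows by cancelling components of `α`. -/
theorem OplaxOn.isIso_of_isIso_app {B : Type u₁} [Bicategory.{w₁, v₁} B] {C : Type u₂}
    [Bicategory.{w₂, v₂} C] {ob : B → C} {F G : OplaxOn ob} (α : F ⟶ G)
    (hα : ∀ {a b : B} (f : a ⟶ b), IsIso (α.app f)) : IsIso α := by
  let β : G ⟶ F :=
    { app := fun f => inv (α.app f)
      naturality := fun {a b f g} η => by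
        rw [← cancel_epi (α.app f), ← reassoc_of% α.naturality]
        simp
      app_comp := fun f g => by
        rw [← cancel_epi (α.app (f ≫ g)), IsIso.hom_inv_id_assoc, ← reassoc_of% α.app_comp,
          whisker_exchange_assoc]
        simp
      app_id := fun a => by rw [IsIso.inv_comp_eq, α.app_id] }
  exact ⟨β, OplaxOn.hom_ext fun _ => IsIso.hom_inv_id _,
    OplaxOn.hom_ext fun _ => IsIso.inv_hom_id _⟩

variable {E : Type u} [Category.{v} E] {C : Type u₂} [Bicategory.{w₂, v₂} C]

namespace PairOn

variable {ob : E → C} {F G : PairOn ob}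

theorem isIso_of_isIso_app (m : F ⟶ G)
    (hα : ∀ {X Y : E} (f : X ⟶ Y), IsIso (CovOn.app m.tensor f))
    (hβ : ∀ {X Y : E} (f : X ⟶ Y), IsIso (ContraOn.app m.delta f)) : IsIso m := by
  have h₁ : IsIso m.tensor.hom := OplaxOn.isIso_of_isIso_app _ fun f => hα f.as
  have h₂ : IsIso m.delta.hom := OplaxOn.isIso_of_isIso_app _ fun f => hβ f.as.unop
  let α : G.tensor ⟶ F.tensor := ObjectProperty.homMk (inv m.tensor.hom)
  let β : G.delta ⟶ F.delta := ObjectProperty.homMk (inv m.delta.hom)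
  have e₁ : m.tensor ≫ α = 𝟙 _ := ObjectProperty.hom_ext _ (IsIso.hom_inv_id m.tensor.hom)
  have e₂ : α ≫ m.tensor = 𝟙 _ := ObjectProperty.hom_ext _ (IsIso.inv_hom_id m.tensor.hom)
  have e₃ : m.delta ≫ β = 𝟙 _ := ObjectProperty.hom_ext _ (IsIso.hom_inv_id m.delta.hom)
  have e₄ : β ≫ m.delta = 𝟙 _ := ObjectProperty.hom_ext _ (IsIso.inv_hom_id m.delta.hom)
  have a₁ : ∀ {X Y : E} (f : X ⟶ Y), CovOn.app m.tensor f ≫ CovOn.app α f = 𝟙 _ := fun f =>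
    congrArg (fun φ : F.tensor ⟶ F.tensor => CovOn.app φ f) e₁
  have a₂ : ∀ {X Y : E} (f : X ⟶ Y), CovOn.app α f ≫ CovOn.app m.tensor f = 𝟙 _ := fun f =>
    congrArg (fun φ : G.tensor ⟶ G.tensor => CovOn.app φ f) e₂
  have a₃ : ∀ {X Y : E} (f : X ⟶ Y), ContraOn.app m.delta f ≫ ContraOn.app β f = 𝟙 _ := fun f =>
    congrArg (fun φ : F.delta ⟶ F.delta => ContraOn.app φ f) e₃
  have a₄ : ∀ {X Y : E} (f : X ⟶ Y), ContraOn.app β f ≫ ContraOn.app m.delta f = 𝟙 _ := fun f =>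
    congrArg (fun φ : G.delta ⟶ G.delta => ContraOn.app φ f) e₄
  refine ⟨⟨α, β, fun {P X Y Z g' f' f g} sq => ?_⟩, PairOn.hom_ext e₁ e₃, PairOn.hom_ext e₂ e₄⟩
  have H := m.comm sq
  change hComp (ContraOn.app β g') (CovOn.app α f') ≫ F.beck sq =
    G.beck sq ≫ hComp (CovOn.app α f) (ContraOn.app β g)
  change hComp (ContraOn.app m.delta g') (CovOn.app m.tensor f') ≫ G.beck sq =
    F.beck sq ≫ hComp (CovOn.app m.tensor f) (ContraOn.app m.delta g) at H
  calc
    _ = hComp (ContraOn.app β g') (CovOn.app α f') ≫ F.beck sq ≫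
        hComp (CovOn.app m.tensor f) (ContraOn.app m.delta g) ≫
          hComp (CovOn.app α f) (ContraOn.app β g) := by
      rw [hComp_comp_hComp, a₁, a₃, id_hComp_id, Category.comp_id]
    _ = _ := by
      rw [← reassoc_of% H, reassoc_of% hComp_comp_hComp, a₂, a₄, id_hComp_id, Category.id_comp]

end PairOn

end Isos

/-! ### Unit cells comparing a pair with the restrictions of its functor -/

section Comparison

variable {E : Type u} [Category.{v} E] {C : Type u₂} [Bicategory.{w₂, v₂} C]

namespace PairOn

variable {ob : E → C} (F : PairOn ob) {x : C}

/-- The 2-cell `F_Δ 1 ; F_⊗ f ⟶ F_⊗ f`. -/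
def tApp {X Y : E} (f : X ⟶ Y) : F.d (𝟙 X) ≫ F.t f ⟶ F.t f :=
  F.dId X ▷ F.t f ≫ (λ_ _).hom

/-- The 2-cell `F_Δ g ; F_⊗ 1 ⟶ F_Δ g`. -/
def dApp {X Y : E} (g : X ⟶ Y) : F.d g ≫ F.t (𝟙 X) ⟶ F.d g :=
  F.d g ◁ F.tId X ≫ (ρ_ _).hom

instance {X Y : E} (f : X ⟶ Y) : IsIso (F.tApp f) := by
  have : IsIso (F.dId X) := F.delta.property.isIso_mapId _
  unfold tApp
  infer_instance

instance {X Y : E} (g : X ⟶ Y) : IsIso (F.dApp g) := by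
  have : IsIso (F.tId X) := F.tensor.property.isIso_mapId _
  unfold dApp
  infer_instance

theorem whiskerLeft_tApp {X Y : E} (h : x ⟶ ob X) (f : X ⟶ Y) :
    h ◁ F.tApp f = (α_ _ _ _).inv ≫ F.wdId h rfl ▷ F.t f := by
  simp [tApp, wdId_rfl]

theorem whiskerLeft_dApp {X Y : E} (h : x ⟶ ob Y) (g : X ⟶ Y) :
    h ◁ F.dApp g = (α_ _ _ _).inv ≫ F.wtId (h ≫ F.d g) rfl := by
  simp [dApp, wtId_rfl]

theorem whiskerLeft_tComp {X Y Z : E} (h : x ⟶ ob X) (f : X ⟶ Y) (g : Y ⟶ Z) :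
    h ◁ F.tComp f g = F.wt h rfl ≫ (α_ _ _ _).hom := by
  simp [wt_rfl]

theorem whiskerLeft_dComp {X Y Z : E} (h : x ⟶ ob Z) (f : X ⟶ Y) (g : Y ⟶ Z) :
    h ◁ F.dComp f g = F.wd h rfl ≫ (α_ _ _ _).hom := by
  simp [wd_rfl]

/-- The two units may be removed in either order, by interchange; this order gives the nullary law
of the covariant comparison icon, the other that of the contravariant one. -/
theorem cId_eq_tApp (X : E) : F.cId X = F.tApp (𝟙 X) ≫ F.tId X := by
  have H := F.wtId_naturality (F.wdId (𝟙 (ob X)) rfl) rfl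
  refine (whiskerLeft_iff _ _).1 ?_
  rw [whiskerLeft_comp, F.whiskerLeft_cId, F.whiskerLeft_tApp, ← reassoc_of% H]
  simp [wtId_rfl]

theorem cId_eq_dApp (X : E) : F.cId X = F.dApp (𝟙 X) ≫ F.dId X := by
  refine (whiskerLeft_iff _ _).1 ?_
  rw [whiskerLeft_comp, F.whiskerLeft_cId, F.whiskerLeft_dApp]
  simp [wdId_rfl]

variable {F}

namespace IsLaxBeck

/-- The binary law of the covariant comparison icon. The constraint contains the Beck 2-cell of the
identity square of `f`, which the horizontal nullary condition turns into unit constraints. -/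
theorem cPb_tApp (hF : F.IsLaxBeck) {X Y Z : E} (f : X ⟶ Y) (g : Y ⟶ Z) :
    F.cPb (IsPullback.id_horiz f) (Category.id_comp (𝟙 X)) rfl ≫
        F.tApp f ▷ (F.d (𝟙 Y) ≫ F.t g) ≫ F.t f ◁ F.tApp g =
      F.tApp (f ≫ g) ≫ F.tComp f g := by
  refine hom₂_ext_of_whiskerLeft fun h => ?_
  have H : F.wPb h (IsPullback.id_horiz f) (Category.id_comp (𝟙 X)) (rfl : f ≫ g = f ≫ g) ≫
      F.wdId h rfl ▷ F.t f ▷ F.d (𝟙 Y) ▷ F.t g ≫ F.wdId (h ≫ F.t f) rfl ▷ F.t g =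
        F.wdId h rfl ▷ F.t (f ≫ g) ≫ F.wt h rfl := by
    simp only [wPb, Category.assoc, ← comp_whiskerRight]
    rw [← reassoc_of% F.wb_naturality, hF.wb_horizontal_id, comp_whiskerRight,
      ← reassoc_of% F.wt_naturality, ← F.wt_naturality, ← comp_whiskerRight_assoc,
      F.wd_wdId_left, id_whiskerRight, Category.id_comp]
  rw [whiskerLeft_comp, whiskerLeft_comp, whiskerLeft_comp, F.whiskerLeft_cPb, whisker_assoc_symm,
    comp_whiskerLeft_symm, F.whiskerLeft_tApp, F.whiskerLeft_tApp, F.whiskerLeft_tApp,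
    F.whiskerLeft_tComp]
  simp only [Category.assoc, ← reassoc_of% H]
  simp

theorem cPb_dApp (hF : F.IsLaxBeck) {X Y Z : E} (f : Y ⟶ X) (g : Z ⟶ Y) :
    F.cPb (IsPullback.id_vert g) rfl (Category.id_comp (𝟙 Z)) ≫
        F.dApp f ▷ (F.d g ≫ F.t (𝟙 Z)) ≫ F.d f ◁ F.dApp g =
      F.dApp (g ≫ f) ≫ F.dComp g f := by
  refine hom₂_ext_of_whiskerLeft fun h => ?_
  have H : F.wPb h (IsPullback.id_vert g) (rfl : g ≫ f = g ≫ f) (Category.id_comp (𝟙 Z)) ≫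
      F.wtId (h ≫ F.d f) rfl ▷ F.d g ▷ F.t (𝟙 Z) ≫ F.wtId ((h ≫ F.d f) ≫ F.d g) rfl =
        F.wtId (h ≫ F.d (g ≫ f)) rfl ≫ F.wd h rfl := by
    simp only [wPb, Category.assoc]
    rw [← comp_whiskerRight_assoc, hF.wb_vertical_id _ _ rfl rfl, ← F.wtId_naturality,
      reassoc_of% F.wt_wtId_left]
  rw [whiskerLeft_comp, whiskerLeft_comp, whiskerLeft_comp, F.whiskerLeft_cPb, whisker_assoc_symm,
    comp_whiskerLeft_symm, F.whiskerLeft_dApp, F.whiskerLeft_dApp, F.whiskerLeft_dApp,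
    F.whiskerLeft_dComp]
  simp only [Category.assoc, ← reassoc_of% H]
  simp

/-- Splitting off identities and removing them has no effect (`H`), and the constraint at `(1, f)`,
`(g, 1)` is the given Beck 2-cell up to units (`H'`). Hence the comparison respects Beck 2-cells. -/
theorem cPb_hComp_beck (hF : F.IsLaxBeck) {P X Y Z : E} {g' : P ⟶ X} {f' : P ⟶ Y} {f : X ⟶ Z}
    {g : Y ⟶ Z} (sq : IsPullback g' f' f g) :
    F.cPb (IsPullback.id_horiz (𝟙 P)) (Category.id_comp g') (Category.id_comp f') ≫
        (F.dApp g' ▷ (F.d (𝟙 P) ≫ F.t f') ≫ F.d g' ◁ F.tApp f') ≫ F.beck sq =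
      F.cPb sq (Category.comp_id g') (Category.comp_id f') ≫
        F.tApp f ▷ (F.d g ≫ F.t (𝟙 Y)) ≫ F.t f ◁ F.dApp g := by
  refine hom₂_ext_of_whiskerLeft fun h => ?_
  have H : F.wPb h (IsPullback.id_horiz (𝟙 P)) (Category.id_comp g') (Category.id_comp f') ≫
      F.wtId (h ≫ F.d g') rfl ▷ F.d (𝟙 P) ▷ F.t f' ≫ F.wdId (h ≫ F.d g') rfl ▷ F.t f' = 𝟙 _ := by
    simp only [wPb, Category.assoc]
    rw [← comp_whiskerRight_assoc, hF.wb_vertical_id _ _ rfl rfl, reassoc_of% F.wt_wtId_left,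
      ← comp_whiskerRight, F.wd_wdId_right, id_whiskerRight]
  have H' : F.wPb h sq (Category.comp_id g') (Category.comp_id f') ≫
      F.wdId h rfl ▷ F.t f ▷ F.d g ▷ F.t (𝟙 Y) ≫ F.wtId ((h ≫ F.t f) ≫ F.d g) rfl =
        F.wb h sq := by
    simp only [wPb, Category.assoc]
    rw [← comp_whiskerRight_assoc, ← F.wb_naturality, comp_whiskerRight_assoc, F.wtId_naturality,
      ← reassoc_of% F.wt_naturality, reassoc_of% F.wt_wtId_right, ← comp_whiskerRight_assoc,
      F.wd_wdId_left, id_whiskerRight, Category.id_comp]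
  have hb : h ◁ F.beck sq = (α_ _ _ _).inv ≫ F.wb h sq ≫ (α_ _ _ _).hom := by simp [wb]
  simp only [whiskerLeft_comp]
  rw [F.whiskerLeft_cPb, F.whiskerLeft_cPb, whisker_assoc_symm, whisker_assoc_symm,
    comp_whiskerLeft_symm, comp_whiskerLeft_symm, F.whiskerLeft_dApp, F.whiskerLeft_dApp,
    F.whiskerLeft_tApp, F.whiskerLeft_tApp, hb, ← H']
  simp only [Category.assoc]
  simp [reassoc_of% H]

end IsLaxBeck
end PairOn
end Comparison

/-! ### Essential surjectivity -/

section EssSurj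

variable {E : Type u} [Category.{v} E] [PullbackChoice E] {C : Type u₂} [Bicategory.{w₂, v₂} C]

open PullbackChoice

namespace PairOn.IsLaxBeck

variable {ob : E → C} {F : PairOn ob} (hF : F.IsLaxBeck)

/-- The object of `Greg_{⊗,Δ}(Span_iso(E), C)` attached to a lax Beck pair. -/
noncomputable def toGreg : GregOn (fun X : SpanIso E => ob X.as.as) :=
  ⟨hF.toOplaxOn, hF.isGregTensorDelta_toOplaxOn⟩

/-- The pair attached to the functor on spans attached to a lax Beck pair. -/
noncomputable abbrev toGregPair : PairOn ob := hF.toGreg.toPair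

theorem map₂_id_mapId (X : E) :
    hF.toOplaxOn.map₂ (𝟙 (𝟙 (SpanIso.of X))) ≫ hF.toOplaxOn.mapId (SpanIso.of X) = F.cId X := by
  rw [hF.toOplaxOn.map₂_id, Category.id_comp]
  rfl

/-- The canonical isomorphism of spans replaces the chosen pullback square by the identity square of
`f`. -/
theorem map₂_tensorComp_mapComp {X Y Z : E} (f : X ⟶ Y) (g : Y ⟶ Z) :
    hF.toOplaxOn.map₂ (SpanIso.tensorComp f g).hom ≫
        hF.toOplaxOn.mapComp (SpanIso.mk (𝟙 X) f) (SpanIso.mk (𝟙 Y) g) =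
      F.cPb (IsPullback.id_horiz f) (Category.id_comp (𝟙 X)) rfl :=
  hF.cMap_apexHom_cPb (SpanIso.tensorComp f g).hom (pbLift_fst _ _ _) (pbLift_snd _ _ _)
    (Category.id_comp _) rfl

theorem map₂_deltaComp_mapComp {X Y Z : E} (f : Y ⟶ X) (g : Z ⟶ Y) :
    hF.toOplaxOn.map₂ (SpanIso.deltaComp f g).hom ≫
        hF.toOplaxOn.mapComp (SpanIso.mk f (𝟙 Y)) (SpanIso.mk g (𝟙 Z)) =
      F.cPb (IsPullback.id_vert g) rfl (Category.id_comp (𝟙 Z)) :=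
  hF.cMap_apexHom_cPb (SpanIso.deltaComp f g).hom (pbLift_fst _ _ _) (pbLift_snd _ _ _)
    rfl (Category.id_comp _)

theorem toOplaxOn_factor {T X Y : E} (s : T ⟶ X) (t : T ⟶ Y) :
    hF.toOplaxOn.factor s t =
      F.cPb (IsPullback.id_horiz (𝟙 T)) (Category.id_comp s) (Category.id_comp t) :=
  hF.cMap_apexHom_cPb (SpanIso.factor s t).hom (pbLift_fst _ _ _) (pbLift_snd _ _ _)
    (Category.id_comp _) (Category.id_comp _)

theorem map₂_ofIsPullback_mapComp {P X Y Z : E} {g' : P ⟶ X} {f' : P ⟶ Y} {f : X ⟶ Z} {g : Y ⟶ Z}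
    (sq : IsPullback g' f' f g) :
    hF.toOplaxOn.map₂ (SpanIso.ofIsPullback sq).hom ≫
        hF.toOplaxOn.mapComp (SpanIso.mk (𝟙 X) f) (SpanIso.mk g (𝟙 Y)) =
      F.cPb sq (Category.comp_id g') (Category.comp_id f') :=
  hF.cMap_apexHom_cPb (SpanIso.ofIsPullback sq).hom (pbLift_fst _ _ _) (pbLift_snd _ _ _)
    (Category.comp_id _) (Category.comp_id _)

/-- The comparison icon between the covariant parts. -/
noncomputable def comparisonTensor : hF.toGregPair.tensor ⟶ F.tensor :=
  ObjectProperty.homMk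
    { app := fun f => F.tApp f.as
      naturality := fun η => by
        obtain rfl := obj_ext_of_isDiscrete η
        rw [OplaxOn.map₂_loc_self, OplaxOn.map₂_loc_self]
        exact (Category.id_comp _).trans (Category.comp_id _).symm
      app_comp := fun f g => (hF.map₂_tensorComp_mapComp f.as g.as =≫ _).trans
        (hF.cPb_tApp f.as g.as)
      app_id := fun X => (F.cId_eq_tApp X.as).symm.trans (hF.map₂_id_mapId X.as).symm }

/-- The comparison icon between the contravariant parts. -/
noncomputable def comparisonDelta : hF.toGregPair.delta ⟶ F.delta :=
  ObjectProperty.homMk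
    { app := fun g => F.dApp g.as.unop
      naturality := fun η => by
        obtain rfl := obj_ext_of_isDiscrete η
        rw [OplaxOn.map₂_loc_self, OplaxOn.map₂_loc_self]
        exact (Category.id_comp _).trans (Category.comp_id _).symm
      app_comp := fun f g => (hF.map₂_deltaComp_mapComp f.as.unop g.as.unop =≫ _).trans
        (hF.cPb_dApp f.as.unop g.as.unop)
      app_id := fun X => (F.cId_eq_dApp X.as.unop).symm.trans
        (hF.map₂_id_mapId X.as.unop).symm }

/-- A lax Beck pair is isomorphic to the pair attached to its functor on spans. -/
noncomputable def comparison : hF.toGregPair ⟶ F where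
  tensor := hF.comparisonTensor
  delta := hF.comparisonDelta
  comm {P X Y Z g' f' f g} sq := by
    have : IsIso (hF.toOplaxOn.factor g' f') := hF.toGreg.property.isIso_factor g' f'
    -- The Beck 2-cell of the reconstructed functor begins with the inverse of this factorization
    -- cell.
    refine (cancel_epi (hF.toOplaxOn.factor g' f')).1 ?_
    refine Eq.trans ?_ ((hF.toGreg.factor_beckCell sq =≫ _).symm.trans (Category.assoc _ _ _))
    refine Eq.trans ?_ ((hF.map₂_ofIsPullback_mapComp sq).symm =≫ _)
    rw [toOplaxOn_factor]
    exact hF.cPb_hComp_beck sq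

instance : IsIso hF.comparison :=
  isIso_of_isIso_app _ (fun f => inferInstanceAs (IsIso (F.tApp f)))
    (fun g => inferInstanceAs (IsIso (F.dApp g)))

end PairOn.IsLaxBeck

/-! ### The equivalences -/

theorem sigma_fst_eq_of_hom {I : Type*} {D : I → Type*} [∀ i, Category (D i)] {X Y : Σ i, D i}
    (f : X ⟶ Y) : X.1 = Y.1 := by
  obtain ⟨f⟩ := f
  rfl

instance : (tensorDelta E C).Faithful where
  map_injective {F G α β} h := by
    obtain ⟨α⟩ := α
    obtain ⟨β⟩ := β
    refine congrArg _ ((GregOn.toPairFunctor _).map_injective ((Sigma.incl _).map_injective h))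

instance : (tensorDelta E C).Full where
  map_surjective {F G} m := by
    obtain ⟨ob, F⟩ := F
    obtain ⟨ob', G⟩ := G
    -- A morphism in a disjoint union stays in one summand; the actions on objects then agree on
    -- `E`, hence on `Span_iso(E)`, which has the same objects.
    have e : ob = ob' := funext fun X => congrFun (sigma_fst_eq_of_hom m) X.as.as
    subst e
    obtain ⟨m', rfl⟩ := (Sigma.incl _).map_surjective m
    obtain ⟨α, rfl⟩ := (GregOn.toPairFunctor _).map_surjective m'
    exact ⟨Sigma.SigmaHom.mk α, rfl⟩

instance : (pseudoInclusion E C).Faithful where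
  map_injective {F G α β} h := by
    obtain ⟨α⟩ := α
    obtain ⟨β⟩ := β
    exact congrArg _
      ((ObjectProperty.ιOfLE fun _ h => IsGregTensorDelta.of_isPseudo h).map_injective
      ((Sigma.incl (C := fun ob : SpanIso E → C => GregOn ob) _).map_injective h))

instance : (pseudoInclusion E C).Full where
  map_surjective {F G} m := by
    obtain ⟨ob, F⟩ := F
    obtain ⟨ob', G⟩ := G
    obtain rfl : ob = ob' := sigma_fst_eq_of_hom m
    obtain ⟨m', rfl⟩ := (Sigma.incl _).map_surjective m
    obtain ⟨α, rfl⟩ := (ObjectProperty.ιOfLE _).map_surjective m'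
    exact ⟨Sigma.SigmaHom.mk α, rfl⟩

/-- The object of `Greg_{⊗,Δ}(Span_iso(E), C)` attached to a lax Beck pair is sent to a pair
isomorphic to the given one. -/
noncomputable def tensorDeltaObjIso {ob : E → C} {F : PairOn ob} (hF : F.IsLaxBeck) :
    (tensorDelta E C).obj ⟨_, hF.toGreg⟩ ≅ ⟨ob, F⟩ :=
  (Sigma.incl (C := fun ob : E → C => PairOn ob) ob).mapIso
    (asIso (X := hF.toGregPair) (Y := F) hF.comparison)

end EssSurj
end SpanBeck

theorem theorem4 (E : Type u) [Category.{v} E] [SpanBeck.PullbackChoice E]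
    [SpanBeck.PullbackChoice.IsNormal E] (C : Type u₂) [Bicategory.{w₂, v₂} C] :
    (∃ h : ∀ F : SpanBeck.GregTensorDelta E C,
        SpanBeck.isLaxBeckPair E C ((SpanBeck.tensorDelta E C).obj F),
      ((SpanBeck.isLaxBeckPair E C).lift (SpanBeck.tensorDelta E C) h :
        SpanBeck.GregTensorDelta E C ⥤ SpanBeck.LaxBeckPair E C).IsEquivalence) ∧
    (∃ h : ∀ F : SpanBeck.PseudoIcon (SpanBeck.SpanIso E) C,
        SpanBeck.isBeckPair E C
          ((SpanBeck.pseudoInclusion E C ⋙ SpanBeck.tensorDelta E C).obj F),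
      ((SpanBeck.isBeckPair E C).lift (SpanBeck.pseudoInclusion E C ⋙ SpanBeck.tensorDelta E C) h :
        SpanBeck.PseudoIcon (SpanBeck.SpanIso E) C ⥤ SpanBeck.BeckPair E C).IsEquivalence) := by
  have h₁ (F : SpanBeck.GregTensorDelta E C) :
      SpanBeck.isLaxBeckPair E C ((SpanBeck.tensorDelta E C).obj F) :=
    F.2.isLaxBeck_toPair
  have h₂ (F : SpanBeck.PseudoIcon (SpanBeck.SpanIso E) C) : SpanBeck.isBeckPair E C
      ((SpanBeck.pseudoInclusion E C ⋙ SpanBeck.tensorDelta E C).obj F) :=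
    ⟨h₁ _, ((SpanBeck.pseudoInclusion E C).obj F).2.isInvertible_toPair_of_isPseudo F.2.property⟩
  refine ⟨⟨h₁, ?_⟩, ⟨h₂, ?_⟩⟩
  · exact
      { faithful := inferInstance
        full := inferInstance
        essSurj := ⟨fun F => ⟨⟨_, F.property.toGreg⟩,
          ⟨ObjectProperty.isoMk _ (SpanBeck.tensorDeltaObjIso F.property)⟩⟩⟩ }
  · exact
      { faithful := inferInstance
        full := inferInstance
        -- The preimage is the one used for lax Beck pairs; invertible Beck 2-cells make all its
        -- constraints invertible.
        essSurj := ⟨fun F => ⟨⟨_, ⟨F.property.1.toOplaxOn,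
            F.property.1.isPseudo_toOplaxOn F.property.2⟩⟩,
          ⟨ObjectProperty.isoMk _ (SpanBeck.tensorDeltaObjIso F.property.1)⟩⟩⟩ }
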